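/- Let $C>0$, $\alpha>0$, $0\le\beta<1$, let $(\ell,g,L,G)$ be canonical variables (angles $\ell,g$, conjugate momenta $L,G$) on the domain $L>0$, $G>0$, and let $$\mathcal K_\varepsilon=\frac{G^2}{2C}\Big[1+2\alpha\sqrt{1-\beta^2}\,\frac LG\Big(1-\varepsilon\,\frac LG\,\frac{1+\beta\cos2\ell}{2\sqrt{1-\beta^2}}\Big)\Big]=H_0+\varepsilon H_1$$ be the torque-free Hamiltonian in action-angle variables, where $\varepsilon$ is a formal small parameter (the rigid body is $\varepsilon=1$), $$H_0=\frac{G^2}{2C}\Big(1+2\alpha\sqrt{1-\beta^2}\,\frac LG\Big),\qquad H_1=-\frac{L^2}{2C}\,\alpha\,(1+\beta\cos2\ell).$$ *Lie transforms.* A generator $W=\sum_{n\ge0}\frac{\varepsilon^n}{n!}W_{n+1}$ transforms a function $f=\sum_{n\ge0}\frac{\varepsilon^n}{n!}f_{n,0}$ into $\sum_{n\ge0}\frac{\varepsilon^n}{n!}f_{0,n}$, evaluated at the new (primed) variables, where Deprit's triangle is $f_{n,p+1}=f_{n+1,p}+\sum_{j=0}^n\binom nj\{f_{n-j,p};W_{j+1}\}$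 and $\{f;h\}=f_\ell h_L-f_Lh_\ell+f_gh_G-f_Gh_g$. Equivalently, for the generator truncated to $W_1,\dots,W_N$ and up to an error $O(\varepsilon^{N+1})$, the old variables are the solution at time $\varepsilon$ of Hamilton's equations $\dot\ell=W_L$, $\dot g=W_G$, $\dot L=-W_\ell$, $\dot G=-W_g$ that starts at the new variables. We say that $W_1,\dots,W_N$ normalize $\mathcal K$ up to order $N$ if they are smooth functions of $(\ell,L,G)$, $2\pi$-periodic in $\ell$ with vanishing average over $\ell$, and the terms up to order $N$ of the transformed Hamiltonian depend on the momenta only. There are polynomials $q_i$, $g_{i,m}$, $\ell_{i,m}$, $L_{i,m}$ in $\beta^2$ with rational coefficients, independent of $C,\alpha,\beta$ (the triaxiality polynomials), such that the following holds. A sequence $W_1,W_2,\dots$ that normalizes $\mathcal K$ up to every order exists. For every $N\ge0$, if $W_1,\dots,W_{N+1}$ normalize $\mathcal K$ up to order $N+1$, then with $\delta'=\dfrac{L'}{G'}\dfrac1{\sqrt{1-\beta^2}}$ the transformed Hamiltonian is, through order $\varepsilon^{N+1}$, $$\mathcal T=\frac{G'^2}{2C}\Big[1+2\alpha\,\frac{L'}{G'}\sqrt{1-\beta^2}-\varepsilon\,\alpha\,\frac{L'^2}{G'^2}\Big(1+\beta^2\sum_{i=1}^{N}\varepsilon^i\delta'^i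 q_i\Big)\Big],$$ and the transformation equations are $G=G'$ and, through order $\varepsilon^{N+1}$, with $k=\lfloor(i+1)/2\rfloor$, $$g=g'-\frac{L'}{G'}\sum_{i=1}^{N+1}\varepsilon^i\delta'^i\sum_{m=1}^{k}(-\beta)^m g_{i,m}\sin2m\ell',$$ $$\ell=\ell'+\sum_{i=1}^{N+1}\varepsilon^i\delta'^i\sum_{m=1}^{i}(-\beta)^m\ell_{i,m}\sin2m\ell',$$ $$L=L'+L'\sum_{i=1}^{N+1}\varepsilon^i\delta'^i\Big(\beta^2L_{i,0}-\sum_{m=1}^{k}(-\beta)^mL_{i,m}\cos2m\ell'\Big).$$ These hold as identities for the sums computed with Deprit's triangle. Moreover, for every initial point in the domain the canonical transformation obtained as the solution of Hamilton's equations of the truncated generator $\sum_{j=0}^{N}\frac{\varepsilon^j}{j!}W_{j+1}$ exists for small $|\varepsilon|$, leaves $G$ unchanged, and has these expansions (as has $\mathcal K_\varepsilon$ along it) with error $O(\varepsilon^{N+2})$ as $\varepsilon\to0$. The polynomials $q_i$ for $i\le10$, and $g_{i,m}$, $\ell_{i,m}$, $L_{i,m}$ for $i\le9$, are the following. $q_{1}=\tfrac{1}{2},\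 q_{2}=\tfrac{5}{8},\ q_{3}=\tfrac{3}{4}+\tfrac{9}{32}\beta^{2},\ q_{4}=\tfrac{7}{8}+\tfrac{35}{32}\beta^{2},\ q_{5}=1+\tfrac{177}{64}\beta^{2}+\tfrac{45}{128}\beta^{4},\ q_{6}=\tfrac{9}{8}+\tfrac{2925}{512}\beta^{2}+\tfrac{2385}{1024}\beta^{4},\ q_{7}=\tfrac{5}{4}+\tfrac{2675}{256}\beta^{2}+\tfrac{9305}{1024}\beta^{4}+\tfrac{4765}{8192}\beta^{6},\ q_{8}=\tfrac{11}{8}+\tfrac{9009}{512}\beta^{2}+\tfrac{55583}{2048}\beta^{4}+\tfrac{44825}{8192}\beta^{6},\ q_{9}=\tfrac{3}{2}+\tfrac{1785}{64}\beta^{2}+\tfrac{70179}{1024}\beta^{4}+\tfrac{237339}{8192}\beta^{6}+\tfrac{36597}{32768}\beta^{8},\ q_{10}=\tfrac{13}{8}+\tfrac{10803}{256}\beta^{2}+\tfrac{630357}{4096}\beta^{4}+\tfrac{232505}{2048}\beta^{6}+\tfrac{27937}{2048}\beta^{8}$. $g_{1,1}=\tfrac{1}{4}$; $g_{2,1}=\tfrac{1}{2}$;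 $g_{3,1}=\tfrac{3}{4}+\tfrac{3}{8}\beta^{2},\ g_{3,2}=\tfrac{1}{64}$; $g_{4,1}=1+\tfrac{55}{32}\beta^{2},\ g_{4,2}=\tfrac{1}{16}+\tfrac{1}{64}\beta^{2}$; $g_{5,1}=\tfrac{5}{4}+\tfrac{1251}{256}\beta^{2}+\tfrac{765}{1024}\beta^{4},\ g_{5,2}=\tfrac{5}{32}+\tfrac{35}{256}\beta^{2},\ g_{5,3}=\tfrac{1}{768}-\tfrac{1}{3072}\beta^{2}$; $g_{6,1}=\tfrac{3}{2}+\tfrac{1413}{128}\beta^{2}+\tfrac{175}{32}\beta^{4},\ g_{6,2}=\tfrac{5}{16}+\tfrac{79}{128}\beta^{2}+\tfrac{1}{16}\beta^{4},\ g_{6,3}=\tfrac{1}{128}$; $g_{7,1}=\tfrac{7}{4}+\tfrac{5551}{256}\beta^{2}+\tfrac{47367}{2048}\beta^{4}+\tfrac{3471}{2048}\beta^{6},\ g_{7,2}=\tfrac{35}{64}+\tfrac{1025}{512}\beta^{2}+\tfrac{2693}{4096}\beta^{4},\ g_{7,3}=\tfrac{7}{256}+\tfrac{29}{2048}\beta^{2}-\tfrac{1}{2048}\beta^{4},\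 g_{7,4}=\tfrac{1}{8192}-\tfrac{1}{16384}\beta^{2}$; $g_{8,1}=2+\tfrac{1239}{32}\beta^{2}+\tfrac{151301}{2048}\beta^{4}+\tfrac{140383}{8192}\beta^{6},\ g_{8,2}=\tfrac{7}{8}+\tfrac{339}{64}\beta^{2}+\tfrac{239}{64}\beta^{4}+\tfrac{209}{1024}\beta^{6},\ g_{8,3}=\tfrac{7}{96}+\tfrac{19}{192}\beta^{2}+\tfrac{61}{8192}\beta^{4},\ g_{8,4}=\tfrac{1}{1024}-\tfrac{1}{4096}\beta^{2}-\tfrac{1}{16384}\beta^{4}$; $g_{9,1}=\tfrac{9}{4}+\tfrac{8253}{128}\beta^{2}+\tfrac{3236383}{16384}\beta^{4}+\tfrac{3162705}{32768}\beta^{6}+\tfrac{1084959}{262144}\beta^{8},\ g_{9,2}=\tfrac{21}{16}+\tfrac{195}{16}\beta^{2}+\tfrac{62665}{4096}\beta^{4}+\tfrac{43329}{16384}\beta^{6},\ g_{9,3}=\tfrac{21}{128}+\tfrac{1731}{4096}\beta^{2}+\tfrac{7947}{65536}\beta^{4}+\tfrac{81}{65536}\beta^{6},\ g_{9,4}=\tfrac{9}{2048}+\tfrac{15}{16384}\beta^{2}-\tfrac{51}{65536}\beta^{4},\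 g_{9,5}=\tfrac{1}{81920}-\tfrac{3}{327680}\beta^{2}+\tfrac{1}{1310720}\beta^{4}$. $\ell_{1,1}=\tfrac{1}{2}$; $\ell_{2,1}=\tfrac{3}{4},\ \ell_{2,2}=\tfrac{1}{16}$; $\ell_{3,1}=1+\tfrac{15}{32}\beta^{2},\ \ell_{3,2}=\tfrac{3}{16},\ \ell_{3,3}=\tfrac{1}{96}$; $\ell_{4,1}=\tfrac{5}{4}+\tfrac{129}{64}\beta^{2},\ \ell_{4,2}=\tfrac{25}{64}+\tfrac{1}{8}\beta^{2},\ \ell_{4,3}=\tfrac{3}{64},\ \ell_{4,4}=\tfrac{1}{512}$; $\ell_{5,1}=\tfrac{3}{2}+\tfrac{705}{128}\beta^{2}+\tfrac{415}{512}\beta^{4},\ \ell_{5,2}=\tfrac{11}{16}+\tfrac{93}{128}\beta^{2},\ \ell_{5,3}=\tfrac{17}{128}+\tfrac{1}{32}\beta^{2},\ \ell_{5,4}=\tfrac{3}{256},\ \ell_{5,5}=\tfrac{1}{2560}$; $\ell_{6,1}=\tfrac{7}{4}+\tfrac{3101}{256}\beta^{2}+\tfrac{5919}{1024}\beta^{4},\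 \ell_{6,2}=\tfrac{35}{32}+\tfrac{649}{256}\beta^{2}+\tfrac{1179}{4096}\beta^{4},\ \ell_{6,3}=\tfrac{77}{256}+\tfrac{117}{512}\beta^{2},\ \ell_{6,4}=\tfrac{43}{1024}+\tfrac{1}{128}\beta^{2},\ \ell_{6,5}=\tfrac{3}{1024},\ \ell_{6,6}=\tfrac{1}{12288}$; $\ell_{7,1}=2+\tfrac{747}{32}\beta^{2}+\tfrac{24575}{1024}\beta^{4}+\tfrac{14021}{8192}\beta^{6},\ \ell_{7,2}=\tfrac{13}{8}+\tfrac{439}{64}\beta^{2}+\tfrac{10191}{4096}\beta^{4},\ \ell_{7,3}=\tfrac{19}{32}+\tfrac{31}{32}\beta^{2}+\tfrac{359}{4096}\beta^{4},\ \ell_{7,4}=\tfrac{119}{1024}+\tfrac{141}{2048}\beta^{2},\ \ell_{7,5}=\tfrac{13}{1024}+\tfrac{1}{512}\beta^{2},\ \ell_{7,6}=\tfrac{3}{4096},\ \ell_{7,7}=\tfrac{1}{57344}$; $\ell_{8,1}=\tfrac{9}{4}+\tfrac{10521}{256}\beta^{2}+\tfrac{154889}{2048}\beta^{4}+\tfrac{279831}{16384}\beta^{6},\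 \ell_{8,2}=\tfrac{147}{64}+\tfrac{8109}{512}\beta^{2}+\tfrac{200025}{16384}\beta^{4}+\tfrac{1465}{2048}\beta^{6},\ \ell_{8,3}=\tfrac{273}{256}+\tfrac{6363}{2048}\beta^{2}+\tfrac{7281}{8192}\beta^{4},\ \ell_{8,4}=\tfrac{2241}{8192}+\tfrac{1407}{4096}\beta^{2}+\tfrac{423}{16384}\beta^{4},\ \ell_{8,5}=\tfrac{85}{2048}+\tfrac{165}{8192}\beta^{2},\ \ell_{8,6}=\tfrac{61}{16384}+\tfrac{1}{2048}\beta^{2},\ \ell_{8,7}=\tfrac{3}{16384},\ \ell_{8,8}=\tfrac{1}{262144}$; $\ell_{9,1}=\tfrac{5}{2}+\tfrac{4333}{64}\beta^{2}+\tfrac{1639795}{8192}\beta^{4}+\tfrac{3121345}{32768}\beta^{6}+\tfrac{262085}{65536}\beta^{8},\ \ell_{9,2}=\tfrac{25}{8}+\tfrac{131}{4}\beta^{2}+\tfrac{182765}{4096}\beta^{4}+\tfrac{269247}{32768}\beta^{6},\ \ell_{9,3}=\tfrac{343}{192}+\tfrac{17095}{2048}\beta^{2}+\tfrac{82345}{16384}\beta^{4}+\tfrac{32245}{131072}\beta^{6},\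 \ell_{9,4}=\tfrac{589}{1024}+\tfrac{10435}{8192}\beta^{2}+\tfrac{4923}{16384}\beta^{4},\ \ell_{9,5}=\tfrac{929}{8192}+\tfrac{947}{8192}\beta^{2}+\tfrac{487}{65536}\beta^{4},\ \ell_{9,6}=\tfrac{115}{8192}+\tfrac{189}{32768}\beta^{2},\ \ell_{9,7}=\tfrac{35}{32768}+\tfrac{1}{8192}\beta^{2},\ \ell_{9,8}=\tfrac{3}{65536},\ \ell_{9,9}=\tfrac{1}{1179648}$. $L_{1,0}=0,\ L_{1,1}=\tfrac{1}{2}$; $L_{2,0}=\tfrac{1}{4},\ L_{2,1}=\tfrac{1}{2}$; $L_{3,0}=\tfrac{5}{8},\ L_{3,1}=\tfrac{1}{2}+\tfrac{3}{8}\beta^{2},\ L_{3,2}=\tfrac{1}{16}$; $L_{4,0}=\tfrac{9}{8}+\tfrac{27}{64}\beta^{2},\ L_{4,1}=\tfrac{1}{2}+\tfrac{21}{16}\beta^{2},\ L_{4,2}=\tfrac{3}{16}+\tfrac{1}{16}\beta^{2}$; $L_{5,0}=\tfrac{7}{4}+\tfrac{35}{16}\beta^{2},\ L_{5,1}=\tfrac{1}{2}+\tfrac{387}{128}\beta^{2}+\tfrac{297}{512}\beta^{4},\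 L_{5,2}=\tfrac{3}{8}+\tfrac{7}{16}\beta^{2},\ L_{5,3}=\tfrac{1}{128}-\tfrac{1}{512}\beta^{2}$; $L_{6,0}=\tfrac{5}{2}+\tfrac{885}{128}\beta^{2}+\tfrac{225}{256}\beta^{4},\ L_{6,1}=\tfrac{1}{2}+\tfrac{735}{128}\beta^{2}+\tfrac{1835}{512}\beta^{4},\ L_{6,2}=\tfrac{5}{8}+\tfrac{53}{32}\beta^{2}+\tfrac{13}{64}\beta^{4},\ L_{6,3}=\tfrac{5}{128}+\tfrac{1}{512}\beta^{2}$; $L_{7,0}=\tfrac{27}{8}+\tfrac{8775}{512}\beta^{2}+\tfrac{7155}{1024}\beta^{4},\ L_{7,1}=\tfrac{1}{2}+\tfrac{1245}{128}\beta^{2}+\tfrac{13425}{1024}\beta^{4}+\tfrac{2307}{2048}\beta^{6},\ L_{7,2}=\tfrac{15}{16}+\tfrac{297}{64}\beta^{2}+\tfrac{473}{256}\beta^{4},\ L_{7,3}=\tfrac{15}{128}+\tfrac{81}{1024}\beta^{2}-\tfrac{3}{2048}\beta^{4},\ L_{7,4}=\tfrac{1}{1024}-\tfrac{1}{2048}\beta^{2}$;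 $L_{8,0}=\tfrac{35}{8}+\tfrac{18725}{512}\beta^{2}+\tfrac{65135}{2048}\beta^{4}+\tfrac{33355}{16384}\beta^{6},\ L_{8,1}=\tfrac{1}{2}+\tfrac{1953}{128}\beta^{2}+\tfrac{295}{8}\beta^{4}+\tfrac{41149}{4096}\beta^{6},\ L_{8,2}=\tfrac{21}{16}+\tfrac{693}{64}\beta^{2}+\tfrac{9497}{1024}\beta^{4}+\tfrac{599}{1024}\beta^{6},\ L_{8,3}=\tfrac{35}{128}+\tfrac{475}{1024}\beta^{2}+\tfrac{205}{4096}\beta^{4},\ L_{8,4}=\tfrac{7}{1024}-\tfrac{3}{2048}\beta^{2}-\tfrac{1}{2048}\beta^{4}$; $L_{9,0}=\tfrac{11}{2}+\tfrac{9009}{128}\beta^{2}+\tfrac{55583}{512}\beta^{4}+\tfrac{44825}{2048}\beta^{6},\ L_{9,1}=\tfrac{1}{2}+\tfrac{1449}{64}\beta^{2}+\tfrac{720999}{8192}\beta^{4}+\tfrac{828675}{16384}\beta^{6}+\tfrac{321543}{131072}\beta^{8},\ L_{9,2}=\tfrac{7}{4}+\tfrac{357}{16}\beta^{2}+\tfrac{69863}{2048}\beta^{4}+\tfrac{3487}{512}\beta^{6},\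 L_{9,3}=\tfrac{35}{64}+\tfrac{3575}{2048}\beta^{2}+\tfrac{20229}{32768}\beta^{4}+\tfrac{45}{4096}\beta^{6},\ L_{9,4}=\tfrac{7}{256}+\tfrac{35}{4096}\beta^{2}-\tfrac{11}{2048}\beta^{4},\ L_{9,5}=\tfrac{1}{8192}-\tfrac{3}{32768}\beta^{2}+\tfrac{1}{131072}\beta^{4}$. -/

import Mathlib

open Set Filter Topology Asymptotics Polynomial
open scoped ContDiff

noncomputable section

namespace RigidBody

/-- Phase space: a point is `(ℓ, g, L, G)`; the angles are `ℓ, g` and their conjugate momenta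
are `L, G`. -/
abbrev Phase : Type := ℝ × ℝ × ℝ × ℝ

namespace Phase

abbrev ell (x : Phase) : ℝ := x.1
abbrev ang (x : Phase) : ℝ := x.2.1
abbrev momL (x : Phase) : ℝ := x.2.2.1
abbrev momG (x : Phase) : ℝ := x.2.2.2

end Phase

/-- The domain `L > 0`, `G > 0` of the action-angle variables of short-axis-mode rotation. -/
def domain : Set Phase := {x | 0 < x.momL ∧ 0 < x.momG}

/-! ### Partial derivatives, Poisson bracket, Hamiltonian vector fields -/

def partialEll (f : Phase → ℝ) (x : Phase) : ℝ :=
  deriv (fun t => f (t, x.ang, x.momL, x.momG)) x.ell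

def partialAng (f : Phase → ℝ) (x : Phase) : ℝ :=
  deriv (fun t => f (x.ell, t, x.momL, x.momG)) x.ang

def partialL (f : Phase → ℝ) (x : Phase) : ℝ :=
  deriv (fun t => f (x.ell, x.ang, t, x.momG)) x.momL

def partialG (f : Phase → ℝ) (x : Phase) : ℝ :=
  deriv (fun t => f (x.ell, x.ang, x.momL, t)) x.momG

/-- The Poisson bracket `{f, h}` with respect to the canonical pairs `(ℓ, L)` and `(g, G)`. -/
def poisson (f h : Phase → ℝ) (x : Phase) : ℝ :=
  partialEll f x * partialL h x - partialL f x * partialEll h x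
    + (partialAng f x * partialG h x - partialG f x * partialAng h x)

/-- The right-hand side of Hamilton's equations for the function `F`. -/
def hamiltonianField (F : Phase → ℝ) (x : Phase) : Phase :=
  (partialL F x, partialG F x, -partialEll F x, -partialAng F x)

/-! ### The Hamiltonian -/

/-- The torque-free Hamiltonian in action-angle variables, with the formal small parameter `ε` in
front of the perturbation; the free rigid body is `ε = 1`. -/
def hamiltonianK (C α β ε : ℝ) (x : Phase) : ℝ :=
  x.momG ^ 2 / (2 * C) *
    (1 + 2 * α * √(1 - β ^ 2) * (x.momL / x.momG) *
      (1 - ε * (x.momL / x.momG * ((1 + β * Real.cos (2 * x.ell)) / (2 * √(1 - β ^ 2))))))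

/-- The terms `H_n` of `K = ∑ ε ^ n / n! * H_n`: the main problem is `H_0`, the disturbing function
is `H_1`, and the other terms vanish. -/
def hamiltonianTerm (C α β : ℝ) : ℕ → Phase → ℝ
  | 0 => fun x => x.momG ^ 2 / (2 * C) * (1 + 2 * α * √(1 - β ^ 2) * (x.momL / x.momG))
  | 1 => fun x => -(x.momL ^ 2 / (2 * C) * α * (1 + β * Real.cos (2 * x.ell)))
  | _ => fun _ => 0

theorem hamiltonianK_eq {C α β : ℝ} (hβ0 : 0 ≤ β) (hβ1 : β < 1) (ε : ℝ) {x : Phase}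
    (hx : x ∈ domain) :
    hamiltonianK C α β ε x = hamiltonianTerm C α β 0 x + ε * hamiltonianTerm C α β 1 x := by
  have hG : x.momG ≠ 0 := ne_of_gt hx.2
  have hs : √(1 - β ^ 2) ≠ 0 := (Real.sqrt_pos.2 (by nlinarith)).ne'
  have h : ∀ s G L c : ℝ, s ≠ 0 → G ≠ 0 →
      G ^ 2 / (2 * C) * (1 + 2 * α * s * (L / G) * (1 - ε * (L / G * (c / (2 * s))))) =
        G ^ 2 / (2 * C) * (1 + 2 * α * s * (L / G)) + ε * -(L ^ 2 / (2 * C) * α * c) := by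
    intro s G L c h1 h2
    have e : L / G * (c / (2 * s)) * (2 * s) = L / G * c := by field_simp
    have e2 : G * (L / G) = L := by field_simp
    linear_combination (-(G ^ 2 / (2 * C)) * α * (L / G) * ε) * e
      - ε * α * c / (2 * C) * (G * (L / G) + L) * e2
  exact h _ _ _ _ hs hG

/-! ### Deprit's method of Lie transforms -/

/-- Deprit's triangle.  The generator is `∑ ε ^ j / j! * W_(j+1)`, where `W_(j+1)` is stored as
`W j`; the function to be transformed is `∑ ε ^ n / n! * f n`.  The entries are
`f_(n,0) = f n` and `f_(n,q+1) = f_(n+1,q) + ∑ j ≤ n, (n choose j) * {f_(n-j,q), W_(j+1)}`. -/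
def depritTriangle (W f : ℕ → Phase → ℝ) : ℕ → ℕ → Phase → ℝ
  | n, 0 => f n
  | n, q + 1 => fun x =>
      depritTriangle W f (n + 1) q x
        + ∑ j ∈ Finset.range (n + 1),
            (n.choose j : ℝ) * poisson (depritTriangle W f (n - j) q) (W j) x

/-- The transformed function, in the new variables, is `∑ ε ^ n / n! * f_(0,n)`. -/
def depritTransform (W f : ℕ → Phase → ℝ) (n : ℕ) : Phase → ℝ := depritTriangle W f 0 n

/-- Partial sum, up to `ε ^ N`, of the transformed function. -/
def depritSum (W f : ℕ → Phase → ℝ) (N : ℕ) (ε : ℝ) (x : Phase) : ℝ :=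
  ∑ n ∈ Finset.range (N + 1), ε ^ n / (n.factorial : ℝ) * depritTransform W f n x

/-- A function that does not depend on `ε`, as a power series in `ε`. -/
def constTerm (f : Phase → ℝ) : ℕ → Phase → ℝ
  | 0 => f
  | _ => fun _ => 0

/-- `W_1, …, W_N` is a generator that normalizes `K` up to order `N`: the `W_n` are smooth, free of
the ignorable angle `g`, `2π`-periodic in `ℓ` with vanishing average over `ℓ`, and the terms up to
order `N` of the transformed Hamiltonian depend on the momenta only. -/
structure IsDepritNormalization (C α β : ℝ) (N : ℕ) (W : ℕ → Phase → ℝ) : Prop where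
  smooth : ∀ j < N, ContDiffOn ℝ ∞ (W j) domain
  ang_free : ∀ j < N, ∀ x ∈ domain, ∀ g : ℝ, W j (x.ell, g, x.momL, x.momG) = W j x
  periodic : ∀ j < N, ∀ x ∈ domain,
    W j (x.ell + 2 * Real.pi, x.ang, x.momL, x.momG) = W j x
  mean_zero : ∀ j < N, ∀ x ∈ domain,
    ∫ t in (0 : ℝ)..(2 * Real.pi), W j (t, x.ang, x.momL, x.momG) = 0
  normalized : ∀ n ≤ N, ∃ T : ℝ → ℝ → ℝ, ∀ x ∈ domain,
    depritTransform W (hamiltonianTerm C α β) n x = T x.momL x.momG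

/-- The generator `∑ j < N, ε ^ j / j! * W_(j+1)`. -/
def generator (W : ℕ → Phase → ℝ) (N : ℕ) (ε : ℝ) (x : Phase) : ℝ :=
  ∑ j ∈ Finset.range N, ε ^ j / (j.factorial : ℝ) * W j x

/-- `γ ε` is the image of the new variables `x'` under the canonical transformation of Lie type
generated by `∑ j < N, ε ^ j / j! * W_(j+1)`: as a function of `ε` it solves Hamilton's equations of
the generator, starting at `x'`. -/
structure IsLieTransform (W : ℕ → Phase → ℝ) (N : ℕ) (x' : Phase) (γ : ℝ → Phase) : Prop where
  init : γ 0 = x'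
  flow : ∀ᶠ ε in 𝓝 (0 : ℝ), HasDerivAt γ (hamiltonianField (generator W N ε) (γ ε)) ε

/-! ### The series of the solution

The triaxiality polynomials are rational polynomials, evaluated at `β ^ 2`. -/

/-- The value of a triaxiality polynomial. -/
def triax (p : ℚ[X]) (β : ℝ) : ℝ := aeval (β ^ 2) p

def deltaPrime (β : ℝ) (x : Phase) : ℝ := x.momL / x.momG * (1 / √(1 - β ^ 2))

/-- The averaged Hamiltonian with `q_1, …, q_N`. -/
def averaged (C α β : ℝ) (q : ℕ → ℚ[X]) (N : ℕ) (ε : ℝ) (x : Phase) : ℝ :=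
  x.momG ^ 2 / (2 * C) *
    (1 + 2 * α * (x.momL / x.momG) * √(1 - β ^ 2)
      - ε * (α * (x.momL ^ 2 / x.momG ^ 2) *
        (1 + β ^ 2 * ∑ i ∈ Finset.Icc 1 N, ε ^ i * (deltaPrime β x ^ i * triax (q i) β))))

def gSeries (β : ℝ) (g : ℕ → ℕ → ℚ[X]) (N : ℕ) (ε : ℝ) (x : Phase) : ℝ :=
  x.ang - x.momL / x.momG * ∑ i ∈ Finset.Icc 1 N, ε ^ i * (deltaPrime β x ^ i *
    ∑ m ∈ Finset.Icc 1 ((i + 1) / 2), (-β) ^ m * triax (g i m) β * Real.sin (2 * m * x.ell))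

def ellSeries (β : ℝ) (l : ℕ → ℕ → ℚ[X]) (N : ℕ) (ε : ℝ) (x : Phase) : ℝ :=
  x.ell + ∑ i ∈ Finset.Icc 1 N, ε ^ i * (deltaPrime β x ^ i *
    ∑ m ∈ Finset.Icc 1 i, (-β) ^ m * triax (l i m) β * Real.sin (2 * m * x.ell))

def LSeries (β : ℝ) (P : ℕ → ℕ → ℚ[X]) (N : ℕ) (ε : ℝ) (x : Phase) : ℝ :=
  x.momL + x.momL * ∑ i ∈ Finset.Icc 1 N, ε ^ i * (deltaPrime β x ^ i *
    (β ^ 2 * triax (P i 0) β -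
      ∑ m ∈ Finset.Icc 1 ((i + 1) / 2), (-β) ^ m * triax (P i m) β * Real.cos (2 * m * x.ell)))

/-! ### Tables

A triaxiality polynomial is given by the list of its coefficients, constant term first:
`[c₀, c₁, c₂, …]` stands for `c₀ + c₁ * β ^ 2 + c₂ * β ^ 4 + …`. -/

def ofCoeffs : List ℚ → ℚ[X]
  | [] => 0
  | c :: cs => Polynomial.C c + X * ofCoeffs cs

/-- The polynomials `q_i`, `1 ≤ i ≤ 10`. -/
def qTable : ℕ → List ℚ
  | 1 => [1 / 2]
  | 2 => [5 / 8]
  | 3 => [3 / 4, 9 / 32]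
  | 4 => [7 / 8, 35 / 32]
  | 5 => [1, 177 / 64, 45 / 128]
  | 6 => [9 / 8, 2925 / 512, 2385 / 1024]
  | 7 => [5 / 4, 2675 / 256, 9305 / 1024, 4765 / 8192]
  | 8 => [11 / 8, 9009 / 512, 55583 / 2048, 44825 / 8192]
  | 9 => [3 / 2, 1785 / 64, 70179 / 1024, 237339 / 8192, 36597 / 32768]
  | 10 => [13 / 8, 10803 / 256, 630357 / 4096, 232505 / 2048, 27937 / 2048]
  | _ => []

/-- The polynomials `g_(i,m)`, `1 ≤ i ≤ 9`: row `i` lists `m = 1, …, (i + 1) / 2`. -/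
def gTable : ℕ → List (List ℚ)
  | 1 => [[1 / 4]]
  | 2 => [[1 / 2]]
  | 3 => [[3 / 4, 3 / 8], [1 / 64]]
  | 4 => [[1, 55 / 32], [1 / 16, 1 / 64]]
  | 5 => [[5 / 4, 1251 / 256, 765 / 1024], [5 / 32, 35 / 256], [1 / 768, -1 / 3072]]
  | 6 => [[3 / 2, 1413 / 128, 175 / 32], [5 / 16, 79 / 128, 1 / 16], [1 / 128]]
  | 7 => [[7 / 4, 5551 / 256, 47367 / 2048, 3471 / 2048], [35 / 64, 1025 / 512, 2693 / 4096],
         [7 / 256, 29 / 2048, -1 / 2048], [1 / 8192, -1 / 16384]]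
  | 8 => [[2, 1239 / 32, 151301 / 2048, 140383 / 8192],
         [7 / 8, 339 / 64, 239 / 64, 209 / 1024], [7 / 96, 19 / 192, 61 / 8192],
         [1 / 1024, -1 / 4096, -1 / 16384]]
  | 9 => [[9 / 4, 8253 / 128, 3236383 / 16384, 3162705 / 32768, 1084959 / 262144],
         [21 / 16, 195 / 16, 62665 / 4096, 43329 / 16384],
         [21 / 128, 1731 / 4096, 7947 / 65536, 81 / 65536],
         [9 / 2048, 15 / 16384, -51 / 65536], [1 / 81920, -3 / 327680, 1 / 1310720]]
  | _ => []

/-- The polynomials `ℓ_(i,m)`, `1 ≤ i ≤ 9`: row `i` lists `m = 1, …, i`. -/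
def ellTable : ℕ → List (List ℚ)
  | 1 => [[1 / 2]]
  | 2 => [[3 / 4], [1 / 16]]
  | 3 => [[1, 15 / 32], [3 / 16], [1 / 96]]
  | 4 => [[5 / 4, 129 / 64], [25 / 64, 1 / 8], [3 / 64], [1 / 512]]
  | 5 => [[3 / 2, 705 / 128, 415 / 512], [11 / 16, 93 / 128], [17 / 128, 1 / 32], [3 / 256],
         [1 / 2560]]
  | 6 => [[7 / 4, 3101 / 256, 5919 / 1024], [35 / 32, 649 / 256, 1179 / 4096],
         [77 / 256, 117 / 512], [43 / 1024, 1 / 128], [3 / 1024], [1 / 12288]]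
  | 7 => [[2, 747 / 32, 24575 / 1024, 14021 / 8192], [13 / 8, 439 / 64, 10191 / 4096],
         [19 / 32, 31 / 32, 359 / 4096], [119 / 1024, 141 / 2048], [13 / 1024, 1 / 512],
         [3 / 4096], [1 / 57344]]
  | 8 => [[9 / 4, 10521 / 256, 154889 / 2048, 279831 / 16384],
         [147 / 64, 8109 / 512, 200025 / 16384, 1465 / 2048],
         [273 / 256, 6363 / 2048, 7281 / 8192], [2241 / 8192, 1407 / 4096, 423 / 16384],
         [85 / 2048, 165 / 8192], [61 / 16384, 1 / 2048], [3 / 16384], [1 / 262144]]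
  | 9 => [[5 / 2, 4333 / 64, 1639795 / 8192, 3121345 / 32768, 262085 / 65536],
         [25 / 8, 131 / 4, 182765 / 4096, 269247 / 32768],
         [343 / 192, 17095 / 2048, 82345 / 16384, 32245 / 131072],
         [589 / 1024, 10435 / 8192, 4923 / 16384], [929 / 8192, 947 / 8192, 487 / 65536],
         [115 / 8192, 189 / 32768], [35 / 32768, 1 / 8192], [3 / 65536], [1 / 1179648]]
  | _ => []

/-- The polynomials `L_(i,m)`, `1 ≤ i ≤ 9`: row `i` lists `m = 0, …, (i + 1) / 2`. -/
def LTable : ℕ → List (List ℚ)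
  | 1 => [[0], [1 / 2]]
  | 2 => [[1 / 4], [1 / 2]]
  | 3 => [[5 / 8], [1 / 2, 3 / 8], [1 / 16]]
  | 4 => [[9 / 8, 27 / 64], [1 / 2, 21 / 16], [3 / 16, 1 / 16]]
  | 5 => [[7 / 4, 35 / 16], [1 / 2, 387 / 128, 297 / 512], [3 / 8, 7 / 16], [1 / 128, -1 / 512]]
  | 6 => [[5 / 2, 885 / 128, 225 / 256], [1 / 2, 735 / 128, 1835 / 512],
         [5 / 8, 53 / 32, 13 / 64], [5 / 128, 1 / 512]]
  | 7 => [[27 / 8, 8775 / 512, 7155 / 1024], [1 / 2, 1245 / 128, 13425 / 1024, 2307 / 2048],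
         [15 / 16, 297 / 64, 473 / 256], [15 / 128, 81 / 1024, -3 / 2048],
         [1 / 1024, -1 / 2048]]
  | 8 => [[35 / 8, 18725 / 512, 65135 / 2048, 33355 / 16384],
         [1 / 2, 1953 / 128, 295 / 8, 41149 / 4096],
         [21 / 16, 693 / 64, 9497 / 1024, 599 / 1024], [35 / 128, 475 / 1024, 205 / 4096],
         [7 / 1024, -3 / 2048, -1 / 2048]]
  | 9 => [[11 / 2, 9009 / 128, 55583 / 512, 44825 / 2048],
         [1 / 2, 1449 / 64, 720999 / 8192, 828675 / 16384, 321543 / 131072],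
         [7 / 4, 357 / 16, 69863 / 2048, 3487 / 512],
         [35 / 64, 3575 / 2048, 20229 / 32768, 45 / 4096], [7 / 256, 35 / 4096, -11 / 2048],
         [1 / 8192, -3 / 32768, 1 / 131072]]
  | _ => []

end RigidBody

end

/-! Put `z = -β exp(2iℓ)` and `z̄ = -β exp(-2iℓ)`. Drop the term `G²/(2C)`, divide by `α√(1-β²)/C`
and absorb `σ = 1/√(1-β²)` into `ε`. The Hamiltonian becomes `L G - ε L² (1 - (z + z̄)/2)/2`, a
power series over the `ℚ`-algebra of Laurent monomials in `L, G` and monomials in `z, z̄`. No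
parameter is left, so the normalization takes place over `ℚ`, and `β` returns only through `z z̄ =
β²` and the harmonics `z^m`, `z̄^m`. This is why the triaxiality polynomials are rational
polynomials in `β²`.

Column `p` of Deprit's triangle is the `p`-th power of `D f = ∂f/∂ε + {f, W}`. Since `D` is a
derivation of both the product and the bracket, the transform is a homomorphism for both
(`transform_mul`, `transform_bracket`). A similar commutator computation handles derivatives with
respect to the momenta and brings in the corrections to the angles (`transform_coeffwise`). The
generator is built order by order by solving the homological equation (`dTheta_lieT_serK`).
Everything is homogeneous in `L` and `G`, so one may set `L = G = 1`, and derivatives with respect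
to the momenta become multiplication by the degree.

Transporting the energy and Hamilton's equations gives identities between the averaged Hamiltonian
`tK`, the frequency `tN`, the momentum `tU`, the exponentials `tZ`, `tZb` and the angle corrections
`tLam`, `tGam`, in which `W` no longer appears. They give the shape of the solution. Reflection of
the angle separates sines from cosines. Elimination of `tZ` and `tZb` leaves a second-order equation
for `tU`, whose nonlinearity bounds the harmonics (`harmBound_X_mul_tU`). Putting `β = 0` shows that
the angle-free parts carry a factor `β²` (`constSeries_tU`).

The explicit values come from two relations `relU`, `relLam` that determine `tU`, `tK` and `tLam`
recursively once the first order is known (`coeff_eq_of_rel`), and from `relGam` for `tGam`. That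
the tables satisfy these relations is a finite computation with rational numbers, done by the
kernel.

Evaluation at a point of phase space turns the formal generator into the real generator `genW`,
which normalizes to every order (`isDepritNormalization_genW`). Any other normalization agrees with
it on the domain, because periodicity and vanishing mean leave no freedom
(`IsDepritNormalization.eqOn`). Finally, the columns of the triangle, evaluated along the flow, are
successive derivatives up to small errors. Integrating from the last column back to the first gives
the Taylor expansion with its remainder (`sum_comp_sub_depritSum_isBigO`). -/

noncomputable section

namespace RigidBody

/-! ### Formal Lie transforms over an algebra with two commuting derivations -/

namespace LieSeries

variable {A : Type*} [CommRing A] [Algebra ℚ A]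

/-- A derivation of `A`, applied to the coefficients of a power series. -/
def coeffwise (d : Derivation ℚ A A) : Derivation ℚ (PowerSeries A) (PowerSeries A) :=
  Derivation.mk'
    { toFun := fun f => PowerSeries.mk fun n => d (PowerSeries.coeff n f)
      map_add' := fun f g => by ext n; simp
      map_smul' := fun r f => by ext n; simp }
    (fun f g => by
      ext n
      simp only [LinearMap.coe_mk, AddHom.coe_mk, PowerSeries.coeff_mk, PowerSeries.coeff_mul,
        map_sum, Derivation.leibniz, smul_eq_mul, map_add, Finset.sum_add_distrib]
      congr 1
      rw [← Finset.Nat.sum_antidiagonal_swap]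
      simp only [Prod.fst_swap, Prod.snd_swap])

@[simp] theorem coeff_coeffwise (d : Derivation ℚ A A) (f : PowerSeries A) (n : ℕ) :
    PowerSeries.coeff n (coeffwise d f) = d (PowerSeries.coeff n f) := by
  simp [coeffwise]

theorem coeffwise_C (d : Derivation ℚ A A) (a : A) :
    coeffwise d (PowerSeries.C a) = PowerSeries.C (d a) := by
  ext n
  rw [coeff_coeffwise, PowerSeries.coeff_C, PowerSeries.coeff_C]
  split <;> simp

theorem coeffwise_X (d : Derivation ℚ A A) : coeffwise d (PowerSeries.X : PowerSeries A) = 0 := by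
  ext n
  rw [coeff_coeffwise, PowerSeries.coeff_X]
  split <;> simp

/-- Differentiation with respect to the variable of the power series. -/
def ddε : Derivation ℚ (PowerSeries A) (PowerSeries A) :=
  (PowerSeries.derivative A).restrictScalars ℚ

theorem coeff_ddε (f : PowerSeries A) (n : ℕ) :
    PowerSeries.coeff n (ddε f) = PowerSeries.coeff (n + 1) f * (n + 1) :=
  PowerSeries.coeff_derivative f n

theorem ddε_X : ddε (PowerSeries.X : PowerSeries A) = 1 := PowerSeries.derivative_X

theorem ddε_coeffwise (d : Derivation ℚ A A) (f : PowerSeries A) :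
    ddε (coeffwise d f) = coeffwise d (ddε f) := by
  ext n
  rw [coeff_ddε, coeff_coeffwise, coeff_coeffwise, coeff_ddε, Derivation.leibniz]
  have : d ((n : A) + 1) = 0 := by
    have := d.map_natCast (n + 1)
    push_cast at this
    exact this
  rw [this]; simp [mul_comm]

theorem coeffwise_comm {d e : Derivation ℚ A A} (h : ∀ a, d (e a) = e (d a)) (f : PowerSeries A) :
    coeffwise d (coeffwise e f) = coeffwise e (coeffwise d f) := by
  ext n; simp [h]

variable (p q : Derivation ℚ A A)

/-- The Poisson bracket for which the derivations `p`, `q` are the partial derivatives with respect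
to a canonical pair. -/
def bracket (f h : PowerSeries A) : PowerSeries A :=
  coeffwise p f * coeffwise q h - coeffwise q f * coeffwise p h

/-- The derivative along the flow of the time-dependent Hamiltonian `W`. -/
def lieDeriv (W : PowerSeries A) : Module.End ℚ (PowerSeries A) :=
  { toFun := fun f => ddε f + bracket p q f W
    map_add' := fun f g => by simp only [bracket, map_add]; ring
    map_smul' := fun r f => by
      simp only [bracket, Derivation.map_smul, smul_mul_assoc, RingHom.id_apply, smul_add, smul_sub] }

/-- The bracket with a fixed first argument. -/
def bracketLeft (f : PowerSeries A) : Module.End ℚ (PowerSeries A) :=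
  { toFun := fun h => bracket p q f h
    map_add' := fun f g => by simp only [bracket, map_add]; ring
    map_smul' := fun r f => by
      simp only [bracket, Derivation.map_smul, mul_smul_comm, RingHom.id_apply, smul_sub] }

theorem bracketLeft_apply (f h : PowerSeries A) : bracketLeft p q f h = bracket p q f h := rfl

theorem lieDeriv_apply (W f : PowerSeries A) :
    lieDeriv p q W f = ddε f + bracket p q f W := rfl

/-- The Lie transform generated by `W`. -/
def transform (W : PowerSeries A) : PowerSeries A →ₗ[ℚ] PowerSeries A :=
  { toFun := fun f => PowerSeries.mk fun n =>
      (1 / (n.factorial : ℚ)) • PowerSeries.coeff 0 ((lieDeriv p q W ^ n) f)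
    map_add' := fun f g => by ext n; simp
    map_smul' := fun r f => by
      ext n
      simp only [map_smul, PowerSeries.coeff_mk, RingHom.id_apply]
      rw [LinearMap.map_smul_of_tower, LinearMap.map_smul_of_tower, PowerSeries.coeff_mk,
        smul_comm] }

variable {p q} {W : PowerSeries A}

theorem coeff_transform (f : PowerSeries A) (n : ℕ) :
    PowerSeries.coeff n (transform p q W f) =
      (1 / (n.factorial : ℚ)) • PowerSeries.coeff 0 ((lieDeriv p q W ^ n) f) := by
  simp [transform]

/-- Leibniz' rule for a sequence of operators that arises by commutation with an operator. -/
theorem pow_mul_leibniz {E : Type*} [AddCommGroup E] [Module ℚ E] (D : Module.End ℚ E)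
    (B : ℕ → Module.End ℚ E) (hB : ∀ i, D * B i = B (i + 1) + B i * D) (n : ℕ) :
    D ^ n * B 0 = ∑ ij ∈ Finset.HasAntidiagonal.antidiagonal n, n.choose ij.1 • (B ij.1 * D ^ ij.2) := by
  induction n with
  | zero => simp
  | succ n ih =>
    rw [Finset.sum_antidiagonal_choose_succ_nsmul (fun i j => B i * D ^ j) n, pow_succ', mul_assoc,
      ih, Finset.mul_sum, ← Finset.sum_add_distrib]
    refine Finset.sum_congr rfl fun ij hij => ?_
    have h := Finset.HasAntidiagonal.mem_antidiagonal.1 hij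
    rw [mul_smul_comm, ← mul_assoc, hB, add_mul, smul_add, add_comm, mul_assoc, ← pow_succ',
      show n.choose ij.2 = n.choose ij.1 from by
        rw [← h, Nat.choose_symm_add]]

theorem choose_smul_factorial (n : ℕ) (ij : ℕ × ℕ) (h : ij ∈ Finset.HasAntidiagonal.antidiagonal n) :
    (1 / (n.factorial : ℚ)) * (n.choose ij.1 : ℚ) =
      1 / (ij.1.factorial : ℚ) * (1 / (ij.2.factorial : ℚ)) := by
  rw [Finset.HasAntidiagonal.mem_antidiagonal] at h
  subst h
  rw [Nat.choose_symm_add, Nat.add_choose]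
  have h1 := Nat.factorial_ne_zero ij.1
  have h2 := Nat.factorial_ne_zero ij.2
  have h3 := Nat.factorial_ne_zero (ij.1 + ij.2)
  rw [Nat.cast_div (Nat.factorial_mul_factorial_dvd_factorial_add _ _) (by positivity)]
  field_simp
  push_cast; ring

/-- The factorials in the definition of the transform absorb the binomial coefficients of Leibniz'
rule. Three choices of `B` are used: multiplication by a series, the bracket with a series, and the
derivative with respect to a momentum. -/
theorem coeff_transform_leibniz (B : ℕ → Module.End ℚ (PowerSeries A))
    (hB : ∀ i, lieDeriv p q W * B i = B (i + 1) + B i * lieDeriv p q W) (f : PowerSeries A)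
    (n : ℕ) :
    PowerSeries.coeff n (transform p q W (B 0 f)) =
      ∑ ij ∈ Finset.HasAntidiagonal.antidiagonal n, (1 / (ij.1.factorial : ℚ) * (1 / (ij.2.factorial : ℚ))) •
        PowerSeries.coeff 0 (B ij.1 ((lieDeriv p q W ^ ij.2) f)) := by
  rw [coeff_transform, ← Module.End.mul_apply, pow_mul_leibniz _ B hB, LinearMap.sum_apply,
    map_sum, Finset.smul_sum]
  refine Finset.sum_congr rfl fun ij hij => ?_
  rw [LinearMap.smul_apply, map_nsmul, ← Nat.cast_smul_eq_nsmul ℚ, smul_smul,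
    choose_smul_factorial n ij hij, Module.End.mul_apply]

theorem lieDeriv_mul (f g : PowerSeries A) :
    lieDeriv p q W (f * g) = lieDeriv p q W f * g + f * lieDeriv p q W g := by
  simp only [lieDeriv_apply, bracket, Derivation.leibniz, smul_eq_mul]
  ring

/-- `lieDeriv` is a derivation, and the exponential of a derivation is multiplicative. -/
theorem transform_mul (f g : PowerSeries A) :
    transform p q W (f * g) = transform p q W f * transform p q W g := by
  ext n
  have := coeff_transform_leibniz (p := p) (q := q) (W := W)
    (fun i => LinearMap.mulLeft ℚ ((lieDeriv p q W ^ i) f))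
    (fun i => by
      ext1 h
      simp only [Module.End.mul_apply, LinearMap.mulLeft_apply, LinearMap.add_apply,
        lieDeriv_mul, pow_succ']) g n
  simp only [pow_zero, LinearMap.mulLeft_apply, Module.End.one_apply] at this
  rw [this, PowerSeries.coeff_mul]
  refine Finset.sum_congr rfl fun ij _ => ?_
  rw [coeff_transform, coeff_transform, PowerSeries.coeff_mul, Finset.Nat.antidiagonal_zero,
    Finset.sum_singleton, smul_mul_smul_comm]

theorem coeff_zero_transform (f : PowerSeries A) :
    PowerSeries.coeff 0 (transform p q W f) = PowerSeries.coeff 0 f := by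
  rw [coeff_transform]; simp

/-- This is the differential equation of the flow: differentiating in `ε` inserts one further power
of `lieDeriv`. It permits inductions on the order in place of computations with factorials. -/
theorem ddε_transform (f : PowerSeries A) :
    ddε (transform p q W f) = transform p q W (lieDeriv p q W f) := by
  ext n
  have h : ((n : A) + 1) = algebraMap ℚ A (n + 1) := by simp
  rw [coeff_ddε, coeff_transform, coeff_transform, pow_succ, Module.End.mul_apply, h, mul_comm,
    ← Algebra.smul_def, smul_smul, Nat.factorial_succ]
  congr 1
  have h1 := Nat.factorial_ne_zero n
  push_cast
  field_simp

/-- The correction by which the transform of a canonical variable differs from the variable, if the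
bracket with the variable is the derivation `r`. -/
def correction (p q r : Derivation ℚ A A) (W : PowerSeries A) : PowerSeries A :=
  PowerSeries.mk fun n => if n = 0 then 0 else
    (1 / (n.factorial : ℚ)) • PowerSeries.coeff 0 ((lieDeriv p q W ^ (n - 1)) (coeffwise r W))

theorem coeff_correction_succ (r : Derivation ℚ A A) (n : ℕ) :
    PowerSeries.coeff (n + 1) (correction p q r W) = (1 / ((n + 1).factorial : ℚ)) •
      PowerSeries.coeff 0 ((lieDeriv p q W ^ n) (coeffwise r W)) := by
  simp [correction]

theorem coeff_zero_correction (r : Derivation ℚ A A) :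
    PowerSeries.coeff 0 (correction p q r W) = 0 := by
  simp [correction]

theorem ddε_correction (r : Derivation ℚ A A) :
    ddε (correction p q r W) = transform p q W (coeffwise r W) := by
  ext n
  have h : ((n : A) + 1) = algebraMap ℚ A (n + 1) := by simp
  rw [coeff_ddε, coeff_correction_succ, coeff_transform, h, mul_comm, ← Algebra.smul_def,
    smul_smul, Nat.factorial_succ]
  congr 1
  have h1 := Nat.factorial_ne_zero n
  push_cast
  field_simp

theorem ddε_pow_coeff (f : PowerSeries A) (n k : ℕ) :
    PowerSeries.coeff k ((((ddε : Derivation ℚ (PowerSeries A) (PowerSeries A)) :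
      PowerSeries A →ₗ[ℚ] PowerSeries A) ^ n) f) =
      ((n + k).descFactorial n : ℚ) • PowerSeries.coeff (n + k) f := by
  induction n generalizing k with
  | zero => simp
  | succ n ih =>
    have h : ((k : A) + 1) = algebraMap ℚ A (k + 1) := by simp
    rw [pow_succ', Module.End.mul_apply, Derivation.coeFn_coe, coeff_ddε, ih, h, mul_comm,
      ← Algebra.smul_def, smul_smul, show n + (k + 1) = n + 1 + k by ring]
    congr 1
    rw [Nat.descFactorial_succ, show n + 1 + k - n = k + 1 by omega]
    push_cast; ring

/-- Series with vanishing partial derivatives are fixed by the Lie transform. -/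
theorem transform_eq_self {f : PowerSeries A} (hp : coeffwise p f = 0) (hq : coeffwise q f = 0) :
    transform p q W f = f := by
  have key : ∀ n, (lieDeriv p q W ^ n) f = (((ddε : Derivation ℚ (PowerSeries A) (PowerSeries A)) :
      PowerSeries A →ₗ[ℚ] PowerSeries A) ^ n) f ∧
      coeffwise p ((lieDeriv p q W ^ n) f) = 0 ∧ coeffwise q ((lieDeriv p q W ^ n) f) = 0 := by
    intro n
    induction n with
    | zero => exact ⟨rfl, hp, hq⟩
    | succ n ih =>
      obtain ⟨h1, h2, h3⟩ := ih
      have : (lieDeriv p q W ^ (n + 1)) f = ddε ((lieDeriv p q W ^ n) f) := by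
        rw [pow_succ', Module.End.mul_apply, lieDeriv_apply, bracket, h2, h3]; ring
      refine ⟨?_, ?_, ?_⟩
      · rw [this, h1, pow_succ', Module.End.mul_apply, Derivation.coeFn_coe]
      · rw [this, ← ddε_coeffwise, h2, map_zero]
      · rw [this, ← ddε_coeffwise, h3, map_zero]
  ext n
  rw [coeff_transform, (key n).1, ddε_pow_coeff, smul_smul, Nat.add_zero, Nat.descFactorial_self,
    one_div_mul_cancel (by exact_mod_cast n.factorial_ne_zero), one_smul]

theorem transform_X_mul (f : PowerSeries A) :
    transform p q W (PowerSeries.X * f) = PowerSeries.X * transform p q W f := by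
  rw [transform_mul, transform_eq_self (coeffwise_X p) (coeffwise_X q)]

theorem transform_one : transform p q W 1 = 1 :=
  transform_eq_self (by simp) (by simp)

theorem coeffwise_X_pow_mul (d : Derivation ℚ A A) (n : ℕ) (f : PowerSeries A) :
    coeffwise d (PowerSeries.X ^ n * f) = PowerSeries.X ^ n * coeffwise d f := by
  rw [Derivation.leibniz, Derivation.leibniz_pow, coeffwise_X]
  simp

theorem transform_X_pow_mul (n : ℕ) (f : PowerSeries A) :
    transform p q W (PowerSeries.X ^ n * f) = PowerSeries.X ^ n * transform p q W f := by
  induction n generalizing f with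
  | zero => simp
  | succ n ih => rw [pow_succ, mul_assoc, ih, transform_X_mul, mul_assoc]

/-- Two generators that agree below the order `n` give transforms that agree up to the order `n`. -/
theorem coeff_transform_congr {W W' : PowerSeries A} {n : ℕ} (h : PowerSeries.X ^ n ∣ W - W')
    {m : ℕ} (hm : m ≤ n) (f : PowerSeries A) :
    PowerSeries.coeff m (transform p q W f) = PowerSeries.coeff m (transform p q W' f) := by
  obtain ⟨V, hV⟩ := h
  induction m generalizing f with
  | zero => rw [coeff_zero_transform, coeff_zero_transform]
  | succ m ih =>
    have h1 : ∀ W, PowerSeries.coeff (m + 1) (transform p q W f) =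
        (1 / (m + 1 : ℚ)) • PowerSeries.coeff m (transform p q W (lieDeriv p q W f)) := by
      intro W
      have h : ((m : A) + 1) = algebraMap ℚ A (m + 1) := by simp
      rw [← ddε_transform, coeff_ddε, h, mul_comm, ← Algebra.smul_def, smul_smul,
        one_div_mul_cancel (by positivity), one_smul]
    rw [h1, h1, ih (by omega)]
    congr 1
    have h2 : lieDeriv p q W f = lieDeriv p q W' f + PowerSeries.X ^ n * bracket p q f V := by
      have : W = W' + PowerSeries.X ^ n * V := by rw [← hV]; ring
      rw [lieDeriv_apply, lieDeriv_apply, this]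
      simp only [bracket, map_add, coeffwise_X_pow_mul]; ring
    rw [h2, map_add, map_add, transform_X_pow_mul, PowerSeries.coeff_X_pow_mul',
      if_neg (by omega), add_zero]

/-- The effect of the leading term of the generator on the first order that it reaches. -/
theorem coeff_succ_transform_congr {W W' : PowerSeries A} {n : ℕ}
    (h : PowerSeries.X ^ n ∣ W - W') (f : PowerSeries A) :
    (n + 1 : A) * PowerSeries.coeff (n + 1) (transform p q W f) =
      (n + 1 : A) * PowerSeries.coeff (n + 1) (transform p q W' f) +
        (p (PowerSeries.coeff 0 f) * q (PowerSeries.coeff n (W - W')) -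
          q (PowerSeries.coeff 0 f) * p (PowerSeries.coeff n (W - W'))) := by
  have h1 : ∀ W, (n + 1 : A) * PowerSeries.coeff (n + 1) (transform p q W f) =
      PowerSeries.coeff n (transform p q W (lieDeriv p q W f)) := by
    intro W
    rw [← ddε_transform, coeff_ddε, mul_comm]
  rw [h1, h1, coeff_transform_congr h le_rfl]
  obtain ⟨V, hV⟩ := h
  have h2 : lieDeriv p q W f = lieDeriv p q W' f + PowerSeries.X ^ n * bracket p q f V := by
    have : W = W' + PowerSeries.X ^ n * V := by rw [← hV]; ring
    rw [lieDeriv_apply, lieDeriv_apply, this]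
    simp only [bracket, map_add, coeffwise_X_pow_mul]; ring
  rw [h2, map_add, map_add, transform_X_pow_mul, PowerSeries.coeff_X_pow_mul', if_pos le_rfl, hV,
    PowerSeries.coeff_X_pow_mul', if_pos le_rfl, Nat.sub_self, coeff_zero_transform, bracket]
  simp [PowerSeries.coeff_mul, -PowerSeries.coeff_zero_eq_constantCoeff]

/-- An anticanonical involution that reverses the generator commutes with the Lie transform. -/
theorem map_transform (s : A →ₐ[ℚ] A) (hp : ∀ a, s (p a) = -p (s a)) (hq : ∀ a, s (q a) = q (s a))
    (hW : PowerSeries.map (s : A →+* A) W = -W) (f : PowerSeries A) :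
    PowerSeries.map (s : A →+* A) (transform p q W f) =
      transform p q W (PowerSeries.map (s : A →+* A) f) := by
  have hD : ∀ f, PowerSeries.map (s : A →+* A) (lieDeriv p q W f) =
      lieDeriv p q W (PowerSeries.map (s : A →+* A) f) := by
    intro f
    have e1 : ∀ f, PowerSeries.map (s : A →+* A) (coeffwise p f) =
        -coeffwise p (PowerSeries.map (s : A →+* A) f) := by intro f; ext n; simp [hp]
    have e2 : ∀ f, PowerSeries.map (s : A →+* A) (coeffwise q f) =
        coeffwise q (PowerSeries.map (s : A →+* A) f) := by intro f; ext n; simp [hq]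
    have e3 : PowerSeries.map (s : A →+* A) (ddε f) = ddε (PowerSeries.map (s : A →+* A) f) := by
      ext n; simp [coeff_ddε]
    rw [lieDeriv_apply, lieDeriv_apply, bracket, bracket, map_add, map_sub, map_mul, map_mul, e1,
      e2, e1, e2, e3, hW, map_neg, map_neg]
    ring
  have hDn : ∀ n, PowerSeries.map (s : A →+* A) ((lieDeriv p q W ^ n) f) =
      (lieDeriv p q W ^ n) (PowerSeries.map (s : A →+* A) f) := by
    intro n
    induction n with
    | zero => rfl
    | succ n ih =>
      rw [pow_succ', Module.End.mul_apply, Module.End.mul_apply, hD, ih]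
  ext n
  rw [PowerSeries.coeff_map, coeff_transform, coeff_transform, ← hDn, PowerSeries.coeff_map]
  exact map_smul s _ _

section Comm

variable (hpq : ∀ a, p (q a) = q (p a))
include hpq

/-- This is the Jacobi identity together with the fact that `∂/∂ε` acts on coefficients only. The
Jacobi identity is where the two derivations have to commute. -/
theorem lieDeriv_bracket (f g : PowerSeries A) :
    lieDeriv p q W (bracket p q f g) =
      bracket p q (lieDeriv p q W f) g + bracket p q f (lieDeriv p q W g) := by
  have h := fun f => coeffwise_comm (A := A) hpq f
  simp only [lieDeriv_apply, bracket, Derivation.leibniz, smul_eq_mul, map_sub, map_add,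
    ddε_coeffwise, h]
  ring

/-- Canonicity of the Lie transform: `lieDeriv` is a derivation of the bracket, so its exponential
preserves the bracket. -/
theorem transform_bracket (f g : PowerSeries A) :
    transform p q W (bracket p q f g) =
      bracket p q (transform p q W f) (transform p q W g) := by
  ext n
  have := coeff_transform_leibniz (p := p) (q := q) (W := W)
    (fun i => bracketLeft p q ((lieDeriv p q W ^ i) f))
    (fun i => by
      ext1 h
      simp only [Module.End.mul_apply, LinearMap.add_apply, bracketLeft_apply,
        lieDeriv_bracket hpq, pow_succ']) g n
  simp only [bracketLeft_apply, pow_zero, Module.End.one_apply] at this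
  rw [this]
  simp only [bracket, map_sub, PowerSeries.coeff_mul, coeff_coeffwise, coeff_transform,
    Derivation.map_smul, smul_mul_smul_comm, smul_sub, Finset.sum_sub_distrib,
    Finset.Nat.antidiagonal_zero, Finset.sum_singleton]

/-- The transform of the bracket with a canonical variable. -/
theorem transform_coeffwise {r : Derivation ℚ A A} (hr : ∀ a, r (p a) = p (r a))
    (hr' : ∀ a, r (q a) = q (r a)) (f : PowerSeries A) :
    transform p q W (coeffwise r f) = coeffwise r (transform p q W f) +
      bracket p q (correction p q r W) (transform p q W f) := by
  ext n
  -- `lieDeriv` does not commute with `r`: the commutator is the bracket with `r W`. So the sequence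
  -- starts with `r` and continues with brackets with the iterates of `r W`, which are the
  -- coefficients of the correction.
  let B : ℕ → Module.End ℚ (PowerSeries A) := fun i =>
    Nat.casesOn i (coeffwise r : PowerSeries A →ₗ[ℚ] PowerSeries A)
      fun i => bracketLeft p q ((lieDeriv p q W ^ i) (coeffwise r W))
  have hB0 : B 0 = (coeffwise r : PowerSeries A →ₗ[ℚ] PowerSeries A) := rfl
  have hB1 : ∀ i, B (i + 1) = bracketLeft p q ((lieDeriv p q W ^ i) (coeffwise r W)) :=
    fun i => rfl
  have h1 := fun f => coeffwise_comm (A := A) hr f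
  have h2 := fun f => coeffwise_comm (A := A) hr' f
  have := coeff_transform_leibniz (p := p) (q := q) (W := W) B
    (fun i => by
      ext1 h
      cases i with
      | zero =>
        simp only [hB0, hB1, Module.End.mul_apply, LinearMap.add_apply, bracketLeft_apply,
          pow_zero, Module.End.one_apply, Derivation.coeFn_coe, lieDeriv_apply, bracket,
          ddε_coeffwise, map_add, map_sub, Derivation.leibniz, h1, h2, smul_eq_mul]
        ring
      | succ i =>
        simp only [hB1, Module.End.mul_apply, LinearMap.add_apply, bracketLeft_apply,
          lieDeriv_bracket hpq, pow_succ']) f n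
  rw [hB0, Derivation.coeFn_coe] at this
  rw [this]
  cases n with
  | zero =>
    simp [hB0, bracket, PowerSeries.coeff_mul, coeff_zero_correction, coeff_zero_transform,
      -PowerSeries.coeff_zero_eq_constantCoeff]
  | succ n =>
    rw [Finset.Nat.sum_antidiagonal_succ]
    simp only [hB0, hB1, bracketLeft_apply, bracket, map_sub, map_add, PowerSeries.coeff_mul,
      coeff_coeffwise, coeff_transform, Derivation.map_smul, smul_mul_smul_comm, smul_sub,
      Finset.sum_sub_distrib, Finset.Nat.antidiagonal_zero, Finset.sum_singleton,
      Finset.Nat.sum_antidiagonal_succ, coeff_zero_correction, coeff_correction_succ, map_zero,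
      zero_mul, zero_add, Derivation.coeFn_coe, Nat.factorial_zero, Nat.cast_one, one_div_one,
      one_mul]

end Comm

end LieSeries
end RigidBody
end

noncomputable section

namespace RigidBody

/-! ### Diagonal operators on monoid algebras -/

section Diagonal

variable {Γ : Type*}

/-- The operator that multiplies the coefficient of the monomial `g` by `m g`. -/
def diag (m : Γ → ℚ) : AddMonoidAlgebra ℚ Γ →ₗ[ℚ] AddMonoidAlgebra ℚ Γ where
  toFun f := .ofCoeff (Finsupp.onFinset f.coeff.support (fun g => m g * f.coeff g) fun g hg =>
    Finsupp.mem_support_iff.2 (right_ne_zero_of_mul hg))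
  map_add' f h := by ext g; simp [mul_add]
  map_smul' r f := by ext g; simp [mul_left_comm]

@[simp] theorem coeff_diag (m : Γ → ℚ) (f : AddMonoidAlgebra ℚ Γ) (g : Γ) :
    (diag m f).coeff g = m g * f.coeff g := rfl

theorem diag_single (m : Γ → ℚ) (g : Γ) (r : ℚ) :
    diag m (AddMonoidAlgebra.single g r) = AddMonoidAlgebra.single g (m g * r) := by
  classical
  ext g'
  rw [coeff_diag, AddMonoidAlgebra.coeff_single, AddMonoidAlgebra.coeff_single,
    Finsupp.single_apply, Finsupp.single_apply]
  split
  · rename_i h; rw [h]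
  · simp

theorem diag_diag (m m' : Γ → ℚ) (f : AddMonoidAlgebra ℚ Γ) :
    diag m (diag m' f) = diag (fun g => m g * m' g) f := by
  ext g; simp [mul_assoc]

theorem diag_comm (m m' : Γ → ℚ) (f : AddMonoidAlgebra ℚ Γ) :
    diag m (diag m' f) = diag m' (diag m f) := by
  ext g; simp [mul_left_comm]

variable [AddCommMonoid Γ]

/-- The derivation that multiplies each monomial by its degree. -/
def degreeDerivation (m : Γ →+ ℚ) :
    Derivation ℚ (AddMonoidAlgebra ℚ Γ) (AddMonoidAlgebra ℚ Γ) :=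
  Derivation.mk' (diag m) (fun f h => by
    induction f using AddMonoidAlgebra.induction_linear with
    | zero => simp
    | add f₁ f₂ h₁ h₂ => simp only [add_mul, map_add, h₁, h₂, smul_eq_mul, mul_add]; ring
    | single g r =>
      induction h using AddMonoidAlgebra.induction_linear with
      | zero => simp
      | add f₁ f₂ h₁ h₂ => simp only [mul_add, map_add, h₁, h₂, smul_eq_mul, add_mul]; ring
      | single g' r' =>
        simp only [diag_single, AddMonoidAlgebra.single_mul_single, smul_eq_mul, map_add]
        rw [add_comm g' g, ← AddMonoidAlgebra.single_add]
        congr 1; ring)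

theorem degreeDerivation_apply (m : Γ →+ ℚ) (f : AddMonoidAlgebra ℚ Γ) :
    degreeDerivation m f = diag m f := rfl

end Diagonal

/-! ### The algebra of the perturbation series

The monomial with exponents `(d, k, a, c)` stands for `L ^ d * G ^ k * z ^ a * z̄ ^ c`, where
`z = -β * exp (2 * i * ℓ)` and `z̄ = -β * exp (-2 * i * ℓ)`. -/

abbrev Expo : Type := ℤ × ℤ × ℕ × ℕ

abbrev PhaseAlg : Type := AddMonoidAlgebra ℚ Expo

/-- The trigonometric part of the algebra: the monomial `(a, c)` stands for `z ^ a * z̄ ^ c`. -/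
abbrev TrigAlg : Type := AddMonoidAlgebra ℚ (ℕ × ℕ)

def mono (d k : ℤ) (a c : ℕ) : PhaseAlg := AddMonoidAlgebra.single (d, k, a, c) 1

theorem mono_mul_mono (d k d' k' : ℤ) (a c a' c' : ℕ) :
    mono d k a c * mono d' k' a' c' = mono (d + d') (k + k') (a + a') (c + c') := by
  simp [mono, AddMonoidAlgebra.single_mul_single]

theorem mono_zero : mono 0 0 0 0 = 1 := rfl

def expL : Expo →+ ℚ := (Int.castAddHom ℚ).comp (AddMonoidHom.fst _ _)

def expG : Expo →+ ℚ :=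
  (Int.castAddHom ℚ).comp ((AddMonoidHom.fst _ _).comp (AddMonoidHom.snd _ _))

/-- The harmonic of a trigonometric monomial. -/
def harm : ℕ × ℕ →+ ℚ :=
  (Nat.castAddMonoidHom ℚ).comp (AddMonoidHom.fst _ _) -
    (Nat.castAddMonoidHom ℚ).comp (AddMonoidHom.snd _ _)

/-- The trigonometric part of a monomial. -/
def trigExpo : Expo →+ ℕ × ℕ := (AddMonoidHom.snd _ _).comp (AddMonoidHom.snd _ _)

theorem expL_apply (g : Expo) : expL g = g.1 := rfl
theorem expG_apply (g : Expo) : expG g = g.2.1 := rfl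
theorem harm_apply (g : ℕ × ℕ) : harm g = (g.1 : ℚ) - g.2 := rfl
theorem trigExpo_apply (g : Expo) : trigExpo g = g.2.2 := rfl

/-- `2 * i * θ` is the derivative with respect to `ℓ`. -/
def θ : Derivation ℚ TrigAlg TrigAlg := degreeDerivation harm

def dTheta : Derivation ℚ PhaseAlg PhaseAlg := degreeDerivation (harm.comp trigExpo)
def degL : Derivation ℚ PhaseAlg PhaseAlg := degreeDerivation expL
def degG : Derivation ℚ PhaseAlg PhaseAlg := degreeDerivation expG
def dL : Derivation ℚ PhaseAlg PhaseAlg := mono (-1) 0 0 0 • degL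
def dG : Derivation ℚ PhaseAlg PhaseAlg := mono 0 (-1) 0 0 • degG

theorem dTheta_mono (d k : ℤ) (a c : ℕ) :
    dTheta (mono d k a c) = ((a : ℚ) - c) • mono d k a c := by
  rw [dTheta, degreeDerivation_apply, mono, diag_single, AddMonoidAlgebra.smul_single]
  rfl

theorem degL_mono (d k : ℤ) (a c : ℕ) : degL (mono d k a c) = (d : ℚ) • mono d k a c := by
  rw [degL, degreeDerivation_apply, mono, diag_single, AddMonoidAlgebra.smul_single]
  rfl

theorem degG_mono (d k : ℤ) (a c : ℕ) : degG (mono d k a c) = (k : ℚ) • mono d k a c := by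
  rw [degG, degreeDerivation_apply, mono, diag_single, AddMonoidAlgebra.smul_single]
  rfl

theorem dL_apply (f : PhaseAlg) : dL f = mono (-1) 0 0 0 * degL f := rfl
theorem dG_apply (f : PhaseAlg) : dG f = mono 0 (-1) 0 0 * degG f := rfl

theorem dL_mono (d k : ℤ) (a c : ℕ) : dL (mono d k a c) = (d : ℚ) • mono (d - 1) k a c := by
  rw [dL_apply, degL_mono, mul_smul_comm, mono_mul_mono]
  congr 2 <;> ring

theorem dG_mono (d k : ℤ) (a c : ℕ) : dG (mono d k a c) = (k : ℚ) • mono d (k - 1) a c := by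
  rw [dG_apply, degG_mono, mul_smul_comm, mono_mul_mono]
  congr 2 <;> ring

theorem dTheta_dL (f : PhaseAlg) : dTheta (dL f) = dL (dTheta f) := by
  rw [dL_apply, dL_apply, Derivation.leibniz, dTheta_mono]
  simp only [dTheta, degL, degreeDerivation_apply, diag_comm, smul_eq_mul]
  simp

theorem dTheta_dG (f : PhaseAlg) : dTheta (dG f) = dG (dTheta f) := by
  rw [dG_apply, dG_apply, Derivation.leibniz, dTheta_mono]
  simp only [dTheta, degG, degreeDerivation_apply, diag_comm, smul_eq_mul]
  simp

theorem degG_degL (f : PhaseAlg) : degG (degL f) = degL (degG f) := by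
  simp only [degL, degG, degreeDerivation_apply, diag_comm]

theorem degL_dL (f : PhaseAlg) : degL (dL f) = dL (degL f) - dL f := by
  simp only [dL_apply, Derivation.leibniz, degL_mono, smul_eq_mul]
  simp only [Int.reduceNeg, Int.cast_neg, Int.cast_one, neg_smul, one_smul]
  ring

theorem degG_dL (f : PhaseAlg) : degG (dL f) = dL (degG f) := by
  simp only [dL_apply, Derivation.leibniz, degG_mono, smul_eq_mul, degG_degL]
  simp

theorem degG_dG (f : PhaseAlg) : degG (dG f) = dG (degG f) - dG f := by
  simp only [dG_apply, Derivation.leibniz, degG_mono, smul_eq_mul]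
  simp only [Int.reduceNeg, Int.cast_neg, Int.cast_one, neg_smul, one_smul]
  ring

theorem degL_dG (f : PhaseAlg) : degL (dG f) = dG (degL f) := by
  simp only [dG_apply, Derivation.leibniz, degL_mono, smul_eq_mul, degG_degL]
  simp

theorem dG_dL (f : PhaseAlg) : dG (dL f) = dL (dG f) := by
  rw [dG_apply, degG_dL, dL_apply, dL_apply, degL_dG, dG_apply, mul_left_comm, degG_degL]

/-- The coefficients that do not vanish have exponents `d` of `L` and `k` of `G`. -/
def IsHomog (d k : ℚ) (f : PhaseAlg) : Prop := degL f = d • f ∧ degG f = k • f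

namespace IsHomog

variable {d k d' k' : ℚ} {f h : PhaseAlg}

theorem zero : IsHomog d k 0 := by simp [IsHomog]

theorem add (hf : IsHomog d k f) (hh : IsHomog d k h) : IsHomog d k (f + h) := by
  simp [IsHomog, hf.1, hf.2, hh.1, hh.2]

theorem smul (r : ℚ) (hf : IsHomog d k f) : IsHomog d k (r • f) := by
  simp [IsHomog, hf.1, hf.2, smul_comm r]

theorem neg (hf : IsHomog d k f) : IsHomog d k (-f) := by
  simp [IsHomog, hf.1, hf.2]

theorem sub (hf : IsHomog d k f) (hh : IsHomog d k h) : IsHomog d k (f - h) := by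
  rw [sub_eq_add_neg]; exact hf.add hh.neg

theorem sum {ι : Type*} {s : Finset ι} {F : ι → PhaseAlg} (hF : ∀ i ∈ s, IsHomog d k (F i)) :
    IsHomog d k (∑ i ∈ s, F i) := by
  classical
  induction s using Finset.induction_on with
  | empty => simpa using zero
  | insert a s ha ih =>
    rw [Finset.sum_insert ha]
    exact (hF _ (Finset.mem_insert_self _ _)).add
      (ih fun i hi => hF i (Finset.mem_insert_of_mem hi))

theorem mul (hf : IsHomog d k f) (hh : IsHomog d' k' h) : IsHomog (d + d') (k + k') (f * h) := by
  constructor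
  · rw [Derivation.leibniz, hf.1, hh.1]
    simp only [smul_eq_mul, Algebra.mul_smul_comm, add_smul, mul_comm h f]
    rw [add_comm]
  · rw [Derivation.leibniz, hf.2, hh.2]
    simp only [smul_eq_mul, Algebra.mul_smul_comm, add_smul, mul_comm h f]
    rw [add_comm]

theorem mono (d k : ℤ) (a c : ℕ) : IsHomog d k (mono d k a c) := ⟨degL_mono .., degG_mono ..⟩

theorem diag (m : Expo → ℚ) (hf : IsHomog d k f) : IsHomog d k (diag m f) := by
  constructor
  · rw [degL, degreeDerivation_apply, diag_comm, ← degreeDerivation_apply, ← degL, hf.1, map_smul]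
  · rw [degG, degreeDerivation_apply, diag_comm, ← degreeDerivation_apply, ← degG, hf.2, map_smul]

theorem dTheta (hf : IsHomog d k f) : IsHomog d k (dTheta f) := hf.diag _

theorem dL (hf : IsHomog d k f) : IsHomog (d - 1) k (dL f) := by
  constructor
  · rw [degL_dL, hf.1, Derivation.map_smul, sub_smul, one_smul]
  · rw [degG_dL, hf.2, Derivation.map_smul]

theorem dG (hf : IsHomog d k f) : IsHomog d (k - 1) (dG f) := by
  constructor
  · rw [degL_dG, hf.1, Derivation.map_smul]
  · rw [degG_dG, hf.2, Derivation.map_smul, sub_smul, one_smul]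

theorem coeff_eq_zero (hf : IsHomog d k f) {g : Expo} (hg : (g.1 : ℚ) ≠ d ∨ (g.2.1 : ℚ) ≠ k) :
    f.coeff g = 0 := by
  have h1 := congrArg (fun f : PhaseAlg => f.coeff g) hf.1
  have h2 := congrArg (fun f : PhaseAlg => f.coeff g) hf.2
  simp only [degL, degG, degreeDerivation_apply, coeff_diag, AddMonoidAlgebra.coeff_smul,
    Finsupp.smul_apply, smul_eq_mul, expL_apply, expG_apply] at h1 h2
  by_contra h0
  rcases hg with hg | hg
  · exact hg (mul_right_cancel₀ h0 h1)
  · exact hg (mul_right_cancel₀ h0 h2)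

end IsHomog

/-! ### Reflection of the angle, and specialization to `L = G = 1` -/

/-- The involution that exchanges `z` and `z̄`, which is the reflection of the angle. -/
def reflExpo : Expo →+ Expo :=
  AddMonoidHom.prodMap (AddMonoidHom.id _)
    (AddMonoidHom.prodMap (AddMonoidHom.id _) (AddMonoidHom.prod (AddMonoidHom.snd _ _)
      (AddMonoidHom.fst _ _)))

def reflTrig : ℕ × ℕ →+ ℕ × ℕ := AddMonoidHom.prod (AddMonoidHom.snd _ _) (AddMonoidHom.fst _ _)

def refl : PhaseAlg →ₐ[ℚ] PhaseAlg := AddMonoidAlgebra.mapDomainAlgHom ℚ ℚ reflExpo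

def trefl : TrigAlg →ₐ[ℚ] TrigAlg := AddMonoidAlgebra.mapDomainAlgHom ℚ ℚ reflTrig

/-- Setting `L = G = 1`. -/
def toTrig : PhaseAlg →ₐ[ℚ] TrigAlg := AddMonoidAlgebra.mapDomainAlgHom ℚ ℚ trigExpo

theorem refl_single (g : Expo) (r : ℚ) :
    refl (AddMonoidAlgebra.single g r) = AddMonoidAlgebra.single (g.1, g.2.1, g.2.2.2, g.2.2.1) r :=
  AddMonoidAlgebra.mapDomain_single

theorem trefl_single (g : ℕ × ℕ) (r : ℚ) :
    trefl (AddMonoidAlgebra.single g r) = AddMonoidAlgebra.single (g.2, g.1) r :=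
  AddMonoidAlgebra.mapDomain_single

theorem toTrig_single (g : Expo) (r : ℚ) :
    toTrig (AddMonoidAlgebra.single g r) = AddMonoidAlgebra.single g.2.2 r :=
  AddMonoidAlgebra.mapDomain_single

theorem refl_mono (d k : ℤ) (a c : ℕ) : refl (mono d k a c) = mono d k c a := refl_single _ _

theorem toTrig_mono (d k : ℤ) (a c : ℕ) :
    toTrig (mono d k a c) = AddMonoidAlgebra.single (a, c) 1 := toTrig_single _ _

theorem refl_diag (m : Expo → ℚ) (f : PhaseAlg) :
    refl (diag m f) = diag (fun g => m (g.1, g.2.1, g.2.2.2, g.2.2.1)) (refl f) := by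
  induction f using AddMonoidAlgebra.induction_linear with
  | zero => simp
  | add f₁ f₂ h₁ h₂ => simp only [map_add, h₁, h₂]
  | single g r => simp only [diag_single, refl_single]

theorem trefl_diag (m : ℕ × ℕ → ℚ) (f : TrigAlg) :
    trefl (diag m f) = diag (fun g => m (g.2, g.1)) (trefl f) := by
  induction f using AddMonoidAlgebra.induction_linear with
  | zero => simp
  | add f₁ f₂ h₁ h₂ => simp only [map_add, h₁, h₂]
  | single g r => simp only [diag_single, trefl_single]

theorem toTrig_diag (m : ℕ × ℕ → ℚ) (f : PhaseAlg) :
    toTrig (diag (fun g => m g.2.2) f) = diag m (toTrig f) := by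
  induction f using AddMonoidAlgebra.induction_linear with
  | zero => simp
  | add f₁ f₂ h₁ h₂ => simp only [map_add, h₁, h₂]
  | single g r => simp only [diag_single, toTrig_single]

theorem toTrig_refl (f : PhaseAlg) : toTrig (refl f) = trefl (toTrig f) := by
  induction f using AddMonoidAlgebra.induction_linear with
  | zero => simp
  | add f₁ f₂ h₁ h₂ => simp only [map_add, h₁, h₂]
  | single g r => simp only [refl_single, toTrig_single, trefl_single]

theorem refl_dTheta (f : PhaseAlg) : refl (dTheta f) = -dTheta (refl f) := by
  rw [dTheta, degreeDerivation_apply, degreeDerivation_apply, refl_diag]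
  ext g
  simp only [coeff_diag, AddMonoidAlgebra.coeff_neg, Finsupp.neg_apply, AddMonoidHom.comp_apply,
    trigExpo_apply, harm_apply]
  ring

theorem refl_dL (f : PhaseAlg) : refl (dL f) = dL (refl f) := by
  rw [dL_apply, dL_apply, map_mul, refl_mono, degL, degreeDerivation_apply,
    degreeDerivation_apply, refl_diag]
  rfl

theorem refl_dG (f : PhaseAlg) : refl (dG f) = dG (refl f) := by
  rw [dG_apply, dG_apply, map_mul, refl_mono, degG, degreeDerivation_apply,
    degreeDerivation_apply, refl_diag]
  rfl

theorem toTrig_dTheta (f : PhaseAlg) : toTrig (dTheta f) = θ (toTrig f) :=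
  toTrig_diag harm f

theorem toTrig_dL {d k : ℚ} {f : PhaseAlg} (hf : IsHomog d k f) :
    toTrig (dL f) = d • toTrig f := by
  rw [dL_apply, map_mul, toTrig_mono, hf.1, map_smul, show
    (AddMonoidAlgebra.single ((0 : ℕ), (0 : ℕ)) (1 : ℚ)) = 1 from rfl, one_mul]

theorem toTrig_dG {d k : ℚ} {f : PhaseAlg} (hf : IsHomog d k f) :
    toTrig (dG f) = k • toTrig f := by
  rw [dG_apply, map_mul, toTrig_mono, hf.2, map_smul, show
    (AddMonoidAlgebra.single ((0 : ℕ), (0 : ℕ)) (1 : ℚ)) = 1 from rfl, one_mul]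

/-! ### Averages and antiderivatives in the angle -/

/-- The part that does not depend on the angle. -/
def avg : TrigAlg →ₗ[ℚ] TrigAlg := diag fun g => if g.1 = g.2 then 1 else 0

/-- The antiderivative with vanishing average. -/
def antider : TrigAlg →ₗ[ℚ] TrigAlg := diag fun g => (harm g)⁻¹

def pavg : PhaseAlg →ₗ[ℚ] PhaseAlg := diag fun g => if g.2.2.1 = g.2.2.2 then 1 else 0

/-- The convention `0⁻¹ = 0` discards the angle-free monomials, so the result has vanishing average.
-/
def pantider : PhaseAlg →ₗ[ℚ] PhaseAlg := diag fun g => (harm g.2.2)⁻¹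

theorem harm_mul_inv (g : ℕ × ℕ) : harm g * (harm g)⁻¹ = 1 - if g.1 = g.2 then 1 else 0 := by
  rw [harm_apply]
  split
  · rename_i h; simp [h]
  · rename_i h
    rw [mul_inv_cancel₀ (sub_ne_zero.2 (by exact_mod_cast h))]; simp

theorem dTheta_pantider (f : PhaseAlg) : dTheta (pantider f) = f - pavg f := by
  ext g
  rw [dTheta, degreeDerivation_apply, pantider, diag_diag, coeff_diag, AddMonoidAlgebra.coeff_sub,
    Finsupp.sub_apply, pavg, coeff_diag, AddMonoidHom.comp_apply, trigExpo_apply, harm_mul_inv]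
  ring

theorem dTheta_pavg (f : PhaseAlg) : dTheta (pavg f) = 0 := by
  ext g
  rw [dTheta, degreeDerivation_apply, pavg, diag_diag, coeff_diag, AddMonoidHom.comp_apply,
    trigExpo_apply, harm_apply]
  split <;> simp_all

theorem antider_θ (f : TrigAlg) : antider (θ f) = f - avg f := by
  ext g
  rw [θ, degreeDerivation_apply, antider, diag_diag, coeff_diag, AddMonoidAlgebra.coeff_sub,
    Finsupp.sub_apply, avg, coeff_diag, mul_comm (harm g)⁻¹, harm_mul_inv]
  ring

theorem avg_θ (f : TrigAlg) : avg (θ f) = 0 := by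
  ext g
  rw [θ, degreeDerivation_apply, avg, diag_diag, coeff_diag, harm_apply]
  split <;> simp_all

theorem avg_eq_self {f : TrigAlg} (hf : θ f = 0) : avg f = f := by
  have := antider_θ f
  rw [hf, map_zero] at this
  exact (sub_eq_zero.1 this.symm).symm

/-- Reflection fixes every angle-free monomial, hence it fixes the average; for an odd element it
also changes the sign of the average. -/
theorem avg_eq_zero {f : TrigAlg} (hf : trefl f = -f) : avg f = 0 := by
  have h : trefl (avg f) = avg (trefl f) := by
    rw [avg, trefl_diag]
    congr 2
    ext g
    simp only [eq_comm]
  have h2 : ∀ f : TrigAlg, trefl (avg f) = avg f := by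
    intro f
    induction f using AddMonoidAlgebra.induction_linear with
    | zero => simp
    | add f₁ f₂ h₁ h₂ => simp only [map_add, h₁, h₂]
    | single g r =>
      rw [avg, diag_single, trefl_single]
      split
      · rename_i h
        rw [show (g.2, g.1) = g from Prod.ext h.symm h]
      · simp
  have h3 := h.symm.trans (h2 f)
  rw [hf, map_neg] at h3
  ext g
  have h4 := congrArg (fun f : TrigAlg => f.coeff g) h3
  simp only [AddMonoidAlgebra.coeff_neg, Finsupp.neg_apply] at h4
  rw [AddMonoidAlgebra.coeff_zero, Finsupp.zero_apply]
  linarith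

end RigidBody
end

noncomputable section

namespace RigidBody

open LieSeries

/-! ### Homogeneous series -/

/-- The coefficient of order `n` is homogeneous of degree `d + n` in `L` and `k - n` in `G`. -/
def HomogSeries (d k : ℚ) (f : PowerSeries PhaseAlg) : Prop :=
  ∀ n : ℕ, IsHomog (d + n) (k - n) (PowerSeries.coeff n f)

namespace HomogSeries

variable {d k d' k' : ℚ} {f h : PowerSeries PhaseAlg}

theorem congr (hf : HomogSeries d k f) (hd : d = d') (hk : k = k') : HomogSeries d' k' f := by
  subst hd hk; exact hf

theorem add (hf : HomogSeries d k f) (hh : HomogSeries d k h) : HomogSeries d k (f + h) :=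
  fun n => by rw [map_add]; exact (hf n).add (hh n)

theorem sub (hf : HomogSeries d k f) (hh : HomogSeries d k h) : HomogSeries d k (f - h) :=
  fun n => by rw [map_sub]; exact (hf n).sub (hh n)

theorem smul (r : ℚ) (hf : HomogSeries d k f) : HomogSeries d k (r • f) :=
  fun n => by rw [LinearMap.map_smul_of_tower]; exact (hf n).smul r

theorem mul (hf : HomogSeries d k f) (hh : HomogSeries d' k' h) :
    HomogSeries (d + d') (k + k') (f * h) := fun n => by
  rw [PowerSeries.coeff_mul]
  refine IsHomog.sum fun ij hij => ?_
  have h1 : ((ij.1 : ℚ) + ij.2) = n := by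
    exact_mod_cast Finset.HasAntidiagonal.mem_antidiagonal.1 hij
  have h2 := (hf ij.1).mul (hh ij.2)
  rw [← h1]
  convert h2 using 1 <;> ring

theorem C {a : PhaseAlg} (ha : IsHomog d k a) : HomogSeries d k (PowerSeries.C a) := fun n => by
  rw [PowerSeries.coeff_C]
  split
  · rename_i h; subst h; simpa using ha
  · exact IsHomog.zero

theorem X_mul (hf : HomogSeries d k f) : HomogSeries (d - 1) (k + 1) (PowerSeries.X * f) :=
  fun n => by
    cases n with
    | zero => rw [PowerSeries.coeff_zero_X_mul]; exact IsHomog.zero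
    | succ n =>
      rw [PowerSeries.coeff_succ_X_mul]
      convert hf n using 1 <;> push_cast <;> ring

theorem dTheta (hf : HomogSeries d k f) : HomogSeries d k (coeffwise dTheta f) :=
  fun n => by rw [coeff_coeffwise]; exact (hf n).dTheta

theorem dL (hf : HomogSeries d k f) : HomogSeries (d - 1) k (coeffwise dL f) :=
  fun n => by
    rw [coeff_coeffwise]
    convert (hf n).dL using 1; ring

theorem dG (hf : HomogSeries d k f) : HomogSeries d (k - 1) (coeffwise dG f) :=
  fun n => by
    rw [coeff_coeffwise]
    convert (hf n).dG using 1; ring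

theorem ddε (hf : HomogSeries d k f) : HomogSeries (d + 1) (k - 1) (ddε f) := fun n => by
  have h : ((n : PhaseAlg) + 1) = algebraMap ℚ PhaseAlg (n + 1) := by
    rw [map_add, map_natCast, map_one]
  rw [coeff_ddε, h, mul_comm, ← Algebra.smul_def]
  convert (hf (n + 1)).smul (n + 1) using 1 <;> push_cast <;> ring

/-- The weights `(2, -1)` of the generator are those for which the bracket with `W`, which costs one
power of `L`, shifts the degrees exactly as `∂/∂ε` does. -/
theorem lieDeriv {W : PowerSeries PhaseAlg} (hW : HomogSeries 2 (-1) W)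
    (hf : HomogSeries d k f) :
    HomogSeries (d + 1) (k - 1) (lieDeriv RigidBody.dTheta RigidBody.dL W f) := by
  rw [lieDeriv_apply, bracket]
  exact hf.ddε.add ((hf.dTheta.mul hW.dL).congr (by ring) (by ring) |>.sub
    ((hf.dL.mul hW.dTheta).congr (by ring) (by ring)))

theorem lieDeriv_pow {W : PowerSeries PhaseAlg} (hW : HomogSeries 2 (-1) W)
    (hf : HomogSeries d k f) (n : ℕ) :
    HomogSeries (d + n) (k - n)
      ((LieSeries.lieDeriv RigidBody.dTheta RigidBody.dL W ^ n) f) := by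
  induction n with
  | zero => simpa using hf
  | succ n ih =>
    rw [pow_succ', Module.End.mul_apply]
    exact (lieDeriv hW ih).congr (by push_cast; ring) (by push_cast; ring)

theorem transform {W : PowerSeries PhaseAlg} (hW : HomogSeries 2 (-1) W)
    (hf : HomogSeries d k f) :
    HomogSeries d k (transform RigidBody.dTheta RigidBody.dL W f) := fun n => by
  rw [coeff_transform]
  refine IsHomog.smul _ ?_
  simpa using lieDeriv_pow hW hf n 0

theorem correction {W : PowerSeries PhaseAlg} (hW : HomogSeries 2 (-1) W)
    {r : Derivation ℚ PhaseAlg PhaseAlg} (hr : HomogSeries (d + 1) (k - 1) (coeffwise r W)) :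
    HomogSeries d k (correction RigidBody.dTheta RigidBody.dL r W) := fun n => by
  cases n with
  | zero => rw [coeff_zero_correction]; exact IsHomog.zero
  | succ n =>
    rw [coeff_correction_succ]
    refine IsHomog.smul _ ?_
    convert lieDeriv_pow hW hr n 0 using 1 <;> push_cast <;> ring

end HomogSeries

/-! ### The formal Hamiltonian and its normalization -/

def serL : PowerSeries PhaseAlg := PowerSeries.C (mono 1 0 0 0)
def serG : PowerSeries PhaseAlg := PowerSeries.C (mono 0 1 0 0)
def serZ : PowerSeries PhaseAlg := PowerSeries.C (mono 0 0 1 0)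
def serZbar : PowerSeries PhaseAlg := PowerSeries.C (mono 0 0 0 1)

theorem dTheta_serL : coeffwise dTheta serL = 0 := by
  rw [serL, coeffwise_C, dTheta_mono]; simp
theorem dTheta_serG : coeffwise dTheta serG = 0 := by
  rw [serG, coeffwise_C, dTheta_mono]; simp
theorem dTheta_serZ : coeffwise dTheta serZ = serZ := by
  rw [serZ, coeffwise_C, dTheta_mono]; simp
theorem dTheta_serZbar : coeffwise dTheta serZbar = -serZbar := by
  rw [serZbar, coeffwise_C, dTheta_mono]; simp
theorem dL_serL : coeffwise dL serL = 1 := by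
  rw [serL, coeffwise_C, dL_mono]; simp [mono_zero]
theorem dL_serG : coeffwise dL serG = 0 := by
  rw [serG, coeffwise_C, dL_mono]; simp
theorem dL_serZ : coeffwise dL serZ = 0 := by
  rw [serZ, coeffwise_C, dL_mono]; simp
theorem dL_serZbar : coeffwise dL serZbar = 0 := by
  rw [serZbar, coeffwise_C, dL_mono]; simp
theorem dG_serL : coeffwise dG serL = 0 := by
  rw [serL, coeffwise_C, dG_mono]; simp
theorem dG_serG : coeffwise dG serG = 1 := by
  rw [serG, coeffwise_C, dG_mono]; simp [mono_zero]
theorem dG_serZ : coeffwise dG serZ = 0 := by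
  rw [serZ, coeffwise_C, dG_mono]; simp
theorem dG_serZbar : coeffwise dG serZbar = 0 := by
  rw [serZbar, coeffwise_C, dG_mono]; simp

/-- The formal Hamiltonian `L * G - ε * L ^ 2 * (1 - (z + z̄) / 2) / 2`. -/
def serK : PowerSeries PhaseAlg :=
  serL * serG - (1 / 2 : ℚ) • (PowerSeries.X * (serL * serL * (1 - (1 / 2 : ℚ) • (serZ + serZbar))))

theorem coeff_zero_serK : PowerSeries.coeff 0 serK = mono 1 1 0 0 := by
  rw [serK, map_sub, LinearMap.map_smul_of_tower, PowerSeries.coeff_zero_X_mul, serL, serG,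
    ← map_mul, PowerSeries.coeff_zero_C, mono_mul_mono]
  simp

theorem dTheta_serK : coeffwise dTheta serK =
    (1 / 4 : ℚ) • (PowerSeries.X * (serL * serL * (serZ - serZbar))) := by
  have h1 : coeffwise dTheta (1 : PowerSeries PhaseAlg) = 0 := by simp
  simp only [serK, map_sub, Derivation.leibniz, Derivation.map_smul, map_add, dTheta_serL,
    dTheta_serG, dTheta_serZ, dTheta_serZbar, coeffwise_X, h1, smul_eq_mul, mul_zero, add_zero,
    zero_sub, smul_neg, mul_neg, sub_neg_eq_add, mul_smul_comm, smul_smul]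
  norm_num [sub_eq_add_neg]

theorem dL_serK : coeffwise dL serK =
    serG - PowerSeries.X * (serL * (1 - (1 / 2 : ℚ) • (serZ + serZbar))) := by
  have h1 : coeffwise dL (1 : PowerSeries PhaseAlg) = 0 := by simp
  simp only [serK, map_sub, Derivation.leibniz, Derivation.map_smul, map_add, dL_serL,
    dL_serG, dL_serZ, dL_serZbar, coeffwise_X, h1, smul_eq_mul, mul_zero, add_zero, zero_add,
    smul_zero, sub_zero, mul_one]
  rw [← two_mul]
  have h2 : (2 : PowerSeries PhaseAlg) = (2 : ℚ) • 1 := by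
    rw [← Algebra.algebraMap_eq_smul_one, map_ofNat]
  rw [h2]
  simp only [smul_mul_assoc, mul_smul_comm, smul_smul, one_mul]
  norm_num
  ring

theorem dG_serK : coeffwise dG serK = serL := by
  have h1 : coeffwise dG (1 : PowerSeries PhaseAlg) = 0 := by simp
  simp [serK, Derivation.leibniz, Derivation.map_smul, dG_serL,
    dG_serG, dG_serZ, dG_serZbar, coeffwise_X, h1]

theorem homog_serK : HomogSeries 1 1 serK := by
  have hL : HomogSeries 1 0 serL := HomogSeries.C (by simpa using IsHomog.mono 1 0 0 0)
  have hG : HomogSeries 0 1 serG := HomogSeries.C (by simpa using IsHomog.mono 0 1 0 0)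
  have hz : HomogSeries 0 0 serZ := HomogSeries.C (by simpa using IsHomog.mono 0 0 1 0)
  have hzb : HomogSeries 0 0 serZbar := HomogSeries.C (by simpa using IsHomog.mono 0 0 0 1)
  have h1 : HomogSeries 0 0 1 := by
    rw [← map_one (PowerSeries.C (R := PhaseAlg)), ← mono_zero]
    exact HomogSeries.C (by simpa using IsHomog.mono 0 0 0 0)
  have h := ((hL.mul hL).mul (h1.sub ((hz.add hzb).smul (1 / 2)))).X_mul.smul (1 / 2)
  exact ((hL.mul hG).congr (by ring) (by ring)).sub (h.congr (by ring) (by ring))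

theorem refl_serK : PowerSeries.map (refl : PhaseAlg →+* PhaseAlg) serK = serK := by
  have hs : ∀ (r : ℚ) (f : PowerSeries PhaseAlg),
      PowerSeries.map (refl : PhaseAlg →+* PhaseAlg) (r • f) =
        r • PowerSeries.map (refl : PhaseAlg →+* PhaseAlg) f := by
    intro r f
    ext1 n
    rw [PowerSeries.coeff_map, LinearMap.map_smul_of_tower, LinearMap.map_smul_of_tower,
      PowerSeries.coeff_map]
    exact map_smul refl _ _
  have e1 : PowerSeries.map (refl : PhaseAlg →+* PhaseAlg) serL = serL := by
    rw [serL, PowerSeries.map_C]; exact congrArg _ (refl_mono ..)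
  have e2 : PowerSeries.map (refl : PhaseAlg →+* PhaseAlg) serG = serG := by
    rw [serG, PowerSeries.map_C]; exact congrArg _ (refl_mono ..)
  have e3 : PowerSeries.map (refl : PhaseAlg →+* PhaseAlg) serZ = serZbar := by
    rw [serZ, PowerSeries.map_C]; exact congrArg _ (refl_mono ..)
  have e4 : PowerSeries.map (refl : PhaseAlg →+* PhaseAlg) serZbar = serZ := by
    rw [serZbar, PowerSeries.map_C]; exact congrArg _ (refl_mono ..)
  simp only [serK, map_sub, map_mul, map_add, hs, PowerSeries.map_X, e1, e2, e3, e4, map_one]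
  rw [add_comm serZbar]

/-- The formal Lie transform. -/
abbrev lieT (W : PowerSeries PhaseAlg) : PowerSeries PhaseAlg →ₗ[ℚ] PowerSeries PhaseAlg :=
  transform dTheta dL W

/-- The term of order `n` of the generator, if `W` is the generator up to the order `n`. -/
def nextTerm (W : PowerSeries PhaseAlg) (n : ℕ) : PhaseAlg :=
  mono 0 (-1) 0 0 * pantider ((n + 1 : ℚ) • PowerSeries.coeff (n + 1) (lieT W serK))

/-- The generator of the normalization, truncated below the order `n`. -/
def genTrunc : ℕ → PowerSeries PhaseAlg
  | 0 => 0
  | n + 1 => genTrunc n + PowerSeries.X ^ n * PowerSeries.C (nextTerm (genTrunc n) n)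

/-- The formal generator of the normalization. -/
def gen : PowerSeries PhaseAlg := PowerSeries.mk fun n => nextTerm (genTrunc n) n

theorem coeff_genTrunc (n m : ℕ) : PowerSeries.coeff m (genTrunc n) =
    if m < n then nextTerm (genTrunc m) m else 0 := by
  induction n with
  | zero => simp [genTrunc]
  | succ n ih =>
    rw [genTrunc, map_add, ih, PowerSeries.coeff_X_pow_mul']
    rcases lt_trichotomy m n with h | h | h
    · rw [if_pos h, if_neg (by omega), if_pos (by omega), add_zero]
    · subst h; simp [-PowerSeries.coeff_zero_eq_constantCoeff, PowerSeries.coeff_zero_C]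
    · rw [if_neg (by omega), if_pos (by omega), if_neg (by omega), PowerSeries.coeff_C,
        if_neg (by omega), add_zero]

theorem X_pow_dvd_gen_sub (n : ℕ) : PowerSeries.X ^ n ∣ gen - genTrunc n := by
  rw [PowerSeries.X_pow_dvd_iff]
  intro m hm
  rw [map_sub, coeff_genTrunc, if_pos hm, gen, PowerSeries.coeff_mk, sub_self]

theorem coeff_gen_sub (n : ℕ) :
    PowerSeries.coeff n (gen - genTrunc n) = nextTerm (genTrunc n) n := by
  rw [map_sub, coeff_genTrunc, if_neg (lt_irrefl n), gen, PowerSeries.coeff_mk, sub_zero]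

theorem mono_G_mul_inv : mono 0 1 0 0 * mono 0 (-1) 0 0 = 1 := by
  rw [mono_mul_mono]; rfl

/-- The homological equation. The term `W_n` first enters at order `n + 1`, through its bracket with
`L G`, which contributes `-G θ W_n`. By the choice in `nextTerm`, this cancels everything in that
order except the average, and later terms of the generator do not reach back. -/
theorem dTheta_lieT_serK (n : ℕ) : dTheta (PowerSeries.coeff n (lieT gen serK)) = 0 := by
  cases n with
  | zero => rw [coeff_zero_transform, coeff_zero_serK, dTheta_mono]; simp
  | succ n =>
    have h := coeff_succ_transform_congr (p := dTheta) (q := dL) (X_pow_dvd_gen_sub n) serK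
    rw [coeff_gen_sub, coeff_zero_serK, dTheta_mono, dL_mono] at h
    have e : ((n : PhaseAlg) + 1) = algebraMap ℚ PhaseAlg (n + 1) := by
      rw [map_add, map_natCast, map_one]
    have h2 : mono 0 1 0 0 * dTheta (nextTerm (genTrunc n) n) =
        (n + 1 : ℚ) • PowerSeries.coeff (n + 1) (lieT (genTrunc n) serK) -
          pavg ((n + 1 : ℚ) • PowerSeries.coeff (n + 1) (lieT (genTrunc n) serK)) := by
      rw [nextTerm, Derivation.leibniz, dTheta_mono, dTheta_pantider]
      simp only [CharP.cast_eq_zero, sub_zero, zero_smul, smul_eq_mul, mul_zero, add_zero]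
      rw [← mul_assoc, mono_G_mul_inv, one_mul]
    rw [e, ← Algebra.smul_def, ← Algebra.smul_def] at h
    simp only [CharP.cast_eq_zero, zero_smul, zero_mul, Int.cast_one, one_smul, sub_self,
      zero_sub] at h
    rw [h2] at h
    have h3 : (n + 1 : ℚ) • PowerSeries.coeff (n + 1) (lieT gen serK) =
        pavg ((n + 1 : ℚ) • PowerSeries.coeff (n + 1) (lieT (genTrunc n) serK)) := by
      rw [h]; abel
    have h4 := congrArg dTheta h3
    rw [dTheta_pavg, Derivation.map_smul] at h4
    exact (smul_eq_zero_iff_right (by positivity : (n + 1 : ℚ) ≠ 0)).1 h4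

theorem homog_genTrunc (n : ℕ) : HomogSeries 2 (-1) (genTrunc n) := by
  induction n with
  | zero => intro m; simpa [genTrunc] using IsHomog.zero
  | succ n ih =>
    refine ih.add fun m => ?_
    rw [PowerSeries.coeff_X_pow_mul']
    split
    · rename_i hnm
      rw [PowerSeries.coeff_C]
      split
      · rename_i h0
        have hm : m = n := by omega
        subst hm
        have h1 := (IsHomog.mono 0 (-1) 0 0).mul
          (((ih.transform homog_serK (m + 1)).smul (m + 1)).diag fun g => (harm g.2.2)⁻¹)
        have e1 : ((0 : ℤ) : ℚ) + (1 + ((m + 1 : ℕ) : ℚ)) = 2 + m := by push_cast; ring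
        have e2 : ((-1 : ℤ) : ℚ) + (1 - ((m + 1 : ℕ) : ℚ)) = -1 - m := by push_cast; ring
        rw [e1, e2] at h1
        exact h1
      · exact IsHomog.zero
    · exact IsHomog.zero

theorem homog_gen : HomogSeries 2 (-1) gen := fun n => by
  have h := homog_genTrunc (n + 1) n
  rw [coeff_genTrunc, if_pos (Nat.lt_succ_self n)] at h
  rw [gen, PowerSeries.coeff_mk]
  exact h

theorem refl_pantider (f : PhaseAlg) : refl (pantider f) = -pantider (refl f) := by
  rw [pantider, refl_diag]
  ext g
  simp only [coeff_diag, AddMonoidAlgebra.coeff_neg, Finsupp.neg_apply, harm_apply]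
  rw [← neg_sub, inv_neg]
  ring

/-- The Hamiltonian is even in the angle. If the generator so far is odd, the transformed
Hamiltonian is even, and its antiderivative, the next term, is odd. -/
theorem refl_genTrunc (n : ℕ) :
    PowerSeries.map (refl : PhaseAlg →+* PhaseAlg) (genTrunc n) = -genTrunc n := by
  induction n with
  | zero => simp [genTrunc]
  | succ n ih =>
    have h := map_transform refl refl_dTheta refl_dL ih serK
    have h2 : refl (nextTerm (genTrunc n) n) = -nextTerm (genTrunc n) n := by
      have h3 := congrArg (PowerSeries.coeff (n + 1)) h
      rw [PowerSeries.coeff_map, refl_serK] at h3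
      change refl _ = _ at h3
      rw [nextTerm, map_mul, refl_pantider, map_smul, refl_mono, h3]
      ring
    rw [genTrunc, map_add, map_mul, map_pow, PowerSeries.map_X, PowerSeries.map_C, ih,
      show ((refl : PhaseAlg →+* PhaseAlg) (nextTerm (genTrunc n) n)) = _ from h2, map_neg]
    ring

theorem refl_gen : PowerSeries.map (refl : PhaseAlg →+* PhaseAlg) gen = -gen := by
  ext1 n
  have h := congrArg (PowerSeries.coeff n) (refl_genTrunc (n + 1))
  rw [PowerSeries.coeff_map, map_neg, coeff_genTrunc, if_pos (Nat.lt_succ_self n)] at h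
  rw [PowerSeries.coeff_map, map_neg]
  simpa [gen] using h

/-- Each term of the generator has no angle-free part, so it is itself the derivative of a
trigonometric polynomial. This is the source of the vanishing mean over `ℓ`. -/
theorem dTheta_pantider_gen (n : ℕ) :
    dTheta (pantider (PowerSeries.coeff n gen)) = PowerSeries.coeff n gen := by
  rw [gen, PowerSeries.coeff_mk, nextTerm]
  set F := (n + 1 : ℚ) • PowerSeries.coeff (n + 1) (lieT (genTrunc n) serK)
  have h : pantider (mono 0 (-1) 0 0 * pantider F) = mono 0 (-1) 0 0 * pantider (pantider F) := by
    have : ∀ F : PhaseAlg, pantider (mono 0 (-1) 0 0 * F) = mono 0 (-1) 0 0 * pantider F := by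
      intro F
      induction F using AddMonoidAlgebra.induction_linear with
      | zero => simp
      | add f₁ f₂ h₁ h₂ => simp only [map_add, mul_add, h₁, h₂]
      | single g r =>
        have h0 : harm (0, 0) = 0 := map_zero harm
        simp only [pantider, mono, diag_single, AddMonoidAlgebra.single_mul_single, one_mul]
        simp [h0]
    exact this _
  rw [h, Derivation.leibniz, dTheta_mono, dTheta_pantider]
  have h2 : pavg (pantider F) = 0 := by
    ext g
    rw [pavg, pantider, diag_diag, coeff_diag, harm_apply]
    split <;> simp_all
  rw [h2]; simp

end RigidBody
end

noncomputable section

namespace RigidBody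

open LieSeries

/-! ### The equations of the normalization, at `L = G = 1` -/

/-- The corrections to the angles `ℓ` and `g`. -/
def corrEll : PowerSeries PhaseAlg := correction dTheta dL dL gen
def corrAng : PowerSeries PhaseAlg := correction dTheta dL dG gen

theorem dTheta_lieT : coeffwise dTheta (lieT gen serK) = 0 := by
  ext1 n
  rw [coeff_coeffwise, dTheta_lieT_serK, map_zero]

theorem bracket_lieT_serK (f : PowerSeries PhaseAlg) :
    bracket dTheta dL f (lieT gen serK) =
      coeffwise dTheta f * coeffwise dL (lieT gen serK) := by
  rw [bracket, dTheta_lieT, mul_zero, sub_zero]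

/-- The map to trigonometric series that sets `L = G = 1`. -/
def proj : PowerSeries PhaseAlg →+* PowerSeries TrigAlg :=
  PowerSeries.map (toTrig : PhaseAlg →+* TrigAlg)

theorem coeff_proj (f : PowerSeries PhaseAlg) (n : ℕ) :
    PowerSeries.coeff n (proj f) = toTrig (PowerSeries.coeff n f) :=
  PowerSeries.coeff_map _ _ _

theorem proj_smul (r : ℚ) (f : PowerSeries PhaseAlg) : proj (r • f) = r • proj f := by
  ext1 n
  rw [coeff_proj, LinearMap.map_smul_of_tower, LinearMap.map_smul_of_tower, coeff_proj, map_smul]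

theorem proj_X : proj PowerSeries.X = PowerSeries.X := PowerSeries.map_X _

theorem proj_dTheta (f : PowerSeries PhaseAlg) :
    proj (coeffwise dTheta f) = coeffwise θ (proj f) := by
  ext1 n
  rw [coeff_proj, coeff_coeffwise, coeff_coeffwise, coeff_proj, toTrig_dTheta]

theorem proj_ddε (f : PowerSeries PhaseAlg) : proj (ddε f) = ddε (proj f) := by
  ext1 n
  rw [coeff_proj, coeff_ddε, coeff_ddε, coeff_proj, map_mul]
  simp

theorem proj_serG : proj serG = 1 := by
  rw [proj, serG, PowerSeries.map_C,
    show (toTrig : PhaseAlg →+* TrigAlg) (mono 0 1 0 0) = 1 from toTrig_mono .., map_one]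

def zz : TrigAlg := AddMonoidAlgebra.single (1, 0) 1
def zzb : TrigAlg := AddMonoidAlgebra.single (0, 1) 1

/-- The series of the averaged Hamiltonian. -/
def tK : PowerSeries TrigAlg := proj (lieT gen serK)
/-- The frequency. -/
def tN : PowerSeries TrigAlg := proj (coeffwise dL (lieT gen serK))
def tU : PowerSeries TrigAlg := proj (lieT gen serL)
def tZ : PowerSeries TrigAlg := proj (lieT gen serZ)
def tZb : PowerSeries TrigAlg := proj (lieT gen serZbar)
def tLam : PowerSeries TrigAlg := proj corrEll
def tGam : PowerSeries TrigAlg := proj corrAng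

theorem lieT_serG : lieT gen serG = serG := transform_eq_self dTheta_serG dL_serG

/-- The coefficient of order `n` of the averaged Hamiltonian has degree `n + 1` in `L`, so `∂/∂L`
multiplies it by `n + 1`. -/
theorem coeff_tN (n : ℕ) :
    PowerSeries.coeff n tN = (n + 1 : ℚ) • PowerSeries.coeff n tK := by
  rw [tN, coeff_proj, coeff_coeffwise, toTrig_dL (homog_gen.transform homog_serK n), tK,
    coeff_proj, add_comm]

theorem θ_tK : coeffwise θ tK = 0 := by
  rw [tK, ← proj_dTheta, dTheta_lieT, map_zero]

theorem two_smul_half {M : Type*} [CommRing M] [Algebra ℚ M] (f : M) : 2 * ((1 / 2 : ℚ) • f) = f := by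
  have h : (2 : M) = algebraMap ℚ M 2 := by rw [map_ofNat]
  rw [h, ← Algebra.smul_def, smul_smul]; norm_num

/-- The mean motion of `ℓ`. -/
theorem tN_mul_θ_tLam : 2 * (tN * (1 + coeffwise θ tLam)) =
    2 - PowerSeries.X * (tU * (2 - tZ - tZb)) := by
  have h := transform_coeffwise (p := dTheta) (q := dL) (W := gen) dTheta_dL
    (fun a => (dTheta_dL a).symm) (fun _ => rfl) serK
  rw [bracket_lieT_serK, dL_serK, map_sub, transform_X_mul, transform_mul, map_sub, map_smul,
    map_add, transform_one, lieT_serG] at h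
  have h2 := congrArg (fun f => 2 * proj f) h
  simp only [map_sub, map_add, map_mul, proj_smul, proj_X, proj_serG, map_one, proj_dTheta] at h2
  change 2 * (1 - PowerSeries.X * (tU * (1 - (1 / 2 : ℚ) • (tZ + tZb)))) =
    2 * (tN + coeffwise θ tLam * tN) at h2
  have h3 := two_smul_half (tZ + tZb)
  linear_combination -h2 + PowerSeries.X * tU * h3

/-- The energy integral. -/
theorem four_mul_tK : 4 * tK = 4 * tU - PowerSeries.X * (tU * tU * (2 - tZ - tZb)) := by
  have h : tK = tU * 1 - (1 / 2 : ℚ) • (PowerSeries.X * (tU * tU *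
      (1 - (1 / 2 : ℚ) • (tZ + tZb)))) := by
    have hT : lieT gen serK = lieT gen serL * serG - (1 / 2 : ℚ) • (PowerSeries.X *
        (lieT gen serL * lieT gen serL *
          (1 - (1 / 2 : ℚ) • (lieT gen serZ + lieT gen serZbar)))) := by
      rw [serK, map_sub, transform_mul, map_smul, transform_X_mul, transform_mul, transform_mul,
        map_sub, map_smul, map_add, transform_one, lieT_serG]
    rw [tK, hT]
    simp only [map_sub, map_add, map_mul, proj_smul, proj_X, proj_serG, map_one]
    rfl
  have h1 := two_smul_half (PowerSeries.X * (tU * tU * (1 - (1 / 2 : ℚ) • (tZ + tZb))))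
  have h2 := two_smul_half (tZ + tZb)
  linear_combination 4 * h - 2 * h1 + PowerSeries.X * tU * tU * h2

/-- The mean motion of `g`. -/
theorem tU_eq : tU = 2 * tK - tN + tN * coeffwise θ tGam := by
  have h := transform_coeffwise (p := dTheta) (q := dL) (W := gen) dTheta_dL
    (r := dG) (fun a => (dTheta_dG a).symm) dG_dL serK
  rw [bracket_lieT_serK, dG_serK] at h
  have h2 := congrArg proj h
  rw [map_add, map_mul, proj_dTheta] at h2
  have h3 : proj (coeffwise dG (lieT gen serK)) = 2 * tK - tN := by
    ext1 n
    have e : (2 : PowerSeries TrigAlg) * tK = (2 : ℚ) • tK := by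
      rw [Algebra.smul_def, map_ofNat]
    rw [coeff_proj, coeff_coeffwise, toTrig_dG (homog_gen.transform homog_serK n), map_sub,
      coeff_tN, e, LinearMap.map_smul_of_tower, ← sub_smul, tK, coeff_proj]
    congr 1; ring
  rw [h3] at h2
  change tU = 2 * tK - tN + coeffwise θ tGam * tN at h2
  rw [mul_comm tN]
  exact h2

/-- Hamilton's equations in the new variables: the averaged Hamiltonian does not contain the angle,
so the time derivative of any transformed function is the frequency times its derivative with
respect to the angle. It is applied to `L`, `z` and `z̄`. -/
theorem bracket_serK {f : PowerSeries PhaseAlg} :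
    lieT gen (bracket dTheta dL f serK) =
      coeffwise dTheta (lieT gen f) * coeffwise dL (lieT gen serK) := by
  rw [transform_bracket dTheta_dL, bracket_lieT_serK]

theorem tN_mul_θ_tU :
    4 * (tN * coeffwise θ tU) = -(PowerSeries.X * (tU * tU * (tZ - tZb))) := by
  have h := bracket_serK (f := serL)
  rw [bracket, dTheta_serL, dL_serL, dTheta_serK, zero_mul, zero_sub, one_mul, map_neg, map_smul,
    transform_X_mul, transform_mul, transform_mul, map_sub] at h
  have h2 := congrArg proj h
  simp only [map_neg, map_sub, map_mul, proj_smul, proj_X, proj_dTheta] at h2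
  change -((1 / 4 : ℚ) • (PowerSeries.X * (tU * tU * (tZ - tZb)))) = coeffwise θ tU * tN at h2
  have h3 : (4 : PowerSeries TrigAlg) * ((1 / 4 : ℚ) • (PowerSeries.X * (tU * tU * (tZ - tZb)))) =
      PowerSeries.X * (tU * tU * (tZ - tZb)) := by
    have h : (4 : PowerSeries TrigAlg) = algebraMap ℚ (PowerSeries TrigAlg) 4 := by
      rw [map_ofNat]
    rw [h, ← Algebra.smul_def, smul_smul]; norm_num
  linear_combination -4 * h2 - h3

theorem two_mul_lieT_dL : 2 * proj (lieT gen (coeffwise dL serK)) =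
    2 - PowerSeries.X * (tU * (2 - tZ - tZb)) := by
  have hT : lieT gen (coeffwise dL serK) = serG - PowerSeries.X *
      (lieT gen serL * (1 - (1 / 2 : ℚ) • (lieT gen serZ + lieT gen serZbar))) := by
    rw [dL_serK, map_sub, transform_X_mul, transform_mul, map_sub, map_smul,
      map_add, transform_one, lieT_serG]
  rw [hT]
  simp only [map_sub, map_add, map_mul, proj_smul, proj_X, proj_serG, map_one]
  change 2 * (1 - PowerSeries.X * (tU * (1 - (1 / 2 : ℚ) • (tZ + tZb)))) = _
  have h3 := two_smul_half (tZ + tZb)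
  linear_combination PowerSeries.X * tU * h3

theorem tN_mul_θ_tZ :
    2 * (tN * coeffwise θ tZ) = tZ * (2 - PowerSeries.X * (tU * (2 - tZ - tZb))) := by
  have h := bracket_serK (f := serZ)
  rw [bracket, dTheta_serZ, dL_serZ, zero_mul, sub_zero, transform_mul] at h
  have h2 := congrArg proj h
  rw [map_mul, map_mul, proj_dTheta] at h2
  change tZ * _ = coeffwise θ tZ * tN at h2
  linear_combination -2 * h2 + tZ * two_mul_lieT_dL

theorem tN_mul_θ_tZb :
    2 * (tN * coeffwise θ tZb) = -(tZb * (2 - PowerSeries.X * (tU * (2 - tZ - tZb)))) := by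
  have h := bracket_serK (f := serZbar)
  rw [bracket, dTheta_serZbar, dL_serZbar, zero_mul, sub_zero, transform_mul, map_neg] at h
  have h2 := congrArg proj h
  rw [map_mul, map_mul, map_neg, proj_dTheta] at h2
  change -tZb * _ = coeffwise θ tZb * tN at h2
  linear_combination -2 * h2 - tZb * two_mul_lieT_dL

/-- This is `Z = z exp Λ` in differential form, which avoids exponentials of power series. -/
theorem ddε_tZ : ddε tZ = tZ * ddε tLam := by
  rw [tZ, tLam, ← proj_ddε, ← proj_ddε, ddε_transform, corrEll, ddε_correction, lieDeriv_apply,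
    bracket, dTheta_serZ, dL_serZ, zero_mul, sub_zero, serZ,
    show ddε (PowerSeries.C (mono 0 0 1 0)) = 0 from PowerSeries.derivative_C, zero_add,
    transform_mul, map_mul]

theorem ddε_tZb : ddε tZb = -(tZb * ddε tLam) := by
  rw [tZb, tLam, ← proj_ddε, ← proj_ddε, ddε_transform, corrEll, ddε_correction, lieDeriv_apply,
    bracket, dTheta_serZbar, dL_serZbar, zero_mul, sub_zero, serZbar,
    show ddε (PowerSeries.C (mono 0 0 0 1)) = 0 from PowerSeries.derivative_C, zero_add,
    transform_mul, map_mul, map_neg, map_neg]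
  ring

/-- The product `z z̄` stands for the constant `β²`; both partial derivatives annihilate it, so the
transform fixes it. -/
theorem tZ_mul_tZb : tZ * tZb = PowerSeries.C (zz * zzb) := by
  have h : lieT gen (serZ * serZbar) = serZ * serZbar := by
    refine transform_eq_self ?_ ?_
    · rw [Derivation.leibniz, dTheta_serZ, dTheta_serZbar, smul_eq_mul, smul_eq_mul]; ring
    · rw [Derivation.leibniz, dL_serZ, dL_serZbar]; simp
  rw [tZ, tZb, ← map_mul, ← transform_mul]
  change proj (lieT gen (serZ * serZbar)) = _
  rw [h, map_mul, map_mul, serZ, serZbar, proj, PowerSeries.map_C, PowerSeries.map_C,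
    show (toTrig : PhaseAlg →+* TrigAlg) (mono 0 0 1 0) = zz from toTrig_mono ..,
    show (toTrig : PhaseAlg →+* TrigAlg) (mono 0 0 0 1) = zzb from toTrig_mono ..]

theorem coeff_zero_tZ : PowerSeries.coeff 0 tZ = zz := by
  rw [tZ, coeff_proj, coeff_zero_transform, serZ, PowerSeries.coeff_zero_C, toTrig_mono]; rfl

theorem coeff_zero_tZb : PowerSeries.coeff 0 tZb = zzb := by
  rw [tZb, coeff_proj, coeff_zero_transform, serZbar, PowerSeries.coeff_zero_C, toTrig_mono]; rfl

theorem coeff_zero_tU : PowerSeries.coeff 0 tU = 1 := by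
  rw [tU, coeff_proj, coeff_zero_transform, serL, PowerSeries.coeff_zero_C, toTrig_mono]; rfl

theorem coeff_zero_tK : PowerSeries.coeff 0 tK = 1 := by
  rw [tK, coeff_proj, coeff_zero_transform, coeff_zero_serK, toTrig_mono]; rfl

theorem coeff_zero_tLam : PowerSeries.coeff 0 tLam = 0 := by
  rw [tLam, coeff_proj, corrEll, coeff_zero_correction, map_zero]

theorem coeff_zero_tGam : PowerSeries.coeff 0 tGam = 0 := by
  rw [tGam, coeff_proj, corrAng, coeff_zero_correction, map_zero]

/-! ### Parity -/

theorem trefl_coeff_proj {f : PowerSeries PhaseAlg} (n : ℕ) :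
    trefl (PowerSeries.coeff n (proj f)) =
      PowerSeries.coeff n (proj (PowerSeries.map (refl : PhaseAlg →+* PhaseAlg) f)) := by
  rw [coeff_proj, coeff_proj, PowerSeries.coeff_map, ← toTrig_refl]; rfl

theorem map_refl_lieT (f : PowerSeries PhaseAlg) :
    PowerSeries.map (refl : PhaseAlg →+* PhaseAlg) (lieT gen f) =
      lieT gen (PowerSeries.map (refl : PhaseAlg →+* PhaseAlg) f) :=
  map_transform refl refl_dTheta refl_dL refl_gen f

theorem trefl_tU (n : ℕ) : trefl (PowerSeries.coeff n tU) = PowerSeries.coeff n tU := by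
  rw [tU, trefl_coeff_proj, map_refl_lieT, serL, PowerSeries.map_C,
    show (refl : PhaseAlg →+* PhaseAlg) (mono 1 0 0 0) = _ from refl_mono ..]

/-- When `r` commutes with the reflection, `r W` is odd like `W`, and the transform preserves
parity. -/
theorem map_refl_correction {r : Derivation ℚ PhaseAlg PhaseAlg} (hr : ∀ f, refl (r f) = r (refl f)) :
    PowerSeries.map (refl : PhaseAlg →+* PhaseAlg) (correction dTheta dL r gen) =
      -correction dTheta dL r gen := by
  refine PowerSeries.ext fun n => ?_
  cases n with
  | zero => rw [PowerSeries.coeff_map, map_neg, coeff_zero_correction, map_zero, neg_zero]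
  | succ n =>
    have h1 : PowerSeries.map (refl : PhaseAlg →+* PhaseAlg) (coeffwise r gen) =
        -coeffwise r gen := by
      rw [← map_neg, ← refl_gen]
      ext1 n
      rw [PowerSeries.coeff_map, coeff_coeffwise, coeff_coeffwise, PowerSeries.coeff_map]
      exact hr _
    have h2 := congrArg (PowerSeries.coeff n) (map_refl_lieT (coeffwise r gen))
    rw [h1, map_neg, map_neg, PowerSeries.coeff_map, coeff_transform] at h2
    have h3 : refl ((1 / (n.factorial : ℚ)) • PowerSeries.coeff 0
        ((lieDeriv dTheta dL gen ^ n) (coeffwise r gen))) = _ := h2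
    rw [map_smul, ← smul_neg, smul_right_inj (by have := n.factorial_ne_zero; positivity)] at h3
    rw [PowerSeries.coeff_map, map_neg, coeff_correction_succ]
    change refl _ = _
    rw [map_smul, h3, smul_neg]

theorem trefl_tLam (n : ℕ) : trefl (PowerSeries.coeff n tLam) = -PowerSeries.coeff n tLam := by
  rw [tLam, trefl_coeff_proj, corrEll, map_refl_correction refl_dL, map_neg, map_neg]

theorem trefl_tGam (n : ℕ) : trefl (PowerSeries.coeff n tGam) = -PowerSeries.coeff n tGam := by
  rw [tGam, trefl_coeff_proj, corrAng, map_refl_correction refl_dG, map_neg, map_neg]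

end RigidBody
end

noncomputable section

namespace RigidBody

open LieSeries

/-! ### Bounds for the harmonics -/

theorem coeffwise_θ_tN : coeffwise θ tN = 0 := by
  ext1 n
  have h := congrArg (PowerSeries.coeff n) θ_tK
  rw [coeff_coeffwise, map_zero] at h
  rw [coeff_coeffwise, coeff_tN, Derivation.map_smul, h, smul_zero, map_zero]

theorem tU_ne_zero : tU ≠ 0 := by
  intro h
  have := coeff_zero_tU
  rw [h, map_zero] at this
  exact zero_ne_one this

theorem ofNat_ne_zero_of_algebra {S : Type*} [CommRing S] [Nontrivial S] [Algebra ℚ S] (n : ℕ)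
    [n.AtLeastTwo] : (OfNat.ofNat n : S) ≠ 0 := by
  rw [← map_ofNat (algebraMap ℚ S) n, Ne, map_eq_zero_iff _ (algebraMap ℚ S).injective]
  exact OfNat.ofNat_ne_zero n

/-- The second-order equation for the momentum. -/
theorem tU_second_order : 2 * (tN * tN * coeffwise θ (coeffwise θ tU)) =
    (1 - PowerSeries.C (zz * zzb)) * (PowerSeries.X ^ 2 * tU ^ 3) - 3 * (PowerSeries.X * tU ^ 2)
      + 2 * tU + 2 * (tK * (PowerSeries.X * tU)) - 2 * tK := by
  have h1 := tN_mul_θ_tU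
  have h2 := congrArg (coeffwise θ) h1
  have h4 : coeffwise θ (4 : PowerSeries TrigAlg) = 0 := by
    exact_mod_cast (coeffwise θ).map_natCast 4
  simp only [Derivation.leibniz, map_sub, coeffwise_θ_tN, coeffwise_X, smul_eq_mul, mul_zero,
    add_zero, h4, map_neg] at h2
  have h3 := tN_mul_θ_tZ
  have h5 := tN_mul_θ_tZb
  have h6 := four_mul_tK
  have h7 := tZ_mul_tZb
  set x := coeffwise θ tU
  set X : PowerSeries TrigAlg := PowerSeries.X
  set b := PowerSeries.C (zz * zzb)
  -- After multiplication by `8 U`, the exponentials occur only in the combinations `ε U² (Z + Z̄)`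
  -- and `ε² U⁴ (Z - Z̄)²`. The energy integral and `Z Z̄ = z z̄` express both of these by `U` and
  -- `K`.
  refine mul_left_cancel₀ (mul_ne_zero (ofNat_ne_zero_of_algebra 8) tU_ne_zero) ?_
  have e : 4 * tN * (4 * (tN * coeffwise θ x)) * tU =
      -(X * tU * (2 * tU * (4 * (tN * x)) * (tZ - tZb) + 2 * tU ^ 2 *
        (2 * (tN * coeffwise θ tZ) - 2 * (tN * coeffwise θ tZb)))) := by
    linear_combination (4 * tN * tU) * h2
  rw [h1, h3, h5] at e
  have e1 : X * tU ^ 2 * (tZ + tZb) = 2 * X * tU ^ 2 - 4 * tU + 4 * tK := by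
    linear_combination -h6
  have e2 : tU * (2 - X * (tU * (2 - tZ - tZb))) = 4 * tK - 2 * tU := by
    linear_combination -h6
  have e3 : X ^ 2 * tU ^ 4 * (tZ - tZb) ^ 2 =
      (2 * X * tU ^ 2 - 4 * tU + 4 * tK) ^ 2 - 4 * b * X ^ 2 * tU ^ 4 := by
    rw [← e1]
    linear_combination -4 * X ^ 2 * tU ^ 4 * h7
  have e4 : 16 * (tN * tN * coeffwise θ x) * tU = 2 * (X ^ 2 * tU ^ 4 * (tZ - tZb) ^ 2) -
      2 * (X * tU ^ 2 * (tZ + tZb)) * (tU * (2 - X * (tU * (2 - tZ - tZb)))) := by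
    linear_combination e
  rw [e3, e1, e2] at e4
  linear_combination e4

/-- The elements whose harmonics are at most `r` in absolute value. -/
def harmLE (r : ℚ) : Submodule ℚ TrigAlg where
  carrier := {f | ∀ g, r < |harm g| → f.coeff g = 0}
  add_mem' := fun {f h} hf hh g hg => by
    rw [AddMonoidAlgebra.coeff_add, Finsupp.add_apply, hf g hg, hh g hg, add_zero]
  zero_mem' := fun g _ => rfl
  smul_mem' := fun r f hf g hg => by
    rw [AddMonoidAlgebra.coeff_smul, Finsupp.smul_apply, hf g hg, smul_zero]

theorem harmLE_mono {r s : ℚ} (h : r ≤ s) {f : TrigAlg} (hf : f ∈ harmLE r) : f ∈ harmLE s :=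
  fun g hg => hf g (h.trans_lt hg)

theorem mul_mem_harmLE {r s : ℚ} {f h : TrigAlg} (hf : f ∈ harmLE r) (hh : h ∈ harmLE s) :
    f * h ∈ harmLE (r + s) := by
  classical
  intro g hg
  rw [AddMonoidAlgebra.coeff_mul, Finsupp.sum]
  refine Finset.sum_eq_zero fun g₁ _ => ?_
  rw [Finsupp.sum]
  refine Finset.sum_eq_zero fun g₂ _ => ?_
  split
  · rename_i hgg
    by_cases h1 : r < |harm g₁|
    · rw [hf _ h1, zero_mul]
    · by_cases h2 : s < |harm g₂|
      · rw [hh _ h2, mul_zero]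
      · exfalso
        rw [← hgg, map_add] at hg
        have := abs_add_le (harm g₁) (harm g₂)
        linarith
  · rfl

theorem diag_mem_harmLE {r : ℚ} (m : ℕ × ℕ → ℚ) {f : TrigAlg} (hf : f ∈ harmLE r) :
    diag m f ∈ harmLE r := fun g hg => by rw [coeff_diag, hf g hg, mul_zero]

theorem mem_harmLE_of_θ {r : ℚ} (hr : 0 ≤ r) {f : TrigAlg} (hf : θ f ∈ harmLE r) :
    f ∈ harmLE r := fun g hg => by
  have h := hf g hg
  rw [θ, degreeDerivation_apply, coeff_diag] at h
  refine (mul_eq_zero.1 h).resolve_left fun h0 => ?_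
  rw [h0, abs_zero] at hg
  linarith

theorem mem_harmLE_of_θ_eq_zero {r : ℚ} (hr : 0 ≤ r) {f : TrigAlg} (hf : θ f = 0) :
    f ∈ harmLE r := mem_harmLE_of_θ hr (by rw [hf]; exact Submodule.zero_mem _)

/-- Below the order `n`, the harmonics in the coefficient of order `i` are at most `c * i`. -/
def HarmBound (c : ℚ) (n : ℕ) (f : PowerSeries TrigAlg) : Prop :=
  ∀ i < n, PowerSeries.coeff i f ∈ harmLE (c * i)

namespace HarmBound

variable {c : ℚ} {n : ℕ} {f h : PowerSeries TrigAlg}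

theorem add (hf : HarmBound c n f) (hh : HarmBound c n h) : HarmBound c n (f + h) :=
  fun i hi => by rw [map_add]; exact Submodule.add_mem _ (hf i hi) (hh i hi)

theorem sub (hf : HarmBound c n f) (hh : HarmBound c n h) : HarmBound c n (f - h) :=
  fun i hi => by rw [map_sub]; exact Submodule.sub_mem _ (hf i hi) (hh i hi)

theorem coeff_mul_mem {i : ℕ} (h1 : ∀ ij ∈ Finset.HasAntidiagonal.antidiagonal i,
    PowerSeries.coeff ij.1 f * PowerSeries.coeff ij.2 h ∈ harmLE (c * ij.1 + c * ij.2)) :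
    PowerSeries.coeff i (f * h) ∈ harmLE (c * i) := by
  rw [PowerSeries.coeff_mul]
  refine Submodule.sum_mem _ fun ij hij => ?_
  have h2 : ((ij.1 : ℚ) + ij.2) = i := by
    exact_mod_cast Finset.HasAntidiagonal.mem_antidiagonal.1 hij
  rw [← h2, mul_add]
  exact h1 ij hij

theorem mul (hf : HarmBound c n f) (hh : HarmBound c n h) : HarmBound c n (f * h) :=
  fun i hi => coeff_mul_mem fun ij hij => by
    have h2 := Finset.HasAntidiagonal.mem_antidiagonal.1 hij
    exact mul_mem_harmLE (hf _ (by omega)) (hh _ (by omega))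

/-- When neither factor has a constant term, the coefficient of order `n` of the product uses only
coefficients of order below `n`. This gains the order needed to close an induction on a nonlinear
equation. -/
theorem mul_succ (hf : HarmBound c n f) (hh : HarmBound c n h)
    (hf0 : PowerSeries.coeff 0 f = 0) (hh0 : PowerSeries.coeff 0 h = 0) :
    HarmBound c (n + 1) (f * h) :=
  fun i hi => coeff_mul_mem fun ij hij => by
    have h2 := Finset.HasAntidiagonal.mem_antidiagonal.1 hij
    obtain ⟨a, b⟩ := ij
    rcases Nat.eq_zero_or_pos a with h3 | h3
    · subst h3; rw [hf0, zero_mul]; exact Submodule.zero_mem _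
    rcases Nat.eq_zero_or_pos b with h4 | h4
    · subst h4; rw [hh0, mul_zero]; exact Submodule.zero_mem _
    simp only at h2
    exact mul_mem_harmLE (hf _ (by omega)) (hh _ (by omega))

theorem of_θ_eq_zero (hc : 0 ≤ c) (hf : coeffwise θ f = 0) : HarmBound c n f := fun i _ => by
  refine mem_harmLE_of_θ_eq_zero (by positivity) ?_
  rw [← coeff_coeffwise, hf, map_zero]

theorem θ (hf : HarmBound c n f) : HarmBound c n (coeffwise RigidBody.θ f) := fun i hi => by
  rw [coeff_coeffwise]; exact diag_mem_harmLE _ (hf i hi)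

theorem natCast_mul (hc : 0 ≤ c) (k : ℕ) (hf : HarmBound c n f) : HarmBound c n (k * f) :=
  mul (of_θ_eq_zero hc (Derivation.map_natCast _ k)) hf

theorem mono {m : ℕ} (hm : m ≤ n) (hf : HarmBound c n f) : HarmBound c m f :=
  fun i hi => hf i (hi.trans_le hm)

/-- Division by a series with constant coefficient `1`. -/
theorem of_mul (hc : 0 ≤ c) (hf : ∀ n, HarmBound c n f) (hf1 : PowerSeries.coeff 0 f = 1)
    (hfh : ∀ n, HarmBound c n (f * h)) : ∀ n, HarmBound c n h := by
  intro n
  induction n with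
  | zero => intro i hi; omega
  | succ n ih =>
    intro i hi
    have h1 : PowerSeries.coeff i (f * h) = PowerSeries.coeff i h +
        PowerSeries.coeff i ((f - 1) * h) := by rw [← map_add]; congr 1; ring
    have h2 : PowerSeries.coeff i ((f - 1) * h) ∈ harmLE (c * i) := by
      refine coeff_mul_mem fun ij hij => ?_
      have h2 := Finset.HasAntidiagonal.mem_antidiagonal.1 hij
      obtain ⟨a, b⟩ := ij
      rcases Nat.eq_zero_or_pos a with h3 | h3
      · subst h3
        rw [map_sub, hf1, PowerSeries.coeff_zero_one, sub_self, zero_mul]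
        exact Submodule.zero_mem _
      simp only at h2
      refine mul_mem_harmLE (((hf (a + 1)).sub (of_θ_eq_zero hc ?_)) a (by omega)) (ih b (by omega))
      simp
    rw [← sub_eq_iff_eq_add.2 h1]
    exact Submodule.sub_mem _ (hfh (n + 1) i hi) h2

end HarmBound

theorem coeff_zero_tN : PowerSeries.coeff 0 tN = 1 := by
  rw [coeff_tN, coeff_zero_tK]; simp

/-- The second-order equation for `x = ε U` has the linear part `x - θ² x`, and all its other terms
are angle-free or are products of series without constant term. Hence the coefficient of order `i`
is governed by lower orders, whose harmonics add up. Inverting `1 - θ²` fails only at the harmonics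
`±1`, and those have to be excluded only for `i < 2`. -/
theorem harmBound_X_mul_tU (n : ℕ) : HarmBound (1 / 2) n (PowerSeries.X * tU) := by
  have hc : (0 : ℚ) ≤ 1 / 2 := by norm_num
  have hx0 : PowerSeries.coeff 0 (PowerSeries.X * tU) = 0 := PowerSeries.coeff_zero_X_mul _
  induction n with
  | zero => intro i hi; omega
  | succ n ih =>
    intro i hi
    rcases Nat.lt_succ_iff_lt_or_eq.1 hi with h | h
    · exact ih i h
    subst h
    -- This is `ε` times the second-order equation, with the part linear in `x = ε U` at frequency
    -- `1` moved to the left.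
    have key : 2 * (PowerSeries.X * tU - coeffwise θ (coeffwise θ (PowerSeries.X * tU))) =
        ((2 : ℕ) : PowerSeries TrigAlg) * ((tN * tN - 1) * coeffwise θ (coeffwise θ (PowerSeries.X * tU))) -
          (1 - PowerSeries.C (zz * zzb)) *
            (PowerSeries.X * tU * ((PowerSeries.X * tU) * (PowerSeries.X * tU))) +
          ((3 : ℕ) : PowerSeries TrigAlg) * ((PowerSeries.X * tU) * (PowerSeries.X * tU)) -
          ((2 : ℕ) : PowerSeries TrigAlg) * (PowerSeries.X * tK * (PowerSeries.X * tU)) +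
          ((2 : ℕ) : PowerSeries TrigAlg) * (PowerSeries.X * tK) := by
      have e : coeffwise θ (coeffwise θ (PowerSeries.X * tU)) =
          PowerSeries.X * coeffwise θ (coeffwise θ tU) := by
        simp only [Derivation.leibniz, coeffwise_X, smul_eq_mul, mul_zero, add_zero]
      rw [e]
      push_cast
      linear_combination -PowerSeries.X * tU_second_order
    have hXK : coeffwise θ (PowerSeries.X * tK) = 0 := by
      rw [Derivation.leibniz, θ_tK, coeffwise_X]; simp
    have hNN : coeffwise θ (tN * tN - 1) = 0 := by
      rw [map_sub, Derivation.leibniz, coeffwise_θ_tN]; simp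
    have hb : coeffwise θ (1 - PowerSeries.C (zz * zzb)) = 0 := by
      rw [map_sub, coeffwise_C, ← sub_self (0 : PowerSeries TrigAlg)]
      congr 1
      · simp
      · rw [zz, zzb, AddMonoidAlgebra.single_mul_single, θ, degreeDerivation_apply, diag_single,
          harm_apply]
        simp
    have hx2 := ih.mul_succ ih hx0 hx0
    have hx02 : PowerSeries.coeff 0 (PowerSeries.X * tU * (PowerSeries.X * tU)) = 0 := by
      rw [mul_assoc]; exact PowerSeries.coeff_zero_X_mul _
    have hθ0 : PowerSeries.coeff 0 (coeffwise θ (coeffwise θ (PowerSeries.X * tU))) = 0 := by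
      rw [coeff_coeffwise, coeff_coeffwise, hx0, map_zero, map_zero]
    have hN0 : PowerSeries.coeff 0 (tN * tN - 1) = 0 := by
      rw [map_sub, PowerSeries.coeff_mul, Finset.Nat.antidiagonal_zero, Finset.sum_singleton,
        coeff_zero_tN, PowerSeries.coeff_zero_one]
      ring
    have hR := (((((HarmBound.of_θ_eq_zero hc hNN).mul_succ ih.θ.θ hN0 hθ0).natCast_mul hc 2).sub
      ((HarmBound.of_θ_eq_zero hc hb).mul
        (ih.mul_succ (hx2.mono (Nat.le_succ i)) hx0 hx02))).add (hx2.natCast_mul hc 3)).sub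
      (((HarmBound.of_θ_eq_zero hc hXK).mul_succ ih (PowerSeries.coeff_zero_X_mul _)
        hx0).natCast_mul hc 2) |>.add ((HarmBound.of_θ_eq_zero hc hXK).natCast_mul hc 2)
    rw [← key] at hR
    have h1 := hR i (Nat.lt_succ_self i)
    intro g hg
    have h2 := h1 g hg
    have e2 : (2 : PowerSeries TrigAlg) * (PowerSeries.X * tU -
        coeffwise θ (coeffwise θ (PowerSeries.X * tU))) = (2 : ℚ) • (PowerSeries.X * tU -
        coeffwise θ (coeffwise θ (PowerSeries.X * tU))) := by
      rw [Algebra.smul_def, map_ofNat]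
    rw [e2, LinearMap.map_smul_of_tower, map_sub, coeff_coeffwise, coeff_coeffwise,
      AddMonoidAlgebra.coeff_smul, Finsupp.smul_apply, AddMonoidAlgebra.coeff_sub,
      Finsupp.sub_apply, θ, degreeDerivation_apply, degreeDerivation_apply, coeff_diag, coeff_diag,
      smul_eq_mul] at h2
    -- The resonant harmonics `±1`, where `1 - θ²` vanishes. They exceed the bound `i / 2` only for
    -- `i = 0` and `i = 1`, and there the coefficient is known explicitly.
    by_cases hone : harm g * harm g = 1
    · have habs : |harm g| = 1 := by
        have := abs_mul_abs_self (harm g)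
        rw [hone] at this
        nlinarith [abs_nonneg (harm g)]
      rw [habs] at hg
      have hi2 : i < 2 := by
        have : (i : ℚ) < 2 := by linarith
        exact_mod_cast this
      interval_cases i
      · rw [hx0]; rfl
      · rw [show (1 : ℕ) = 0 + 1 from rfl, PowerSeries.coeff_succ_X_mul, coeff_zero_tU,
          AddMonoidAlgebra.one_def, AddMonoidAlgebra.coeff_single, Finsupp.single_apply, if_neg]
        rintro rfl
        rw [map_zero] at hone
        norm_num at hone
    · have h3 : (1 - harm g * harm g) * (PowerSeries.coeff i (PowerSeries.X * tU)).coeff g = 0 := by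
        linear_combination (1 / 2 : ℚ) * h2
      exact (mul_eq_zero.1 h3).resolve_left (sub_ne_zero.2 (Ne.symm hone))

theorem coeff_tU_mem_harmLE (i : ℕ) : PowerSeries.coeff i tU ∈ harmLE ((i + 1) / 2) := by
  have h := harmBound_X_mul_tU (i + 2) (i + 1) (by omega)
  rw [PowerSeries.coeff_succ_X_mul] at h
  convert h using 2
  push_cast; ring

/-- In the equation for the mean motion of `g` everything is angle-free except `U` and `θ Γ`;
division by the frequency then creates no harmonics, and `Γ` inherits the bound for `U`. -/
theorem coeff_tGam_mem_harmLE (i : ℕ) : PowerSeries.coeff i tGam ∈ harmLE ((i + 1) / 2) := by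
  have hc : (0 : ℚ) ≤ 1 / 2 := by norm_num
  have hn : ∀ n, HarmBound (1 / 2) n (tN * (PowerSeries.X * coeffwise θ tGam)) := by
    intro n
    have h0 : coeffwise θ (PowerSeries.X * (2 * tK - tN)) = 0 := by
      have h2 : coeffwise θ (2 : PowerSeries TrigAlg) = 0 := by
        exact_mod_cast (coeffwise θ).map_natCast 2
      simp [Derivation.leibniz, θ_tK, coeffwise_θ_tN, coeffwise_X, h2]
    have h1 := (harmBound_X_mul_tU n).sub (HarmBound.of_θ_eq_zero hc h0)
    have e : PowerSeries.X * tU - PowerSeries.X * (2 * tK - tN) =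
        tN * (PowerSeries.X * coeffwise θ tGam) := by
      linear_combination PowerSeries.X * tU_eq
    rwa [e] at h1
  have h := HarmBound.of_mul hc (fun n => HarmBound.of_θ_eq_zero hc coeffwise_θ_tN) coeff_zero_tN
    hn (i + 2) (i + 1) (by omega)
  rw [PowerSeries.coeff_succ_X_mul, coeff_coeffwise] at h
  refine mem_harmLE_of_θ (by positivity) ?_
  convert h using 2
  push_cast; ring

/-- The energy integral removes the exponentials from the equation for the mean motion of `ℓ`, after
multiplication by `U`. -/
theorem tN_mul_tU_mul : tN * tU * (1 + coeffwise θ tLam) = 2 * tK - tU := by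
  refine mul_left_cancel₀ (ofNat_ne_zero_of_algebra 2) ?_
  linear_combination tU * tN_mul_θ_tLam - four_mul_tK

/-- Solving for `θ Λ` requires division by `U`. So the bound per order must be an integer multiple
that `U` satisfies at every order without an additive offset: `(i + 1) / 2 ≤ i` for `i ≥ 1`, and at
order zero `U` is constant. -/
theorem coeff_tLam_mem_harmLE (i : ℕ) : PowerSeries.coeff i tLam ∈ harmLE i := by
  have hc : (0 : ℚ) ≤ 1 := by norm_num
  have hU : ∀ n, HarmBound 1 n tU := by
    intro n i _
    cases i with
    | zero =>
      rw [coeff_zero_tU]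
      exact mem_harmLE_of_θ_eq_zero (by simp) (by simp)
    | succ i =>
      refine harmLE_mono ?_ (coeff_tU_mem_harmLE (i + 1))
      push_cast
      linarith [(Nat.cast_nonneg i : (0 : ℚ) ≤ i)]
  have h2 : ∀ n, HarmBound 1 n (tN * tU * (1 + coeffwise θ tLam)) := by
    intro n
    rw [tN_mul_tU_mul]
    refine HarmBound.sub (HarmBound.of_θ_eq_zero hc ?_) (hU n)
    have h2 : coeffwise θ (2 : PowerSeries TrigAlg) = 0 := by
      exact_mod_cast (coeffwise θ).map_natCast 2
    simp [Derivation.leibniz, θ_tK, h2]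
  have hNU : ∀ n, HarmBound 1 n (tN * tU) := fun n =>
    (HarmBound.of_θ_eq_zero hc coeffwise_θ_tN).mul (hU n)
  have hNU0 : PowerSeries.coeff 0 (tN * tU) = 1 := by
    rw [PowerSeries.coeff_mul, Finset.Nat.antidiagonal_zero, Finset.sum_singleton,
      coeff_zero_tN, coeff_zero_tU, mul_one]
  have h3 := (HarmBound.of_mul hc hNU hNU0 h2 (i + 1)).sub
    (HarmBound.of_θ_eq_zero (f := 1) hc (by simp))
  have h4 := h3 i (Nat.lt_succ_self i)
  rw [add_sub_cancel_left, coeff_coeffwise, one_mul] at h4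
  exact mem_harmLE_of_θ (by positivity) h4

/-! ### The terms that do not contain `β` -/

/-- The coefficient of the monomial `1`. -/
def constTrig : TrigAlg →ₐ[ℚ] ℚ :=
  AddMonoidAlgebra.lift ℚ ℚ (ℕ × ℕ)
    { toFun := fun g => 0 ^ g.toAdd.1 * 0 ^ g.toAdd.2
      map_one' := by simp
      map_mul' := fun g h => by simp only [toAdd_mul, Prod.fst_add, Prod.snd_add, pow_add]; ring }

theorem constTrig_single (g : ℕ × ℕ) (r : ℚ) :
    constTrig (AddMonoidAlgebra.single g r) = r * (0 ^ g.1 * 0 ^ g.2) := by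
  rw [constTrig, AddMonoidAlgebra.lift_single]; rfl

theorem constTrig_θ (f : TrigAlg) : constTrig (θ f) = 0 := by
  induction f using AddMonoidAlgebra.induction_linear with
  | zero => simp
  | add f₁ f₂ h₁ h₂ => simp only [map_add, h₁, h₂, add_zero]
  | single g r =>
    rw [θ, degreeDerivation_apply, diag_single, constTrig_single, harm_apply]
    rcases Nat.eq_zero_or_pos g.1 with h | h
    · rcases Nat.eq_zero_or_pos g.2 with h' | h'
      · simp [h, h']
      · simp [zero_pow h'.ne']
    · simp [zero_pow h.ne']

def constSeries : PowerSeries TrigAlg →+* PowerSeries ℚ :=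
  PowerSeries.map (constTrig : TrigAlg →+* ℚ)

theorem coeff_constSeries (f : PowerSeries TrigAlg) (n : ℕ) :
    PowerSeries.coeff n (constSeries f) = constTrig (PowerSeries.coeff n f) :=
  PowerSeries.coeff_map _ _ _

theorem constSeries_X : constSeries PowerSeries.X = PowerSeries.X := PowerSeries.map_X _

theorem constSeries_θ (f : PowerSeries TrigAlg) : constSeries (coeffwise θ f) = 0 := by
  ext1 n
  rw [coeff_constSeries, coeff_coeffwise, constTrig_θ, map_zero]

/-- The differential equation is a linear recursion for the coefficients, so the solution at `z = z̄
= 0` vanishes together with its initial value. -/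
theorem constSeries_eq_zero {Z lam : PowerSeries TrigAlg} (h : ddε Z = Z * lam)
    (h0 : constTrig (PowerSeries.coeff 0 Z) = 0) : constSeries Z = 0 := by
  ext1 n
  rw [map_zero]
  induction n using Nat.strong_induction_on with
  | _ n ih =>
    cases n with
    | zero => rw [coeff_constSeries, h0]
    | succ n =>
      have h1 := congrArg (PowerSeries.coeff n) (congrArg constSeries h)
      rw [map_mul, coeff_constSeries, coeff_ddε, map_mul, PowerSeries.coeff_mul,
        Finset.sum_eq_zero, ← coeff_constSeries] at h1
      · refine (mul_eq_zero.1 h1).resolve_right ?_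
        rw [map_add, map_natCast, map_one]; positivity
      · intro ij hij
        have h2 := Finset.HasAntidiagonal.mem_antidiagonal.1 hij
        rw [ih _ (by omega), zero_mul]

theorem constSeries_tZ : constSeries tZ = 0 :=
  constSeries_eq_zero ddε_tZ (by rw [coeff_zero_tZ, zz, constTrig_single]; simp)

theorem constSeries_tZb : constSeries tZb = 0 :=
  constSeries_eq_zero (ddε_tZb.trans (mul_neg _ _).symm)
    (by rw [coeff_zero_tZb, zzb, constTrig_single]; simp)

/-- At `z = z̄ = 0`, that is `β = 0`, the derivatives with respect to the angle and the exponentials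
drop out. The mean motions and the energy then give `2 (U - 1)(1 - ε U) = 0`, whose second factor is
not zero. -/
theorem constSeries_tU : constSeries tU = 1 := by
  have h1 := congrArg constSeries tN_mul_θ_tLam
  have h2 := congrArg constSeries four_mul_tK
  have h3 := congrArg constSeries tU_eq
  simp only [map_mul, map_add, map_sub, constSeries_θ, constSeries_tZ, constSeries_tZb,
    constSeries_X, map_ofNat, map_one] at h1 h2 h3
  set u := constSeries tU
  have h4 : (u - 1) * (2 * (1 - PowerSeries.X * u)) = 0 := by
    linear_combination -2 * h3 - h2 + h1
  refine sub_eq_zero.1 ((mul_eq_zero.1 h4).resolve_right (mul_ne_zero (ofNat_ne_zero_of_algebra 2) fun h => ?_))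
  have h5 := congrArg (PowerSeries.coeff 0) h
  rw [map_sub, PowerSeries.coeff_zero_X_mul, PowerSeries.coeff_zero_one, sub_zero, map_zero] at h5
  exact one_ne_zero h5

theorem constTrig_coeff_tU (i : ℕ) : constTrig (PowerSeries.coeff (i + 1) tU) = 0 := by
  rw [← coeff_constSeries, constSeries_tU, PowerSeries.coeff_one, if_neg (by omega)]

theorem constTrig_coeff_tK (i : ℕ) : constTrig (PowerSeries.coeff (i + 2) tK) = 0 := by
  have h2 := congrArg constSeries four_mul_tK
  simp only [map_mul, map_sub, constSeries_tZ, constSeries_tZb,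
    constSeries_X, map_ofNat, constSeries_tU, mul_one, sub_zero] at h2
  have h3 := congrArg (PowerSeries.coeff (i + 2)) h2
  rw [map_sub, show (4 : PowerSeries ℚ) = PowerSeries.C 4 from (map_ofNat _ 4).symm,
    show (2 : PowerSeries ℚ) = PowerSeries.C 2 from (map_ofNat _ 2).symm, PowerSeries.coeff_C_mul,
    one_mul, PowerSeries.coeff_succ_X_mul, PowerSeries.coeff_C, PowerSeries.coeff_C,
    if_neg (by omega), if_neg (by omega), sub_zero, coeff_constSeries] at h3
  linarith

/-- At order one the mean motion of `g` makes `U` a derivative with respect to the angle, hence of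
average zero. Averaging the energy integral leaves only the constant of the perturbation. -/
theorem coeff_one_tK : PowerSeries.coeff 1 tK = -(1 / 2 : ℚ) • 1 := by
  have h1 := congrArg (PowerSeries.coeff 1) four_mul_tK
  have h2 := congrArg (PowerSeries.coeff 1) tU_eq
  have e4 : ∀ f : PowerSeries TrigAlg, (4 : PowerSeries TrigAlg) * f = (4 : ℚ) • f := by
    intro f; rw [Algebra.smul_def, map_ofNat]
  have e2 : ∀ f : PowerSeries TrigAlg, (2 : PowerSeries TrigAlg) * f = (2 : ℚ) • f := by
    intro f; rw [Algebra.smul_def, map_ofNat]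
  have e0 : PowerSeries.coeff 0 (tU * tU * (2 - tZ - tZb)) = 2 - zz - zzb := by
    simp only [PowerSeries.coeff_mul, Finset.Nat.antidiagonal_zero, Finset.sum_singleton, map_sub,
      coeff_zero_tU, coeff_zero_tZ, coeff_zero_tZb, one_mul]
    rw [show (2 : PowerSeries TrigAlg) = PowerSeries.C 2 from (map_ofNat _ 2).symm,
      PowerSeries.coeff_zero_C]
  have hX : ∀ f : PowerSeries TrigAlg,
      PowerSeries.coeff 1 (PowerSeries.X * f) = PowerSeries.coeff 0 f :=
    fun f => PowerSeries.coeff_succ_X_mul 0 f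
  rw [e4, e4, map_sub, LinearMap.map_smul_of_tower, LinearMap.map_smul_of_tower,
    hX, e0] at h1
  rw [e2, map_add, map_sub, LinearMap.map_smul_of_tower, coeff_tN, PowerSeries.coeff_mul,
    Finset.Nat.sum_antidiagonal_succ, Finset.Nat.antidiagonal_zero, Finset.sum_singleton,
    coeff_coeffwise, coeff_coeffwise, coeff_zero_tN, coeff_zero_tGam, map_zero, mul_zero, add_zero,
    one_mul, ← sub_smul] at h2
  norm_num at h2
  have h3 := congrArg avg h1
  have hz : avg (2 - zz - zzb) = 2 := by
    have h1 : avg (2 : TrigAlg) = 2 := avg_eq_self (by exact_mod_cast θ.map_natCast 2)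
    rw [map_sub, map_sub, h1, zz, zzb, avg, diag_single, diag_single]
    simp
  have hK : avg (PowerSeries.coeff 1 tK) = PowerSeries.coeff 1 tK := by
    refine avg_eq_self ?_
    rw [← coeff_coeffwise, θ_tK, map_zero]
  rw [map_smul, map_sub, map_smul, h2, avg_θ, hz, hK, smul_zero, zero_sub] at h3
  have h4 : (4 : ℚ) • (PowerSeries.coeff 1 tK + (1 / 2 : ℚ) • (1 : TrigAlg)) = 0 := by
    rw [smul_add, h3, smul_smul]
    norm_num
    rw [show (2 : TrigAlg) = algebraMap ℚ TrigAlg 2 from (map_ofNat _ 2).symm,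
      Algebra.algebraMap_eq_smul_one]
    simp
  rw [neg_smul]
  exact eq_neg_of_add_eq_zero_left ((smul_eq_zero_iff_right (by norm_num)).1 h4)

end RigidBody
end

noncomputable section

namespace RigidBody

open LieSeries

/-! ### Triaxiality polynomials of a trigonometric polynomial -/

/-- A polynomial in `β ^ 2 = z * z̄`. -/
def ofPoly : ℚ[X] →ₐ[ℚ] TrigAlg := aeval (zz * zzb)

def sinForm (d : ℕ) (p : ℕ → ℚ[X]) : TrigAlg :=
  ∑ m ∈ Finset.Icc 1 d, (zz ^ m - zzb ^ m) * ofPoly (p m)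

def cosForm (d : ℕ) (p : ℕ → ℚ[X]) : TrigAlg :=
  ∑ m ∈ Finset.Icc 1 d, (zz ^ m + zzb ^ m) * ofPoly (p m)

theorem sinForm_add (d : ℕ) (p p' : ℕ → ℚ[X]) :
    sinForm d (p + p') = sinForm d p + sinForm d p' := by
  simp only [sinForm, Pi.add_apply, map_add, mul_add, Finset.sum_add_distrib]

theorem cosForm_add (d : ℕ) (p p' : ℕ → ℚ[X]) :
    cosForm d (p + p') = cosForm d p + cosForm d p' := by
  simp only [cosForm, Pi.add_apply, map_add, mul_add, Finset.sum_add_distrib]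

theorem sinForm_smul (d : ℕ) (r : ℚ) (p : ℕ → ℚ[X]) :
    sinForm d (r • p) = r • sinForm d p := by
  simp only [sinForm, Pi.smul_apply, map_smul, mul_smul_comm, Finset.smul_sum]

theorem cosForm_smul (d : ℕ) (r : ℚ) (p : ℕ → ℚ[X]) :
    cosForm d (r • p) = r • cosForm d p := by
  simp only [cosForm, Pi.smul_apply, map_smul, mul_smul_comm, Finset.smul_sum]

theorem zz_pow (m : ℕ) : zz ^ m = AddMonoidAlgebra.single (m, 0) 1 := by
  rw [zz, AddMonoidAlgebra.single_pow]; simp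

theorem zzb_pow (m : ℕ) : zzb ^ m = AddMonoidAlgebra.single (0, m) 1 := by
  rw [zzb, AddMonoidAlgebra.single_pow]; simp

theorem ofPoly_monomial (n : ℕ) (r : ℚ) :
    ofPoly (monomial n r) = AddMonoidAlgebra.single (n, n) r := by
  rw [ofPoly, aeval_monomial, mul_pow, zz_pow, zzb_pow, AddMonoidAlgebra.single_mul_single,
    ← Algebra.smul_def, AddMonoidAlgebra.smul_single]
  simp

/-- The forms of a monomial and its reflection. -/
theorem single_add_refl {d : ℕ} {g : ℕ × ℕ} (r : ℚ) (h1 : g.1 ≤ g.2 + d) (h2 : g.2 ≤ g.1 + d) :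
    (∃ p p0, AddMonoidAlgebra.single g r + trefl (AddMonoidAlgebra.single g r) =
      ofPoly p0 + cosForm d p) ∧
    ∃ p, AddMonoidAlgebra.single g r - trefl (AddMonoidAlgebra.single g r) = sinForm d p := by
  obtain ⟨a, c⟩ := g
  rw [trefl_single]
  simp only at h1 h2 ⊢
  have key : ∀ m n : ℕ, 1 ≤ m → m ≤ d →
      cosForm d (Pi.single m (monomial n r)) = AddMonoidAlgebra.single (m + n, n) r +
        AddMonoidAlgebra.single (n, m + n) r ∧
      sinForm d (Pi.single m (monomial n r)) = AddMonoidAlgebra.single (m + n, n) r -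
        AddMonoidAlgebra.single (n, m + n) r := by
    intro m n hm1 hmd
    constructor
    · rw [cosForm, Finset.sum_eq_single_of_mem m (Finset.mem_Icc.2 ⟨hm1, hmd⟩)
        (fun b _ hb => by simp [Pi.single_eq_of_ne hb]), Pi.single_eq_same, ofPoly_monomial,
        zz_pow, zzb_pow, add_mul, AddMonoidAlgebra.single_mul_single,
        AddMonoidAlgebra.single_mul_single]
      simp
    · rw [sinForm, Finset.sum_eq_single_of_mem m (Finset.mem_Icc.2 ⟨hm1, hmd⟩)
        (fun b _ hb => by simp [Pi.single_eq_of_ne hb]), Pi.single_eq_same, ofPoly_monomial,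
        zz_pow, zzb_pow, sub_mul, AddMonoidAlgebra.single_mul_single,
        AddMonoidAlgebra.single_mul_single]
      simp
  rcases lt_trichotomy a c with h | h | h
  · obtain ⟨m, rfl⟩ := Nat.exists_eq_add_of_lt h
    have k := key (m + 1) a (by omega) (by omega)
    rw [show m + 1 + a = a + m + 1 by ring] at k
    refine ⟨⟨Pi.single (m + 1) (monomial a r), 0, ?_⟩, ⟨(-1 : ℚ) • Pi.single (m + 1) (monomial a r), ?_⟩⟩
    · rw [map_zero, zero_add, k.1, add_comm]
    · rw [sinForm_smul, k.2]; simp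
  · subst h
    refine ⟨⟨0, monomial a (r + r), ?_⟩, ⟨0, ?_⟩⟩
    · rw [ofPoly_monomial, AddMonoidAlgebra.single_add]
      simp [cosForm]
    · simp [sinForm]
  · obtain ⟨m, rfl⟩ := Nat.exists_eq_add_of_lt h
    have k := key (m + 1) c (by omega) (by omega)
    rw [show m + 1 + c = c + m + 1 by ring] at k
    refine ⟨⟨Pi.single (m + 1) (monomial c r), 0, ?_⟩, ⟨_, k.2.symm⟩⟩
    rw [map_zero, zero_add, k.1]

/-- A monomial `z^a z̄^c` is a power of `z z̄` times a pure power of `z` or `z̄`, with exponent the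
harmonic. Adding or subtracting the reflection pairs these into cosines or sines; the claim then
follows by linearity over the support. -/
theorem exists_forms {d : ℕ} {f : TrigAlg}
    (hf : ∀ g, f.coeff g ≠ 0 → g.1 ≤ g.2 + d ∧ g.2 ≤ g.1 + d) :
    (∃ p p0, f + trefl f = ofPoly p0 + cosForm d p) ∧ ∃ p, f - trefl f = sinForm d p := by
  classical
  have hsum : f = ∑ g ∈ f.coeff.support, AddMonoidAlgebra.single g (f.coeff g) :=
    (AddMonoidAlgebra.sum_coeff_single f).symm
  have key : ∀ s : Finset (ℕ × ℕ), s ⊆ f.coeff.support →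
      (∃ p p0, (∑ g ∈ s, AddMonoidAlgebra.single g (f.coeff g)) +
        trefl (∑ g ∈ s, AddMonoidAlgebra.single g (f.coeff g)) = ofPoly p0 + cosForm d p) ∧
      ∃ p, (∑ g ∈ s, AddMonoidAlgebra.single g (f.coeff g)) -
        trefl (∑ g ∈ s, AddMonoidAlgebra.single g (f.coeff g)) = sinForm d p := by
    intro s
    induction s using Finset.induction_on with
    | empty => exact fun _ => ⟨⟨0, 0, by simp [cosForm]⟩, ⟨0, by simp [sinForm]⟩⟩
    | insert a s ha ih =>
      intro hs
      obtain ⟨⟨p, p0, h1⟩, p', h2⟩ := ih fun g hg => hs (Finset.mem_insert_of_mem hg)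
      have h3 := hf a (Finsupp.mem_support_iff.1 (hs (Finset.mem_insert_self _ _)))
      obtain ⟨⟨r, r0, h4⟩, r', h5⟩ := single_add_refl (f.coeff a) h3.1 h3.2
      rw [Finset.sum_insert ha, map_add]
      refine ⟨⟨r + p, r0 + p0, ?_⟩, ⟨r' + p', ?_⟩⟩
      · rw [cosForm_add, map_add]
        linear_combination h1 + h4
      · rw [sinForm_add]
        linear_combination h2 + h5
  have h := key _ (Finset.Subset.refl _)
  rwa [← hsum] at h

/-- Harmonics are integers, so a rational bound below `d + 1` may be rounded down to `d`. For the
bound `(i + 1) / 2` this produces the floor in the summation limits. -/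
theorem harm_bound_of_mem {r : ℚ} {d : ℕ} (hd : r < d + 1) {f : TrigAlg} (hf : f ∈ harmLE r)
    (g : ℕ × ℕ) (hg : f.coeff g ≠ 0) : g.1 ≤ g.2 + d ∧ g.2 ≤ g.1 + d := by
  have h1 : |harm g| ≤ r := not_lt.1 fun h => hg (hf g h)
  rw [harm_apply, abs_le] at h1
  constructor
  · have : (g.1 : ℚ) < g.2 + d + 1 := by linarith
    exact Nat.lt_succ_iff.1 (by exact_mod_cast this)
  · have : (g.2 : ℚ) < g.1 + d + 1 := by linarith
    exact Nat.lt_succ_iff.1 (by exact_mod_cast this)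

theorem half_lt (i : ℕ) : ((i : ℚ) + 1) / 2 < ((i + 1) / 2 : ℕ) + 1 := by
  have : i + 1 < 2 * ((i + 1) / 2) + 2 := by omega
  have h2 : ((i : ℚ) + 1) < 2 * ((i + 1) / 2 : ℕ) + 2 := by exact_mod_cast this
  linarith

theorem exists_sinForm {d : ℕ} {r : ℚ} (hd : r < d + 1) {f : TrigAlg} (hf : f ∈ harmLE r)
    (hs : trefl f = -f) : ∃ p, f = sinForm d p := by
  obtain ⟨p, hp⟩ := (exists_forms (harm_bound_of_mem hd hf)).2
  refine ⟨(1 / 2 : ℚ) • p, ?_⟩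
  rw [sinForm_smul, ← hp, hs, sub_neg_eq_add, ← two_smul ℚ, smul_smul]
  norm_num

theorem exists_cosForm {d : ℕ} {r : ℚ} (hd : r < d + 1) {f : TrigAlg} (hf : f ∈ harmLE r)
    (hs : trefl f = f) : ∃ p p0, f = ofPoly p0 + cosForm d p := by
  obtain ⟨p, p0, hp⟩ := (exists_forms (harm_bound_of_mem hd hf)).1
  refine ⟨(1 / 2 : ℚ) • p, (1 / 2 : ℚ) • p0, ?_⟩
  rw [cosForm_smul, map_smul, ← smul_add, ← hp, hs, ← two_smul ℚ, smul_smul]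
  norm_num

theorem exists_tLam (i : ℕ) : ∃ p, PowerSeries.coeff i tLam = sinForm i p :=
  exists_sinForm (by linarith) (coeff_tLam_mem_harmLE i) (trefl_tLam i)

theorem exists_tGam (i : ℕ) : ∃ p, PowerSeries.coeff i tGam = -sinForm ((i + 1) / 2) p := by
  obtain ⟨p, hp⟩ := exists_sinForm (half_lt i) (coeff_tGam_mem_harmLE i) (trefl_tGam i)
  exact ⟨(-1 : ℚ) • p, by rw [sinForm_smul, hp]; simp⟩

theorem constTrig_ofPoly (p : ℚ[X]) : constTrig (ofPoly p) = p.coeff 0 := by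
  induction p using Polynomial.induction_on' with
  | add p q hp hq => simp [hp, hq]
  | monomial n r =>
    rw [ofPoly_monomial, constTrig_single, coeff_monomial]
    rcases Nat.eq_zero_or_pos n with h | h
    · simp [h]
    · simp [zero_pow h.ne', h.ne']

theorem constTrig_cosForm (d : ℕ) (p : ℕ → ℚ[X]) : constTrig (cosForm d p) = 0 := by
  rw [cosForm, map_sum]
  refine Finset.sum_eq_zero fun m hm => ?_
  have h : m ≠ 0 := by have := (Finset.mem_Icc.1 hm).1; omega
  rw [map_mul, zz_pow, zzb_pow, map_add, constTrig_single, constTrig_single]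
  simp [zero_pow h]

theorem ofPoly_X : ofPoly X = zz * zzb := by rw [ofPoly, aeval_X]

theorem exists_tU (i : ℕ) : ∃ p : ℕ → ℚ[X], PowerSeries.coeff (i + 1) tU =
    ofPoly (X * p 0) - (1 / 2 : ℚ) • cosForm ((i + 1 + 1) / 2) p := by
  have hlt := half_lt (i + 1)
  obtain ⟨p, p0, hp⟩ := exists_cosForm hlt (coeff_tU_mem_harmLE (i + 1)) (trefl_tU (i + 1))
  have h0 := constTrig_coeff_tU i
  rw [hp, map_add, constTrig_ofPoly, constTrig_cosForm, add_zero] at h0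
  obtain ⟨r, hr⟩ := X_dvd_iff.2 h0
  -- The index `0` stores the angle-free part after division by `β²`, whose existence is the
  -- vanishing at `β = 0`. The factor `-2` compensates the `-1/2` in front of `cosForm`.
  refine ⟨fun m => if m = 0 then r else (-2 : ℚ) • p m, ?_⟩
  have e : cosForm ((i + 1 + 1) / 2) (fun m => if m = 0 then r else (-2 : ℚ) • p m) =
      (-2 : ℚ) • cosForm ((i + 1 + 1) / 2) p := by
    rw [← cosForm_smul]
    refine Finset.sum_congr rfl fun m hm => ?_
    have h : m ≠ 0 := by have := (Finset.mem_Icc.1 hm).1; omega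
    simp only [if_neg h, Pi.smul_apply]
  simp only [e, if_pos]
  rw [← hr, hp, smul_smul]
  norm_num

/-- The averaged Hamiltonian is angle-free and even, so its coefficients are polynomials in `z z̄`;
from order two on they vanish at `β = 0`, which gives the factor `β²`. -/
theorem exists_tK (i : ℕ) : ∃ q : ℚ[X], PowerSeries.coeff (i + 2) tK =
    -((1 / 2 : ℚ) • ofPoly (X * q)) := by
  have hθ : θ (PowerSeries.coeff (i + 2) tK) = 0 := by
    rw [← coeff_coeffwise, θ_tK, map_zero]
  have hs : trefl (PowerSeries.coeff (i + 2) tK) = PowerSeries.coeff (i + 2) tK := by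
    rw [tK, trefl_coeff_proj, map_refl_lieT, refl_serK]
  obtain ⟨p, p0, hp⟩ := exists_cosForm (d := 0) (r := 0) (by norm_num)
    (mem_harmLE_of_θ_eq_zero le_rfl hθ) hs
  have h0 := constTrig_coeff_tK i
  rw [hp, map_add, constTrig_ofPoly, constTrig_cosForm, add_zero] at h0
  obtain ⟨r, hr⟩ := X_dvd_iff.2 h0
  refine ⟨(-2 : ℚ) • r, ?_⟩
  rw [hp, hr, mul_smul_comm, map_smul, smul_smul]
  simp [cosForm]

end RigidBody
end

noncomputable section

namespace RigidBody

open LieSeries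

/-! ### Arithmetic of polynomials given by lists of coefficients -/

section ListArithmetic

variable {α : Type} (add mul : α → α → α)

def listAdd : List α → List α → List α
  | [], b => b
  | a, [] => a
  | x :: a, y :: b => add x y :: listAdd a b

def listMul (zero : α) : List α → List α → List α
  | [], _ => []
  | x :: a, b => listAdd add (b.map (mul x)) (zero :: listMul zero a b)

end ListArithmetic

/-- Polynomials in `z̄`, in `z` and `z̄`, and in `ε`, `z` and `z̄`. -/
abbrev Coeff1 : Type := List ℚ
abbrev Coeff2 : Type := List Coeff1
abbrev Coeff3 : Type := List Coeff2

def add1 : Coeff1 → Coeff1 → Coeff1 := listAdd (· + ·)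
def mul1 : Coeff1 → Coeff1 → Coeff1 := listMul (· + ·) (· * ·) 0
def smul1 (r : ℚ) : Coeff1 → Coeff1 := List.map (r * ·)
-- The rational argument is the harmonic of the current leading monomial: a power of `z̄` lowers it
-- by one, and in `theta2` a power of `z` raises it by one. In `euler3` the corresponding argument
-- is the order in `ε`.
def theta1 : ℚ → Coeff1 → Coeff1
  | _, [] => []
  | k, c :: l => (k * c) :: theta1 (k - 1) l

def add2 : Coeff2 → Coeff2 → Coeff2 := listAdd add1
def mul2 : Coeff2 → Coeff2 → Coeff2 := listMul add1 mul1 []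
def smul2 (r : ℚ) : Coeff2 → Coeff2 := List.map (smul1 r)
def theta2 : ℚ → Coeff2 → Coeff2
  | _, [] => []
  | k, c :: l => theta1 k c :: theta2 (k + 1) l

def add3 : Coeff3 → Coeff3 → Coeff3 := listAdd add2
def mul3 : Coeff3 → Coeff3 → Coeff3 := listMul add2 mul2 []
def smul3 (r : ℚ) : Coeff3 → Coeff3 := List.map (smul2 r)
def theta3 : Coeff3 → Coeff3 := List.map (theta2 0)
def euler3 : ℚ → Coeff3 → Coeff3
  | _, [] => []
  | k, c :: l => smul2 k c :: euler3 (k + 1) l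

def isZero2 (l : Coeff2) : Bool := l.all fun c => c.all (· == 0)

/-- A polynomial in `z * z̄`. -/
def diagCoeff : Coeff1 → Coeff2
  | [] => []
  | c :: l => add2 [[c]] ([] :: (diagCoeff l).map (0 :: ·))

/-- `∑ z ^ m * p_m (z * z̄)`. -/
def zCoeff : List (List ℚ) → Coeff2
  | [] => []
  | p :: l => add2 (diagCoeff p) ([] :: zCoeff l)

/-- `∑ z̄ ^ m * p_m (z * z̄)`. -/
def zbCoeff : List (List ℚ) → Coeff2
  | [] => []
  | p :: l => add2 (diagCoeff p) ((zbCoeff l).map (0 :: ·))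

/-- `q_10` is a coefficient of order `11` of the averaged Hamiltonian, and the recursion gives that
order only together with the orders up to `11` of the other series. Rows `10` and `11`, here and in
`LRows`, serve this purpose alone. -/
def ellRows : ℕ → List (List ℚ)
  | 10 =>
    [[11 / 4, 13563 / 128, 7677901 / 16384, 25621479 / 65536, 1681659 / 32768],
     [33 / 8, 3993 / 64, 8845593 / 65536, 3408443 / 65536, 1954199 / 1048576],
     [363 / 128, 81081 / 4096, 342045 / 16384, 837039 / 262144],
     [2277 / 2048, 63939 / 16384, 126093 / 65536, 331 / 4096],
     [22363 / 81920, 1993 / 4096, 12795 / 131072], [2861 / 65536, 2453 / 65536, 551 / 262144],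
     [299 / 65536, 213 / 131072], [79 / 262144, 1 / 32768], [3 / 262144], [1 / 5242880]]
  | 11 =>
    [[3, 2547 / 16, 4098877 / 4096, 172391151 / 131072, 23559243 / 65536, 2604007 / 262144],
     [85 / 16, 7137 / 64, 23391219 / 65536, 15697643 / 65536, 28014537 / 1048576],
     [69 / 16, 43773 / 1024, 4651533 / 65536, 2961111 / 131072, 1462887 / 2097152],
     [2061 / 1024, 85497 / 8192, 1173459 / 131072, 306609 / 262144],
     [2447 / 4096, 13713 / 8192, 11439 / 16384, 1683 / 65536],
     [7755 / 65536, 11553 / 65536, 63 / 2048], [2085 / 131072, 771 / 65536, 615 / 1048576],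
     [377 / 262144, 237 / 524288], [11 / 131072, 1 / 131072], [3 / 1048576], [1 / 23068672]]
  | i => ellTable i

def LRows : ℕ → List (List ℚ)
  | 10 =>
    [[27 / 4, 16065 / 128, 631611 / 2048, 2136051 / 16384, 329373 / 65536],
     [1 / 2, 2061 / 64, 1535103 / 8192, 3095519 / 16384, 3758339 / 131072],
     [9 / 4, 42, 421105 / 4096, 353931 / 8192, 6777 / 4096],
     [63 / 64, 10575 / 2048, 124419 / 32768, 11427 / 32768],
     [21 / 256, 377 / 4096, -147 / 8192, -21 / 8192], [9 / 8192, -17 / 32768, -11 / 131072]]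
  | 11 =>
    [[65 / 8, 54015 / 256, 3151785 / 4096, 1162525 / 2048, 139685 / 2048],
     [1 / 2, 2835 / 64, 3002475 / 8192, 19087433 / 32768, 24140409 / 131072, 3003221 / 524288],
     [45 / 16, 2361 / 32, 17637579 / 65536, 12974583 / 65536, 24843501 / 1048576],
     [105 / 64, 26703 / 2048, 1086459 / 65536, 246771 / 65536, 4749 / 65536],
     [105 / 512, 3795 / 8192, 343 / 8192, -1841 / 65536],
     [45 / 8192, -1 / 65536, -211 / 131072, -13 / 524288], [1 / 65536, -1 / 65536, 3 / 1048576]]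
  | i => LTable i

def ellCoeff (i : ℕ) : Coeff2 :=
  add2 (zCoeff ([] :: ellRows i)) (smul2 (-1) (zbCoeff ([] :: ellRows i)))

def LCoeff : ℕ → Coeff2
  | 0 => [[1]]
  | i => add2 (diagCoeff (0 :: (LRows i).headD []))
      (smul2 (-1 / 2) (add2 (zCoeff ([] :: (LRows i).tail)) (zbCoeff ([] :: (LRows i).tail))))

/-- The order in `ε` is one more than the index of `q`. Orders zero and one, which belong to no `q`,
are given separately. -/
def KCoeff : ℕ → Coeff2
  | 0 => [[1]]
  | 1 => [[-1 / 2]]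
  | i + 2 => smul2 (-1 / 2) (diagCoeff (0 :: qTable (i + 1)))

def gCoeff (i : ℕ) : Coeff2 :=
  smul2 (-1) (add2 (zCoeff ([] :: gTable i)) (smul2 (-1) (zbCoeff ([] :: gTable i))))

def dataU : Coeff3 := (List.range 12).map LCoeff
def dataK : Coeff3 := (List.range 12).map KCoeff
def dataLam : Coeff3 := (List.range 12).map ellCoeff
def dataGam : Coeff3 := (List.range 10).map gCoeff

/-- The sums and products are bracketed as in `relU`, so that evaluation turns this expression into
that one term by term. -/
def listRelU (u k lam : Coeff3) : Coeff3 :=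
  let eu := euler3 0 u
  let ek := euler3 0 k
  add3 (mul3 u (add3 (add3 ek (add3 eu (add3 u (smul3 (-1) k))))
    (mul3 (mul3 (add3 k ek) (theta3 u)) (euler3 0 lam)))) (smul3 (-2) (mul3 k eu))

def listRelLam (u k lam : Coeff3) : Coeff3 :=
  add3 (mul3 (mul3 u (add3 k (euler3 0 k))) (add3 [[[1]]] (theta3 lam)))
    (add3 u (smul3 (-2) k))

def listRelGam (u k gam : Coeff3) : Coeff3 :=
  add3 (add3 u (smul3 (-2) k)) (mul3 (add3 k (euler3 0 k))
    (add3 [[[1]]] (smul3 (-1) (theta3 gam))))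

/-- Exact rational arithmetic in the kernel. The series are truncated, so only orders up to `11` of
the relation are meaningful. -/
theorem listRelLam_data : ((listRelLam dataU dataK dataLam).take 12).all isZero2 = true := by
  decide +kernel

theorem listRelU_data : ((listRelU dataU dataK dataLam).take 12).all isZero2 = true := by
  decide +kernel

theorem listRelGam_data : ((listRelGam dataU dataK dataGam).take 10).all isZero2 = true := by
  decide +kernel

end RigidBody
end

noncomputable section

namespace RigidBody

open LieSeries

/-! ### Evaluation of lists of coefficients -/

section Horner

variable {α R : Type} [CommRing R] {ev : α → R} {add mul : α → α → α} {zero : α}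

def horner (ev : α → R) (x : R) : List α → R
  | [] => 0
  | c :: l => ev c + x * horner ev x l

theorem horner_listAdd (x : R) (hadd : ∀ a b, ev (add a b) = ev a + ev b) :
    ∀ a b, horner ev x (listAdd add a b) = horner ev x a + horner ev x b
  | [], b => by simp [listAdd, horner]
  | a :: l, [] => by simp [listAdd, horner]
  | a :: l, b :: l' => by
    rw [listAdd, horner, horner, horner, horner_listAdd x hadd l l', hadd]
    ring

theorem horner_map (x c : R) {f : α → α} (hf : ∀ a, ev (f a) = c * ev a) :
    ∀ l, horner ev x (l.map f) = c * horner ev x l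
  | [] => by simp [horner]
  | a :: l => by
    rw [List.map_cons, horner, horner, horner_map x c hf l, hf]
    ring

theorem horner_listMul (x : R) (hadd : ∀ a b, ev (add a b) = ev a + ev b)
    (hmul : ∀ a b, ev (mul a b) = ev a * ev b) (h0 : ev zero = 0) :
    ∀ a b, horner ev x (listMul add mul zero a b) = horner ev x a * horner ev x b
  | [], b => by simp [listMul, horner]
  | a :: l, b => by
    rw [listMul, horner_listAdd x hadd, horner_map x (ev a) (hmul a), horner, horner, h0,
      horner_listMul x hadd hmul h0 l b]
    ring

end Horner

def ev1 : Coeff1 → TrigAlg := horner (algebraMap ℚ TrigAlg) zzb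
def ev2 : Coeff2 → TrigAlg := horner ev1 zz
def ev3 : Coeff3 → PowerSeries TrigAlg := horner (fun a => PowerSeries.C (ev2 a)) PowerSeries.X

theorem ev1_add (a b) : ev1 (add1 a b) = ev1 a + ev1 b := horner_listAdd _ (map_add _) a b

theorem ev1_mul (a b) : ev1 (mul1 a b) = ev1 a * ev1 b :=
  horner_listMul _ (map_add _) (map_mul _) (map_zero _) a b

theorem ev1_smul (r : ℚ) (a) : ev1 (smul1 r a) = r • ev1 a := by
  rw [Algebra.smul_def]; exact horner_map _ _ (map_mul _ r) a

theorem ev2_add (a b) : ev2 (add2 a b) = ev2 a + ev2 b := horner_listAdd _ ev1_add a b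

theorem ev2_mul (a b) : ev2 (mul2 a b) = ev2 a * ev2 b := horner_listMul _ ev1_add ev1_mul rfl a b

theorem ev2_smul (r : ℚ) (a) : ev2 (smul2 r a) = r • ev2 a := by
  rw [Algebra.smul_def]
  exact horner_map _ _ (fun a => by rw [ev1_smul, Algebra.smul_def]) a

theorem ev3_add (a b) : ev3 (add3 a b) = ev3 a + ev3 b :=
  horner_listAdd _ (fun a b => by rw [ev2_add, map_add]) a b

theorem ev3_mul (a b) : ev3 (mul3 a b) = ev3 a * ev3 b :=
  horner_listMul (ev := fun a => PowerSeries.C (ev2 a)) _ (fun a b => by rw [ev2_add, map_add])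
    (fun a b => by rw [ev2_mul, map_mul]) (map_zero PowerSeries.C) a b

theorem ev3_smul (r : ℚ) (a) : ev3 (smul3 r a) = r • ev3 a := by
  rw [Algebra.smul_def]
  refine horner_map _ _ (fun a => ?_) a
  rw [ev2_smul, ← Algebra.smul_def]
  ext1 n
  rw [LinearMap.map_smul_of_tower, PowerSeries.coeff_C, PowerSeries.coeff_C]
  split <;> simp

theorem θ_zz : θ zz = zz := by
  rw [θ, degreeDerivation_apply, zz, diag_single]; simp [harm_apply]

theorem θ_zzb : θ zzb = -zzb := by
  rw [θ, degreeDerivation_apply, zzb, diag_single]; simp [harm_apply, AddMonoidAlgebra.single_neg]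

theorem ev1_theta : ∀ (k : ℚ) (l), ev1 (theta1 k l) = k • ev1 l + θ (ev1 l)
  | k, [] => by simp [theta1, ev1, horner]
  | k, c :: l => by
    have h := ev1_theta (k - 1) l
    simp only [ev1] at h ⊢
    rw [theta1, horner, horner, h, map_add, Derivation.leibniz, Derivation.map_algebraMap, θ_zzb]
    simp only [map_mul, Algebra.smul_def, map_sub, map_one]
    simp only [Algebra.algebraMap_self, RingHom.id_apply]
    ring

theorem ev2_theta : ∀ (k : ℚ) (l), ev2 (theta2 k l) = k • ev2 l + θ (ev2 l)
  | k, [] => by simp [theta2, ev2, horner]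
  | k, c :: l => by
    have h := ev2_theta (k + 1) l
    simp only [ev2] at h ⊢
    rw [theta2, horner, horner, h, map_add, Derivation.leibniz, ev1_theta, θ_zz]
    simp only [Algebra.smul_def, map_add, map_one]
    simp only [Algebra.algebraMap_self, RingHom.id_apply]
    ring

theorem ev3_theta : ∀ l, ev3 (theta3 l) = coeffwise θ (ev3 l)
  | [] => by simp [theta3, ev3, horner]
  | c :: l => by
    have h := ev3_theta l
    simp only [ev3, theta3] at h ⊢
    rw [List.map_cons, horner, horner, h, map_add, Derivation.leibniz, coeffwise_C, coeffwise_X,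
      ev2_theta]
    simp

/-- The Euler derivation `ε d/dε`. -/
def euler (f : PowerSeries TrigAlg) : PowerSeries TrigAlg := PowerSeries.X * ddε f

theorem coeff_euler (f : PowerSeries TrigAlg) (n : ℕ) :
    PowerSeries.coeff n (euler f) = (n : ℚ) • PowerSeries.coeff n f := by
  cases n with
  | zero => simp [euler]
  | succ n =>
    rw [euler, PowerSeries.coeff_succ_X_mul, coeff_ddε, Algebra.smul_def, mul_comm, map_natCast,
      Nat.cast_succ]

theorem ev3_euler : ∀ (k : ℚ) (l), ev3 (euler3 k l) = k • ev3 l + euler (ev3 l)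
  | k, [] => by simp [euler3, ev3, horner, euler]
  | k, c :: l => by
    have h := ev3_euler (k + 1) l
    have hC : PowerSeries.C (ev2 (smul2 k c)) = k • PowerSeries.C (ev2 c) := by
      rw [ev2_smul]
      ext1 n
      rw [LinearMap.map_smul_of_tower, PowerSeries.coeff_C, PowerSeries.coeff_C]
      split <;> simp
    simp only [ev3, euler] at h ⊢
    rw [euler3, horner, horner, h, hC, map_add, Derivation.leibniz, ddε_X,
      show ddε (PowerSeries.C (ev2 c)) = 0 from PowerSeries.derivative_C]
    simp only [Algebra.smul_def, map_add, map_one]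
    simp only [Algebra.algebraMap_self, RingHom.id_apply]
    ring

theorem coeff_ev3 : ∀ (l : Coeff3) (i : ℕ), PowerSeries.coeff i (ev3 l) = ev2 (l.getD i [])
  | [], i => by simp [ev3, horner, ev2]
  | c :: l, 0 => by simp [ev3, horner]
  | c :: l, i + 1 => by
    have h := coeff_ev3 l i
    rw [List.getD_cons_succ, ← h]
    simp only [ev3]
    rw [horner, map_add, PowerSeries.coeff_succ_X_mul, PowerSeries.coeff_succ_C, zero_add]

theorem ev1_eq_zero : ∀ {l : Coeff1}, (l.all (· == 0)) = true → ev1 l = 0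
  | [], _ => rfl
  | c :: l, h => by
    rw [List.all_cons, Bool.and_eq_true, beq_iff_eq] at h
    have := ev1_eq_zero h.2
    simp only [ev1] at this ⊢
    rw [horner, this, h.1, map_zero, mul_zero, add_zero]

theorem ev2_eq_zero : ∀ {l : Coeff2}, isZero2 l = true → ev2 l = 0
  | [], _ => rfl
  | c :: l, h => by
    rw [isZero2, List.all_cons, Bool.and_eq_true] at h
    have := ev2_eq_zero (l := l) h.2
    simp only [ev2] at this ⊢
    rw [horner, this, ev1_eq_zero h.1, mul_zero, add_zero]

theorem coeff_ev3_eq_zero {l : Coeff3} {n i : ℕ} (h : (l.take n).all isZero2 = true) (hi : i < n) :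
    PowerSeries.coeff i (ev3 l) = 0 := by
  rw [coeff_ev3]
  by_cases hl : i < l.length
  · refine ev2_eq_zero (List.all_eq_true.1 h _ ?_)
    rw [List.getD_eq_getElem _ _ hl]
    exact List.mem_take_iff_getElem.2 ⟨i, by omega, rfl⟩
  · rw [List.getD_eq_default _ _ (by omega)]; rfl

theorem ev2_diagCoeff : ∀ p, ev2 (diagCoeff p) = ofPoly (ofCoeffs p)
  | [] => by simp [diagCoeff, ofCoeffs, ev2, horner]
  | c :: l => by
    have h := ev2_diagCoeff l
    have hs : ∀ a, ev1 (0 :: a) = zzb * ev1 a := fun a => by simp [ev1, horner]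
    rw [diagCoeff, ev2_add, ofCoeffs, map_add, map_mul, ofPoly_X, ← h]
    simp only [ev2, horner]
    rw [horner_map _ _ hs]
    simp only [ev1, horner, ofPoly, aeval_C]
    ring

theorem ev2_zCoeff : ∀ (R : List (List ℚ)) (d : ℕ), R.length ≤ d →
    ev2 (zCoeff R) = ∑ m ∈ Finset.range d, zz ^ m * ofPoly (ofCoeffs (R.getD m []))
  | [], d, _ => by simp [zCoeff, ev2, horner, ofCoeffs]
  | p :: R, d + 1, h => by
    have ih := ev2_zCoeff R d (by simpa using h)
    rw [zCoeff, ev2_add, ev2_diagCoeff, Finset.sum_range_succ', add_comm]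
    simp only [List.getD_cons_succ, List.getD_cons_zero, pow_succ', mul_assoc, ← Finset.mul_sum,
      ← ih, pow_zero, one_mul]
    simp [ev2, horner, ev1]

theorem ev2_zbCoeff : ∀ (R : List (List ℚ)) (d : ℕ), R.length ≤ d →
    ev2 (zbCoeff R) = ∑ m ∈ Finset.range d, zzb ^ m * ofPoly (ofCoeffs (R.getD m []))
  | [], d, _ => by simp [zbCoeff, ev2, horner, ofCoeffs]
  | p :: R, d + 1, h => by
    have ih := ev2_zbCoeff R d (by simpa using h)
    have hs : ∀ a, ev1 (0 :: a) = zzb * ev1 a := fun a => by simp [ev1, horner]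
    rw [zbCoeff, ev2_add, ev2_diagCoeff, Finset.sum_range_succ', add_comm]
    simp only [List.getD_cons_succ, List.getD_cons_zero, pow_succ', mul_assoc, ← Finset.mul_sum,
      ← ih, pow_zero, one_mul]
    rw [ev2, horner_map _ _ hs]

theorem sum_Icc_one {M : Type*} [AddCommMonoid M] (f : ℕ → M) (d : ℕ) :
    ∑ m ∈ Finset.Icc 1 d, f m = ∑ m ∈ Finset.range d, f (m + 1) := by
  induction d with
  | zero => simp
  | succ d ih => rw [Finset.sum_Icc_succ_top (by omega), ih, Finset.sum_range_succ]

theorem ev2_zCoeff_cons {R : List (List ℚ)} {d : ℕ} (h : R.length ≤ d) :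
    ev2 (zCoeff ([] :: R)) =
      ∑ m ∈ Finset.Icc 1 d, zz ^ m * ofPoly (ofCoeffs (R.getD (m - 1) [])) := by
  rw [ev2_zCoeff _ (d + 1) (by simpa using h), Finset.sum_range_succ', sum_Icc_one]
  simp [ofCoeffs]

theorem ev2_zbCoeff_cons {R : List (List ℚ)} {d : ℕ} (h : R.length ≤ d) :
    ev2 (zbCoeff ([] :: R)) =
      ∑ m ∈ Finset.Icc 1 d, zzb ^ m * ofPoly (ofCoeffs (R.getD (m - 1) [])) := by
  rw [ev2_zbCoeff _ (d + 1) (by simpa using h), Finset.sum_range_succ', sum_Icc_one]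
  simp [ofCoeffs]

theorem ev2_sinForm {R : List (List ℚ)} {d : ℕ} (h : R.length ≤ d) :
    ev2 (add2 (zCoeff ([] :: R)) (smul2 (-1) (zbCoeff ([] :: R)))) =
      sinForm d fun m => ofCoeffs (R.getD (m - 1) []) := by
  rw [ev2_add, ev2_smul, neg_one_smul, ev2_zCoeff_cons h, ev2_zbCoeff_cons h, ← sub_eq_add_neg,
    ← Finset.sum_sub_distrib]
  simp only [sinForm, sub_mul]

theorem ev2_cosForm {R : List (List ℚ)} {d : ℕ} (h : R.length ≤ d) :
    ev2 (add2 (zCoeff ([] :: R)) (zbCoeff ([] :: R))) =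
      cosForm d fun m => ofCoeffs (R.getD (m - 1) []) := by
  rw [ev2_add, ev2_zCoeff_cons h, ev2_zbCoeff_cons h, ← Finset.sum_add_distrib]
  simp only [cosForm, add_mul]

theorem ev2_ellCoeff {i d : ℕ} (h : (ellRows i).length ≤ d) :
    ev2 (ellCoeff i) = sinForm d fun m => ofCoeffs ((ellRows i).getD (m - 1) []) := ev2_sinForm h

theorem ev2_gCoeff {i d : ℕ} (h : (gTable i).length ≤ d) :
    ev2 (gCoeff i) = -sinForm d fun m => ofCoeffs ((gTable i).getD (m - 1) []) := by
  rw [gCoeff, ev2_smul, ev2_sinForm h, neg_one_smul]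

theorem ev2_LCoeff {i d : ℕ} (hi : i ≠ 0) (h : (LRows i).length ≤ d + 1) :
    ev2 (LCoeff i) = ofPoly (X * ofCoeffs ((LRows i).getD 0 [])) -
      (1 / 2 : ℚ) • cosForm d fun m => ofCoeffs ((LRows i).getD m []) := by
  obtain ⟨i, rfl⟩ := Nat.exists_eq_succ_of_ne_zero hi
  have e : ∀ l : List (List ℚ), l.headD [] = l.getD 0 [] := fun l => by cases l <;> rfl
  rw [LCoeff, ev2_add, ev2_smul, ev2_cosForm (d := d) (by rw [List.length_tail]; omega),
    ev2_diagCoeff, ofCoeffs, Polynomial.C_0, zero_add, neg_div, neg_smul, ← sub_eq_add_neg, e]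
  · congr 2
    refine Finset.sum_congr rfl fun m hm => ?_
    obtain ⟨k, rfl⟩ := Nat.exists_eq_add_of_le' (Finset.mem_Icc.1 hm).1
    generalize LRows (i + 1) = l
    cases l <;> simp
  · simp

theorem ev2_KCoeff (i : ℕ) :
    ev2 (KCoeff (i + 2)) = -((1 / 2 : ℚ) • ofPoly (X * ofCoeffs (qTable (i + 1)))) := by
  rw [KCoeff, ev2_smul, ev2_diagCoeff, ofCoeffs, Polynomial.C_0, zero_add, neg_div, neg_smul]

/-! ### The recursion for the coefficients -/

/-- `f` and `f'` have the same coefficients below `j`, and their coefficients `j` differ by `a`. -/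
def Agree (j : ℕ) (f f' : PowerSeries TrigAlg) (a : TrigAlg) : Prop :=
  (∀ i < j, PowerSeries.coeff i f = PowerSeries.coeff i f') ∧
    PowerSeries.coeff j f = PowerSeries.coeff j f' + a

theorem coeff_zero_mul' (f h : PowerSeries TrigAlg) : PowerSeries.coeff 0 (f * h) =
    PowerSeries.coeff 0 f * PowerSeries.coeff 0 h := by
  simp [PowerSeries.coeff_zero_eq_constantCoeff_apply]

namespace Agree

variable {j : ℕ} {f f' h h' : PowerSeries TrigAlg} {a b : TrigAlg}

theorem of_lt (H : ∀ i < j, PowerSeries.coeff i f = PowerSeries.coeff i f') :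
    Agree j f f' (PowerSeries.coeff j f - PowerSeries.coeff j f') := ⟨H, by ring⟩

theorem add (H : Agree j f f' a) (H' : Agree j h h' b) : Agree j (f + h) (f' + h') (a + b) :=
  ⟨fun i hi => by rw [map_add, map_add, H.1 i hi, H'.1 i hi],
    by rw [map_add, map_add, H.2, H'.2]; ring⟩

theorem smul (r : ℚ) (H : Agree j f f' a) : Agree j (r • f) (r • f') (r • a) :=
  ⟨fun i hi => by rw [LinearMap.map_smul_of_tower, LinearMap.map_smul_of_tower, H.1 i hi],
    by rw [LinearMap.map_smul_of_tower, LinearMap.map_smul_of_tower, H.2, smul_add]⟩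

theorem euler (H : Agree j f f' a) : Agree j (euler f) (RigidBody.euler f') ((j : ℚ) • a) :=
  ⟨fun i hi => by rw [coeff_euler, coeff_euler, H.1 i hi],
    by rw [coeff_euler, coeff_euler, H.2, smul_add]⟩

theorem theta (H : Agree j f f' a) : Agree j (coeffwise θ f) (coeffwise θ f') (θ a) :=
  ⟨fun i hi => by rw [coeff_coeffwise, coeff_coeffwise, H.1 i hi],
    by rw [coeff_coeffwise, coeff_coeffwise, H.2, map_add]⟩

theorem sub_eq (H : Agree j f f' a) : ∃ r, f = f' + PowerSeries.X ^ j * r ∧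
    PowerSeries.coeff 0 r = a := by
  obtain ⟨r, hr⟩ := (PowerSeries.X_pow_dvd_iff (n := j) (φ := f - f')).2 fun i hi => by
    rw [map_sub, H.1 i hi, sub_self]
  refine ⟨r, by rw [← hr]; ring, ?_⟩
  have h2 := H.2
  rw [← sub_eq_iff_eq_add', ← map_sub, hr] at h2
  rw [← h2]
  simpa using (PowerSeries.coeff_X_pow_mul r j 0).symm

/-- The product rule for first variations, `f h - f' h' = (f - f') h + f' (h - h')`. At the first
order where the factors may differ, only the constant terms of the others contribute; taking them
from `h` and `f'` makes the formula exact also at order zero. -/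
theorem mul (H : Agree j f f' a) (H' : Agree j h h' b) :
    Agree j (f * h) (f' * h')
      (a * PowerSeries.coeff 0 h + PowerSeries.coeff 0 f' * b) := by
  obtain ⟨r, hr, rfl⟩ := H.sub_eq
  obtain ⟨s, hs, rfl⟩ := H'.sub_eq
  have e : f * h = f' * h' + PowerSeries.X ^ j * (r * h + f' * s) := by
    rw [hr]; conv_lhs => rw [hs]
    rw [show r * h = r * (h' + PowerSeries.X ^ j * s) by rw [← hs]]
    ring
  constructor
  · intro i hi
    rw [e, map_add, PowerSeries.coeff_X_pow_mul', if_neg (by omega), add_zero]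
  · rw [e, map_add, PowerSeries.coeff_X_pow_mul', if_pos le_rfl, Nat.sub_self, map_add,
      coeff_zero_mul', coeff_zero_mul']

end Agree

/-- The relations `relU`, `relLam` and `relGam` contain no exponentials of the angle, so they
involve only series for which tables exist. -/
def relU (u k lam : PowerSeries TrigAlg) : PowerSeries TrigAlg :=
  u * (euler k + (euler u + (u + (-1 : ℚ) • k)) + (k + euler k) * coeffwise θ u * euler lam) +
    (-2 : ℚ) • (k * euler u)

def relLam (u k lam : PowerSeries TrigAlg) : PowerSeries TrigAlg :=
  u * (k + euler k) * (1 + coeffwise θ lam) + (u + (-2 : ℚ) • k)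

def relGam (u k gam : PowerSeries TrigAlg) : PowerSeries TrigAlg :=
  u + (-2 : ℚ) • k + (k + euler k) * (1 + (-1 : ℚ) • coeffwise θ gam)

end RigidBody
end

/-! ### The relations determine the series, and the tables satisfy them -/

noncomputable section

namespace RigidBody

open LieSeries

theorem tN_eq : tN = tK + euler tK := by
  ext1 n
  rw [coeff_tN, map_add, coeff_euler, add_smul, one_smul, add_comm]

theorem neg_one_smul_ser (f : PowerSeries TrigAlg) : (-1 : ℚ) • f = -f := neg_one_smul ℚ f

theorem neg_two_smul_ser (f : PowerSeries TrigAlg) : (-2 : ℚ) • f = -(2 * f) := by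
  rw [show (-2 : ℚ) = -1 + -1 by norm_num, add_smul, neg_one_smul]; ring

/-- Differentiate the energy integral in `ε`. The derivatives of `Z` and `Z̄` bring in `(Z - Z̄)
Λ'`, which the equation of motion of the momentum replaces by `N θU Λ'`. The energy integral itself
removes the remaining `2 - Z - Z̄`, after multiplication by `ε U`. -/
theorem relU_eq_zero : relU tU tK tLam = 0 := by
  have hd := congrArg ddε four_mul_tK
  have hn : ∀ f : PowerSeries TrigAlg, ddε (4 * f) = 4 * ddε f := fun f => by
    rw [show (4 : PowerSeries TrigAlg) * f = f + f + f + f by ring]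
    simp only [map_add]; ring
  have h2 : ddε (2 : PowerSeries TrigAlg) = 0 := by
    have := Derivation.map_natCast (ddε (A := TrigAlg)) 2
    simpa using this
  simp only [map_sub, hn, Derivation.leibniz, smul_eq_mul, ddε_X, ddε_tZ, ddε_tZb, h2] at hd
  have hu := tN_mul_θ_tU
  rw [tN_eq] at hu
  have h4 : (4 : PowerSeries TrigAlg) * relU tU tK tLam = 0 := by
    rw [relU, neg_one_smul_ser, neg_two_smul_ser]
    simp only [euler] at hu ⊢
    linear_combination tU * PowerSeries.X * hd + PowerSeries.X * ddε tLam * tU * hu -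
      (tU + 2 * PowerSeries.X * ddε tU) * four_mul_tK
  exact (mul_eq_zero.1 h4).resolve_left (ofNat_ne_zero_of_algebra 4)

theorem relLam_eq_zero : relLam tU tK tLam = 0 := by
  have h := tN_mul_θ_tLam
  rw [tN_eq] at h
  have h2 : (2 : PowerSeries TrigAlg) * relLam tU tK tLam = 0 := by
    rw [relLam, neg_two_smul_ser]
    linear_combination tU * h - four_mul_tK
  exact (mul_eq_zero.1 h2).resolve_left (ofNat_ne_zero_of_algebra 2)

theorem relGam_eq_zero : relGam tU tK tGam = 0 := by
  have h := tU_eq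
  rw [tN_eq] at h
  rw [relGam, neg_one_smul_ser, neg_two_smul_ser]
  linear_combination h

theorem coeff_zero_euler (f : PowerSeries TrigAlg) : PowerSeries.coeff 0 (euler f) = 0 := by
  rw [coeff_euler]; simp

theorem coeff_zero_theta {f : PowerSeries TrigAlg} (h : PowerSeries.coeff 0 f = 1) :
    PowerSeries.coeff 0 (coeffwise θ f) = 0 := by
  rw [coeff_coeffwise, h, Derivation.map_one_eq_zero]

theorem coeff_zero_theta' {f : PowerSeries TrigAlg} (h : PowerSeries.coeff 0 f = 0) :
    PowerSeries.coeff 0 (coeffwise θ f) = 0 := by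
  rw [coeff_coeffwise, h, map_zero]

theorem agree_one (j : ℕ) : Agree j (1 : PowerSeries TrigAlg) 1 0 :=
  ⟨fun _ _ => rfl, by rw [add_zero]⟩

theorem eq_zero_of_avg {a : TrigAlg} (h : avg a = 0) (hθ : θ a = 0) : a = 0 := by
  rw [← avg_eq_self hθ, h]

/-- Suppose two solutions agree below order `j` and differ there by `a` in `u`, `b` in `k` and `c`
in `lam`. Linearizing at the constant terms gives `(j - 1)(b - a) = 0` and `2 a + (j - 1) b + θ c =
0`. The average of the second equation determines `a = b`, and the rest determines `c`, which has no
average. The first equation says nothing at `j = 1`, so the first order is a hypothesis. -/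
theorem coeff_eq_of_rel {u k lam u' k' lam' : PowerSeries TrigAlg} {n : ℕ}
    (hk : ∀ i, θ (PowerSeries.coeff i k) = 0) (hk' : ∀ i, θ (PowerSeries.coeff i k') = 0)
    (hl : ∀ i, avg (PowerSeries.coeff i lam) = 0) (hl' : ∀ i, avg (PowerSeries.coeff i lam') = 0)
    (hu0 : PowerSeries.coeff 0 u = 1) (hu0' : PowerSeries.coeff 0 u' = 1)
    (hk0 : PowerSeries.coeff 0 k = 1) (hk0' : PowerSeries.coeff 0 k' = 1)
    (hl0 : PowerSeries.coeff 0 lam = 0)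
    (hu1 : PowerSeries.coeff 1 u = PowerSeries.coeff 1 u')
    (hk1 : PowerSeries.coeff 1 k = PowerSeries.coeff 1 k')
    (hA : ∀ i < n, PowerSeries.coeff i (relU u k lam) = PowerSeries.coeff i (relU u' k' lam'))
    (hB : ∀ i < n, PowerSeries.coeff i (relLam u k lam) = PowerSeries.coeff i (relLam u' k' lam')) :
    ∀ j < n, PowerSeries.coeff j u = PowerSeries.coeff j u' ∧
      PowerSeries.coeff j k = PowerSeries.coeff j k' ∧
      PowerSeries.coeff j lam = PowerSeries.coeff j lam' := by
  intro j
  induction j using Nat.strong_induction_on with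
  | _ j ih =>
    intro hj
    have au := Agree.of_lt fun i hi => (ih i hi (hi.trans hj)).1
    have ak := Agree.of_lt fun i hi => (ih i hi (hi.trans hj)).2.1
    have al := Agree.of_lt fun i hi => (ih i hi (hi.trans hj)).2.2
    have ha : θ (PowerSeries.coeff j k - PowerSeries.coeff j k') = 0 := by
      rw [map_sub, hk, hk', sub_zero]
    have hb : avg (PowerSeries.coeff j lam - PowerSeries.coeff j lam') = 0 := by
      rw [map_sub, hl, hl', sub_zero]
    have hu1' : j = 1 → PowerSeries.coeff j u - PowerSeries.coeff j u' = 0 := by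
      rintro rfl; rw [hu1, sub_self]
    have hk1' : j = 1 → PowerSeries.coeff j k - PowerSeries.coeff j k' = 0 := by
      rintro rfl; rw [hk1, sub_self]
    rw [← sub_eq_zero, ← sub_eq_zero (b := PowerSeries.coeff j k'),
      ← sub_eq_zero (b := PowerSeries.coeff j lam')]
    generalize PowerSeries.coeff j u - PowerSeries.coeff j u' = a at *
    generalize PowerSeries.coeff j k - PowerSeries.coeff j k' = b at *
    generalize PowerSeries.coeff j lam - PowerSeries.coeff j lam' = c at *
    have hU := ((au.mul ((ak.euler.add (au.euler.add (au.add (ak.smul (-1))))).add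
      (((ak.add ak.euler).mul au.theta).mul al.euler))).add ((ak.mul au.euler).smul (-2))).2
    have hL := (((au.mul (ak.add ak.euler)).mul ((agree_one j).add al.theta)).add
      (au.add (ak.smul (-2)))).2
    rw [← relU, ← relU, hA j hj] at hU
    rw [← relLam, ← relLam, hB j hj] at hL
    have hU := left_eq_add.1 hU
    have hL := left_eq_add.1 hL
    simp only [map_add, coeff_zero_mul', coeff_zero_euler, hu0, hu0', hk0, hk0',
      coeff_zero_theta hu0, coeff_zero_theta hu0', coeff_zero_theta' hl0,
      LinearMap.map_smul_of_tower, PowerSeries.coeff_zero_one] at hU hL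
    have hU : ((j : ℚ) - 1) • (b - a) = 0 := by
      rw [← hU]
      simp only [Algebra.smul_def, map_sub, map_neg, map_one, map_ofNat]
      ring
    have hL : (2 : ℚ) • a + ((j : ℚ) - 1) • b + θ c = 0 := by
      rw [← hL]
      simp only [Algebra.smul_def, map_sub, map_neg, map_one, map_ofNat]
      ring
    -- For `j = 1` the relation degenerates and the given first-order coefficients are used instead.
    have hab : b = a := by
      by_cases h1 : j = 1
      · rw [hu1' h1, hk1' h1]
      · have : ((j : ℚ) - 1) ≠ 0 := by
          rw [sub_ne_zero]; exact_mod_cast h1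
        exact sub_eq_zero.1 ((smul_eq_zero.1 hU).resolve_left this)
    subst hab
    rw [← add_smul] at hL
    -- Averaging removes `θ c` and leaves `(j + 1) b = 0`; then `θ c = 0`.
    have hb0 := congrArg avg hL
    rw [map_add, avg_θ, map_smul, avg_eq_self ha, add_zero, map_zero] at hb0
    have hb0 := (smul_eq_zero.1 hb0).resolve_left (by rw [show (2 : ℚ) + (j - 1) = j + 1 by ring]; positivity)
    rw [hb0, smul_zero, zero_add] at hL
    exact ⟨hb0, hb0, eq_zero_of_avg hb hL⟩

theorem θ_ofPoly (p : ℚ[X]) : θ (ofPoly p) = 0 := by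
  have h : θ (zz * zzb) = 0 := by
    rw [Derivation.leibniz, θ_zz, θ_zzb, smul_eq_mul, smul_eq_mul]; ring
  rw [ofPoly, Derivation.map_aeval, h, smul_zero]

theorem trefl_sinForm (d : ℕ) (p : ℕ → ℚ[X]) : trefl (sinForm d p) = -sinForm d p := by
  have h1 : trefl zz = zzb := trefl_single _ _
  have h2 : trefl zzb = zz := trefl_single _ _
  have h3 : ∀ p, trefl (ofPoly p) = ofPoly p := fun p => by
    rw [ofPoly, ← Polynomial.aeval_algHom_apply, map_mul, h1, h2, mul_comm]
  rw [sinForm, map_sum, ← Finset.sum_neg_distrib]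
  refine Finset.sum_congr rfl fun m _ => ?_
  rw [map_mul, map_sub, map_pow, map_pow, h1, h2, h3]
  ring

theorem coeff_ev3_map_range (f : ℕ → Coeff2) (n i : ℕ) :
    PowerSeries.coeff i (ev3 ((List.range n).map f)) = if i < n then ev2 (f i) else 0 := by
  rw [coeff_ev3]
  split
  · rw [List.getD_eq_getElem _ _ (by simpa)]; simp
  · rw [List.getD_eq_default _ _ (by simpa using by omega)]; rfl

theorem length_ellRows : ∀ i < 12, (ellRows i).length ≤ i := by decide
theorem length_LRows : ∀ i < 12, (LRows i).length ≤ (i + 1) / 2 + 1 := by decide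
theorem length_gTable : ∀ i < 10, (gTable i).length ≤ (i + 1) / 2 := by decide

theorem ev3_listRelU (u k lam : Coeff3) :
    ev3 (listRelU u k lam) = relU (ev3 u) (ev3 k) (ev3 lam) := by
  simp only [listRelU, relU, ev3_add, ev3_mul, ev3_smul, ev3_theta, ev3_euler, zero_smul, zero_add]

theorem ev3_one : ev3 [[[1]]] = 1 := by
  have h : ev2 [[1]] = 1 := by
    simp only [ev2, ev1, horner, map_one, mul_zero, add_zero]
  simp only [ev3, horner, h, map_one, mul_zero, add_zero]

theorem ev3_listRelLam (u k lam : Coeff3) :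
    ev3 (listRelLam u k lam) = relLam (ev3 u) (ev3 k) (ev3 lam) := by
  simp only [listRelLam, relLam, ev3_add, ev3_mul, ev3_smul, ev3_theta, ev3_euler, zero_smul,
    zero_add, ev3_one]

theorem ev3_listRelGam (u k gam : Coeff3) :
    ev3 (listRelGam u k gam) = relGam (ev3 u) (ev3 k) (ev3 gam) := by
  simp only [listRelGam, relGam, ev3_add, ev3_mul, ev3_smul, ev3_theta, ev3_euler, zero_smul,
    zero_add, ev3_one]

/-- The first order is not supplied by the recursion. The energy integral gives it once the first
order of the averaged Hamiltonian is known. -/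
theorem coeff_one_tU : PowerSeries.coeff 1 tU = ev2 (LCoeff 1) := by
  have h := congrArg (PowerSeries.coeff 1) four_mul_tK
  have h4 : ∀ f : PowerSeries TrigAlg, PowerSeries.coeff 1 (4 * f) = 4 * PowerSeries.coeff 1 f :=
    fun f => by
      rw [show (4 : PowerSeries TrigAlg) * f = f + f + f + f by ring]
      simp only [map_add]; ring
  rw [map_sub, h4, h4, coeff_one_tK, PowerSeries.coeff_succ_X_mul, coeff_zero_mul', coeff_zero_mul',
    map_sub, map_sub, coeff_zero_tU, coeff_zero_tZ, coeff_zero_tZb,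
    show PowerSeries.coeff 0 (2 : PowerSeries TrigAlg) = 2 from by
      rw [PowerSeries.coeff_zero_eq_constantCoeff_apply, map_ofNat]] at h
  have e : ev2 (LCoeff 1) = -((1 / 4 : ℚ) • (zz + zzb)) := by
    rw [ev2_LCoeff (d := 1) one_ne_zero (by decide)]
    simp only [cosForm, LRows, LTable, ofCoeffs, List.getD_cons_zero, Finset.Icc_self,
      Finset.sum_singleton, List.getD_cons_succ, map_zero, mul_zero, add_zero, zero_sub, pow_one]
    rw [ofPoly, aeval_C, mul_comm, ← Algebra.smul_def, smul_smul]
    norm_num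
  rw [e]
  have h5 : (4 : TrigAlg) = algebraMap ℚ TrigAlg 4 := by rw [map_ofNat]
  have h6 : (4 : TrigAlg) * PowerSeries.coeff 1 tU = 4 * -((1 / 4 : ℚ) • (zz + zzb)) := by
    have e1 : (4 : TrigAlg) * ((1 / 4 : ℚ) • (zz + zzb)) = zz + zzb := by
      rw [h5, ← Algebra.smul_def, smul_smul]; norm_num
    have e2 : (4 : TrigAlg) * (-(1 / 2 : ℚ) • 1) = -2 := by
      rw [h5, ← Algebra.smul_def, smul_smul, Algebra.smul_def, mul_one,
        show (4 * -(1 / 2) : ℚ) = -2 by norm_num, map_neg, map_ofNat]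
    rw [e2] at h
    rw [mul_neg, e1]
    linear_combination -h
  have h7 := congrArg (fun x => (1 / 4 : ℚ) • x) h6
  simp only [h5, ← Algebra.smul_def, smul_smul] at h7
  norm_num at h7
  rw [h7]
  norm_num

/-- The true series and the tabulated ones satisfy the same relations below order `12` and share the
first orders, so uniqueness of the recursion identifies them. -/
theorem coeff_eq_data (j : ℕ) (hj : j < 12) :
    PowerSeries.coeff j tU = ev2 (LCoeff j) ∧ PowerSeries.coeff j tK = ev2 (KCoeff j) ∧
      PowerSeries.coeff j tLam = ev2 (ellCoeff j) := by
  have e0 : ev2 [[1]] = 1 := by simp only [ev2, ev1, horner, map_one, mul_zero, add_zero]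
  have e1 : ev2 [[-1 / 2]] = -(1 / 2 : ℚ) • 1 := by
    simp [ev2, ev1, horner, Algebra.smul_def, neg_div]
  have hU : ∀ i < 12, PowerSeries.coeff i (ev3 dataU) = ev2 (LCoeff i) := fun i hi => by
    rw [dataU, coeff_ev3_map_range, if_pos hi]
  have hK : ∀ i < 12, PowerSeries.coeff i (ev3 dataK) = ev2 (KCoeff i) := fun i hi => by
    rw [dataK, coeff_ev3_map_range, if_pos hi]
  have hL : ∀ i < 12, PowerSeries.coeff i (ev3 dataLam) = ev2 (ellCoeff i) := fun i hi => by
    rw [dataLam, coeff_ev3_map_range, if_pos hi]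
  rw [← hU j hj, ← hK j hj, ← hL j hj]
  refine coeff_eq_of_rel (n := 12) (fun i => ?_) (fun i => ?_) (fun i => avg_eq_zero (trefl_tLam i))
    (fun i => ?_) coeff_zero_tU ?_ coeff_zero_tK ?_ coeff_zero_tLam ?_ ?_ ?_ ?_ j hj
  · rw [← coeff_coeffwise, θ_tK, map_zero]
  · rw [dataK, coeff_ev3_map_range]
    split
    · match i with
      | 0 => rw [KCoeff, e0, Derivation.map_one_eq_zero]
      | 1 => rw [KCoeff, e1, Derivation.map_smul, Derivation.map_one_eq_zero, smul_zero]
      | i + 2 => rw [ev2_KCoeff, map_neg, Derivation.map_smul, θ_ofPoly, smul_zero, neg_zero]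
    · rw [map_zero]
  · rw [dataLam, coeff_ev3_map_range]
    split
    · rw [ev2_ellCoeff le_rfl]
      exact avg_eq_zero (trefl_sinForm _ _)
    · rw [map_zero]
  · rw [hU 0 (by norm_num)]; exact e0
  · rw [hK 0 (by norm_num)]; exact e0
  · rw [hU 1 (by norm_num), coeff_one_tU]
  · rw [hK 1 (by norm_num), coeff_one_tK]; exact e1.symm
  · intro i hi
    rw [relU_eq_zero, ← ev3_listRelU, coeff_ev3_eq_zero listRelU_data hi, map_zero]
  · intro i hi
    rw [relLam_eq_zero, ← ev3_listRelLam, coeff_ev3_eq_zero listRelLam_data hi, map_zero]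

/-- With `U` and `K` known, the relation for `Γ` is affine in `θ Γ` with leading coefficient `1`.
Oddness fixes the remaining constant of integration. -/
theorem coeff_tGam_eq_data (j : ℕ) (hj : j < 10) :
    PowerSeries.coeff j tGam = ev2 (gCoeff j) := by
  have hG : ∀ i < 10, PowerSeries.coeff i (ev3 dataGam) = ev2 (gCoeff i) := fun i hi => by
    rw [dataGam, coeff_ev3_map_range, if_pos hi]
  have hU : ∀ i < 12, PowerSeries.coeff i (ev3 dataU) = PowerSeries.coeff i tU := fun i hi => by
    rw [dataU, coeff_ev3_map_range, if_pos hi, (coeff_eq_data i hi).1]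
  have hK : ∀ i < 12, PowerSeries.coeff i (ev3 dataK) = PowerSeries.coeff i tK := fun i hi => by
    rw [dataK, coeff_ev3_map_range, if_pos hi, (coeff_eq_data i hi).2.1]
  have hG0 : ∀ i < 10, avg (PowerSeries.coeff i (ev3 dataGam)) = 0 := fun i hi => by
    rw [hG i hi, ev2_gCoeff le_rfl, map_neg, avg_eq_zero (trefl_sinForm _ _), neg_zero]
  rw [← hG j hj]
  induction j using Nat.strong_induction_on with
  | _ j ih =>
    have au : Agree j tU (ev3 dataU) 0 :=
      ⟨fun i hi => (hU i (by omega)).symm, by rw [hU j (by omega), add_zero]⟩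
    have ak : Agree j tK (ev3 dataK) 0 :=
      ⟨fun i hi => (hK i (by omega)).symm, by rw [hK j (by omega), add_zero]⟩
    have ag := Agree.of_lt (f := tGam) (f' := ev3 dataGam) fun i hi => ih i hi (by omega)
    have hb : avg (PowerSeries.coeff j tGam - PowerSeries.coeff j (ev3 dataGam)) = 0 := by
      rw [map_sub, avg_eq_zero (trefl_tGam j), hG0 j hj, sub_zero]
    have h := ((au.add (ak.smul (-2))).add ((ak.add ak.euler).mul
      ((agree_one j).add (ag.theta.smul (-1))))).2
    rw [← relGam, ← relGam, relGam_eq_zero, ← ev3_listRelGam,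
      coeff_ev3_eq_zero listRelGam_data hj, map_zero, zero_add] at h
    simp only [map_add, coeff_zero_euler, hK 0 (by norm_num), coeff_zero_tK] at h
    rw [← sub_eq_zero]
    refine eq_zero_of_avg hb (neg_eq_zero.1 ?_)
    simpa using h.symm

end RigidBody
end

/-! ### The triaxiality polynomials -/

noncomputable section

namespace RigidBody

open LieSeries

/-- Tabulated orders take their polynomials from the tables, so that the explicit values hold by
definition; at higher orders only the existence of the form is used. -/
theorem exists_triaxiality_polynomials :
    ∃ (q : ℕ → Polynomial ℚ) (g l P : ℕ → ℕ → Polynomial ℚ),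
      (∀ i, 1 ≤ i → i ≤ 10 → q i = ofCoeffs (qTable i)) ∧
      (∀ i m, 1 ≤ i → i ≤ 9 → g i m = ofCoeffs ((gTable i).getD (m - 1) [])) ∧
      (∀ i m, 1 ≤ i → i ≤ 9 → l i m = ofCoeffs ((ellTable i).getD (m - 1) [])) ∧
      (∀ i m, 1 ≤ i → i ≤ 9 → P i m = ofCoeffs ((LTable i).getD m [])) ∧
      (∀ i, PowerSeries.coeff (i + 2) tK = -((1 / 2 : ℚ) • ofPoly (X * q (i + 1)))) ∧
      (∀ i, PowerSeries.coeff i tGam = -sinForm ((i + 1) / 2) (g i)) ∧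
      (∀ i, PowerSeries.coeff i tLam = sinForm i (l i)) ∧
      ∀ i, 1 ≤ i → PowerSeries.coeff i tU =
        ofPoly (X * P i 0) - (1 / 2 : ℚ) • cosForm ((i + 1) / 2) (P i) := by
  have hq : ∀ i, ∃ q : ℚ[X], (1 ≤ i → i ≤ 10 → q = ofCoeffs (qTable i)) ∧
      (1 ≤ i → PowerSeries.coeff (i + 1) tK = -((1 / 2 : ℚ) • ofPoly (X * q))) := by
    intro i
    cases i with
    | zero => exact ⟨0, by omega, by omega⟩
    | succ i =>
      by_cases hi : i + 1 ≤ 10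
      · exact ⟨_, fun _ _ => rfl, fun _ => by
          rw [(coeff_eq_data (i + 2) (by omega)).2.1, ev2_KCoeff]⟩
      · obtain ⟨q, hq⟩ := exists_tK i
        exact ⟨q, fun _ h => absurd h hi, fun _ => hq⟩
  have hg : ∀ i, ∃ g : ℕ → ℚ[X], (1 ≤ i → i ≤ 9 → ∀ m, g m = ofCoeffs ((gTable i).getD (m - 1) []))
      ∧ PowerSeries.coeff i tGam = -sinForm ((i + 1) / 2) g := by
    intro i
    by_cases hi : i < 10
    · exact ⟨_, fun _ _ _ => rfl, by
        rw [coeff_tGam_eq_data i hi, ev2_gCoeff (length_gTable i hi)]⟩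
    · obtain ⟨g, hg⟩ := exists_tGam i
      exact ⟨g, fun _ h => by omega, hg⟩
  have hl : ∀ i, ∃ l : ℕ → ℚ[X], (1 ≤ i → i ≤ 9 → ∀ m,
      l m = ofCoeffs ((ellTable i).getD (m - 1) [])) ∧
      PowerSeries.coeff i tLam = sinForm i l := by
    intro i
    by_cases hi : i < 10
    · have e : ellRows i = ellTable i := by interval_cases i <;> rfl
      refine ⟨_, fun _ _ _ => rfl, ?_⟩
      rw [(coeff_eq_data i (by omega)).2.2, ev2_ellCoeff (length_ellRows i (by omega)), e]
    · obtain ⟨l, hl⟩ := exists_tLam i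
      exact ⟨l, fun _ h => by omega, hl⟩
  have hP : ∀ i, ∃ P : ℕ → ℚ[X], (1 ≤ i → i ≤ 9 → ∀ m,
      P m = ofCoeffs ((LTable i).getD m [])) ∧
      (1 ≤ i → PowerSeries.coeff i tU =
        ofPoly (X * P 0) - (1 / 2 : ℚ) • cosForm ((i + 1) / 2) P) := by
    intro i
    by_cases hi : i < 10
    · have e : LRows i = LTable i := by interval_cases i <;> rfl
      refine ⟨fun m => ofCoeffs ((LTable i).getD m []), fun _ _ _ => rfl, fun h1 => ?_⟩
      rw [(coeff_eq_data i (by omega)).1, ev2_LCoeff (by omega) (length_LRows i (by omega)), e]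
    · obtain ⟨i, rfl⟩ := Nat.exists_eq_add_of_le' (show 1 ≤ i by omega)
      obtain ⟨P, hP⟩ := exists_tU i
      exact ⟨P, fun _ h => by omega, fun _ => hP⟩
  choose q hq using hq
  choose g hg using hg
  choose l hl using hl
  choose P hP using hP
  exact ⟨q, g, l, P, fun i h1 h2 => (hq i).1 h1 h2, fun i m h1 h2 => (hg i).1 h1 h2 m,
    fun i m h1 h2 => (hl i).1 h1 h2 m, fun i m h1 h2 => (hP i).1 h1 h2 m,
    fun i => (hq (i + 1)).2 (by omega), fun i => (hg i).2, fun i => (hl i).2,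
    fun i h1 => (hP i).2 h1⟩

end RigidBody
end

noncomputable section

namespace RigidBody

open LieSeries

/-! ### Evaluation on phase space -/

section EvalWith

variable {Γ : Type*}

/-- The evaluation that sends the monomial with exponents `g` to `m g`. -/
def evalWith (m : Γ → ℂ) : AddMonoidAlgebra ℚ Γ →ₗ[ℚ] ℂ :=
  Finsupp.linearCombination ℚ m ∘ₗ (AddMonoidAlgebra.coeffLinearEquiv ℚ).toLinearMap

theorem evalWith_single (m : Γ → ℂ) (g : Γ) (r : ℚ) :
    evalWith m (AddMonoidAlgebra.single g r) = r • m g :=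
  Finsupp.linearCombination_single ℚ r g

theorem evalWith_mul [AddCommMonoid Γ] {m : Γ → ℂ} (hm : ∀ g g', m (g + g') = m g * m g')
    (f h : AddMonoidAlgebra ℚ Γ) : evalWith m (f * h) = evalWith m f * evalWith m h := by
  induction f using AddMonoidAlgebra.induction_linear with
  | zero => simp
  | add f₁ f₂ h₁ h₂ => simp only [add_mul, map_add, h₁, h₂]
  | single g r =>
    induction h using AddMonoidAlgebra.induction_linear with
    | zero => simp
    | add f₁ f₂ h₁ h₂ => simp only [mul_add, map_add, h₁, h₂]
    | single g' r' =>
      rw [AddMonoidAlgebra.single_mul_single, evalWith_single, evalWith_single, evalWith_single, hm,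
        smul_mul_smul_comm]

end EvalWith

def trigVal (β ℓ : ℝ) (g : ℕ × ℕ) : ℂ :=
  (-β : ℂ) ^ (g.1 + g.2) * Complex.exp (2 * Complex.I * ((g.1 : ℂ) - g.2) * ℓ)

def phaseVal (β : ℝ) (x : Phase) (g : Expo) : ℂ :=
  (x.momL : ℂ) ^ g.1 * (x.momG : ℂ) ^ g.2.1 * trigVal β x.ell g.2.2

def evTrig (β ℓ : ℝ) : TrigAlg →ₗ[ℚ] ℂ := evalWith (trigVal β ℓ)

def ev (β : ℝ) (x : Phase) : PhaseAlg →ₗ[ℚ] ℂ := evalWith (phaseVal β x)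

theorem trigVal_add (β ℓ : ℝ) (g g' : ℕ × ℕ) :
    trigVal β ℓ (g + g') = trigVal β ℓ g * trigVal β ℓ g' := by
  simp only [trigVal, Prod.fst_add, Prod.snd_add, Nat.cast_add]
  rw [show 2 * Complex.I * (((g.1 : ℂ) + g'.1) - (g.2 + g'.2)) * ℓ =
    2 * Complex.I * ((g.1 : ℂ) - g.2) * ℓ + 2 * Complex.I * ((g'.1 : ℂ) - g'.2) * ℓ by ring,
    Complex.exp_add]
  ring

variable {β : ℝ} {x : Phase}

theorem momL_ne (hx : x ∈ domain) : (x.momL : ℂ) ≠ 0 := Complex.ofReal_ne_zero.2 hx.1.ne'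

theorem momG_ne (hx : x ∈ domain) : (x.momG : ℂ) ≠ 0 := Complex.ofReal_ne_zero.2 hx.2.ne'

theorem phaseVal_add (hx : x ∈ domain) (g g' : Expo) :
    phaseVal β x (g + g') = phaseVal β x g * phaseVal β x g' := by
  simp only [phaseVal, Prod.fst_add, Prod.snd_add, trigVal_add, zpow_add₀ (momL_ne hx),
    zpow_add₀ (momG_ne hx)]
  ring

theorem ev_mul (hx : x ∈ domain) (f h : PhaseAlg) : ev β x (f * h) = ev β x f * ev β x h :=
  evalWith_mul (phaseVal_add hx) f h

theorem evTrig_mul (ℓ : ℝ) (f h : TrigAlg) :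
    evTrig β ℓ (f * h) = evTrig β ℓ f * evTrig β ℓ h := evalWith_mul (trigVal_add β ℓ) f h

theorem ev_single (g : Expo) (r : ℚ) :
    ev β x (AddMonoidAlgebra.single g r) = r • phaseVal β x g := evalWith_single _ _ _

theorem conj_trigVal (ℓ : ℝ) (g : ℕ × ℕ) :
    (starRingEnd ℂ) (trigVal β ℓ g) = trigVal β ℓ (g.2, g.1) := by
  simp only [trigVal, map_mul, map_pow, map_neg, Complex.conj_ofReal, ← Complex.exp_conj, map_sub,
    Complex.conj_I, map_natCast, map_ofNat]
  rw [add_comm g.2]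
  congr 2
  ring

/-- All coefficients are rational and `z`, `z̄` are evaluated at conjugate numbers, so complex
conjugation is the reflection. -/
theorem conj_ev (f : PhaseAlg) : (starRingEnd ℂ) (ev β x f) = ev β x (refl f) := by
  induction f using AddMonoidAlgebra.induction_linear with
  | zero => simp
  | add f₁ f₂ h₁ h₂ => simp only [map_add, h₁, h₂]
  | single g r =>
    rw [refl_single, ev_single, ev_single, phaseVal, phaseVal, Rat.smul_def, Rat.smul_def]
    simp only [map_mul, map_zpow₀, Complex.conj_ofReal, conj_trigVal, map_ratCast]

/-- Homogeneity recovers the dependence on `L` and `G` that setting `L = G = 1` has forgotten. -/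
theorem evTrig_toTrig {d k : ℤ} {f : PhaseAlg} (hf : IsHomog d k f) :
    ev β x f = (x.momL : ℂ) ^ d * (x.momG : ℂ) ^ k * evTrig β x.ell (toTrig f) := by
  have key : ∀ f : PhaseAlg, (∀ g ∈ f.coeff.support, g.1 = d ∧ g.2.1 = k) →
      ev β x f = (x.momL : ℂ) ^ d * (x.momG : ℂ) ^ k * evTrig β x.ell (toTrig f) := by
    intro f hf
    have hs : f = ∑ g ∈ f.coeff.support, AddMonoidAlgebra.single g (f.coeff g) := by
      ext g
      rw [AddMonoidAlgebra.coeff_sum, Finsupp.finsetSum_apply]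
      simp only [AddMonoidAlgebra.coeff_single, Finsupp.single_apply, Finset.sum_ite_eq',
        Finsupp.mem_support_iff]
      split <;> simp_all
    rw [hs, map_sum, map_sum, map_sum, Finset.mul_sum]
    refine Finset.sum_congr rfl fun g hg => ?_
    obtain ⟨h1, h2⟩ := hf g hg
    rw [ev_single, toTrig_single, evTrig, evalWith_single, phaseVal, h1, h2, mul_smul_comm]
  refine key f fun g hg => ?_
  by_contra h
  refine Finsupp.mem_support_iff.1 hg (hf.coeff_eq_zero ?_)
  rcases not_and_or.1 h with h | h
  · left; exact_mod_cast h
  · right; exact_mod_cast h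

/-! ### Derivatives -/

theorem hasDerivAt_ev_ell (f : PhaseAlg) (x : Phase) :
    HasDerivAt (fun t : ℝ => ev β (t, x.ang, x.momL, x.momG) f)
      (2 * Complex.I * ev β x (dTheta f)) x.ell := by
  induction f using AddMonoidAlgebra.induction_linear with
  | zero => simpa using hasDerivAt_const _ _
  | add f₁ f₂ h₁ h₂ => simpa only [map_add, mul_add] using h₁.fun_add h₂
  | single g r =>
    rw [dTheta, degreeDerivation_apply, diag_single]
    simp only [ev_single, Rat.smul_def]
    have h1 : HasDerivAt (fun t : ℝ => 2 * Complex.I * ((g.2.2.1 : ℂ) - g.2.2.2) * (t : ℂ))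
        (2 * Complex.I * ((g.2.2.1 : ℂ) - g.2.2.2) * 1) x.ell :=
      Complex.ofRealCLM.hasDerivAt.const_mul _
    have h2 := ((h1.cexp.const_mul ((-β : ℂ) ^ (g.2.2.1 + g.2.2.2))).const_mul
      ((x.momL : ℂ) ^ g.1 * (x.momG : ℂ) ^ g.2.1)).const_mul (r : ℂ)
    refine h2.congr_deriv ?_
    simp only [phaseVal, trigVal, AddMonoidHom.comp_apply, trigExpo_apply, harm_apply]
    push_cast
    ring

theorem hasDerivAt_ev_momL (f : PhaseAlg) {x : Phase} (hx : x ∈ domain) :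
    HasDerivAt (fun t : ℝ => ev β (x.ell, x.ang, t, x.momG) f) (ev β x (dL f)) x.momL := by
  induction f using AddMonoidAlgebra.induction_linear with
  | zero => simpa using hasDerivAt_const _ _
  | add f₁ f₂ h₁ h₂ => simpa only [map_add] using h₁.fun_add h₂
  | single g r =>
    rw [dL_apply, ev_mul hx, degL, degreeDerivation_apply, diag_single, mono]
    simp only [ev_single, Rat.smul_def]
    have h1 : HasDerivAt (fun t : ℝ => (t : ℂ) ^ g.1) (g.1 * (x.momL : ℂ) ^ (g.1 - 1)) x.momL :=
      (hasDerivAt_zpow g.1 (x.momL : ℂ) (Or.inl (momL_ne hx))).comp_ofReal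
    have h2 := ((h1.mul_const ((x.momG : ℂ) ^ g.2.1)).mul_const
      (trigVal β x.ell g.2.2)).const_mul (r : ℂ)
    refine h2.congr_deriv ?_
    simp only [phaseVal, expL_apply, zpow_sub_one₀ (momL_ne hx)]
    simp [trigVal]
    ring

theorem hasDerivAt_ev_momG (f : PhaseAlg) {x : Phase} (hx : x ∈ domain) :
    HasDerivAt (fun t : ℝ => ev β (x.ell, x.ang, x.momL, t) f) (ev β x (dG f)) x.momG := by
  induction f using AddMonoidAlgebra.induction_linear with
  | zero => simpa using hasDerivAt_const _ _
  | add f₁ f₂ h₁ h₂ => simpa only [map_add] using h₁.fun_add h₂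
  | single g r =>
    rw [dG_apply, ev_mul hx, degG, degreeDerivation_apply, diag_single, mono]
    simp only [ev_single, Rat.smul_def]
    have h1 : HasDerivAt (fun t : ℝ => (t : ℂ) ^ g.2.1) (g.2.1 * (x.momG : ℂ) ^ (g.2.1 - 1))
        x.momG := (hasDerivAt_zpow g.2.1 (x.momG : ℂ) (Or.inl (momG_ne hx))).comp_ofReal
    have h2 := ((h1.const_mul ((x.momL : ℂ) ^ g.1)).mul_const
      (trigVal β x.ell g.2.2)).const_mul (r : ℂ)
    refine h2.congr_deriv ?_
    simp only [phaseVal, expG_apply, zpow_sub_one₀ (momG_ne hx)]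
    simp [trigVal]
    ring

theorem contDiffOn_ev (f : PhaseAlg) : ContDiffOn ℝ ∞ (fun x => ev β x f) domain := by
  induction f using AddMonoidAlgebra.induction_linear with
  | zero => simpa using contDiffOn_const
  | add f₁ f₂ h₁ h₂ => simpa only [map_add] using h₁.add h₂
  | single g r =>
    simp only [ev_single, Rat.smul_def, phaseVal, trigVal]
    have hz : ∀ (n : ℤ) (u : Phase → ℝ), ContDiff ℝ ∞ u → (∀ x ∈ domain, u x ≠ 0) →
        ContDiffOn ℝ ∞ (fun x => (u x : ℂ) ^ n) domain := by
      intro n u hu h0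
      have h1 : ContDiff ℝ ∞ fun x => (u x : ℂ) := Complex.ofRealCLM.contDiff.comp hu
      cases n with
      | ofNat n => simpa using (h1.pow n).contDiffOn
      | negSucc n =>
        simp only [zpow_negSucc]
        exact (h1.pow (n + 1)).contDiffOn.inv fun x hx =>
          pow_ne_zero _ (Complex.ofReal_ne_zero.2 (h0 x hx))
    have h1 : ContDiff ℝ ∞ fun x : Phase => (x.ell : ℂ) :=
      Complex.ofRealCLM.contDiff.comp contDiff_fst
    have hE : ContDiff ℝ ∞ fun x : Phase =>
        Complex.exp (2 * Complex.I * ((g.2.2.1 : ℂ) - g.2.2.2) * (x.ell : ℂ)) :=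
      (contDiff_const.mul h1).cexp
    exact contDiffOn_const.mul (((hz _ (fun x => x.momL) (by fun_prop) fun x hx => hx.1.ne').mul
      (hz _ (fun x => x.momG) (by fun_prop) fun x hx => hx.2.ne')).mul
        (contDiffOn_const.mul hE.contDiffOn))

end RigidBody
end

noncomputable section

namespace RigidBody

open LieSeries

/-! ### Deprit's triangle of the explicit generator -/

variable {β : ℝ} {x : Phase}

/-- The factor `1 / √(1 - β ^ 2)`. -/
def sigma (β : ℝ) : ℂ := ((√(1 - β ^ 2) : ℝ) : ℂ)⁻¹

/-- The generator of the normalization. -/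
def genW (β : ℝ) (j : ℕ) (x : Phase) : ℝ :=
  ((j.factorial : ℂ) * sigma β ^ (j + 1) / (2 * Complex.I) * ev β x (PowerSeries.coeff j gen)).re

theorem refl_coeff_gen (j : ℕ) :
    refl (PowerSeries.coeff j gen) = -PowerSeries.coeff j gen := by
  have h := congrArg (PowerSeries.coeff j) refl_gen
  rw [PowerSeries.coeff_map, map_neg] at h
  exact h

theorem conj_sigma : (starRingEnd ℂ) (sigma β) = sigma β := by
  rw [sigma, map_inv₀, Complex.conj_ofReal]

/-- The formal generator is odd under reflection, so its values are purely imaginary; division by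
`2i` makes them real, and taking the real part loses nothing. -/
theorem coe_genW (j : ℕ) (x : Phase) : (genW β j x : ℂ) =
    (j.factorial : ℂ) * sigma β ^ (j + 1) / (2 * Complex.I) * ev β x (PowerSeries.coeff j gen) := by
  rw [genW, Complex.conj_eq_iff_re.1]
  rw [map_mul, conj_ev, refl_coeff_gen, map_neg, map_div₀, map_mul, map_pow, conj_sigma, map_mul,
    Complex.conj_I, map_natCast, map_ofNat]
  ring

/-- On the domain `f` is `c` times the value of `φ`, up to a function of `G`. -/
def IsEval (β : ℝ) (k : ℝ → ℝ) (f : Phase → ℝ) (c : ℂ) (φ : PhaseAlg) : Prop :=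
  ∀ x ∈ domain, (f x : ℂ) = k x.momG + c * ev β x φ

/-- Bridge between the real `deriv` in the partial derivatives and computations in `ℂ`: the real
part gives differentiability, and uniqueness of derivatives identifies the value. -/
theorem ofReal_deriv_eq {u : ℝ → ℝ} {F : ℝ → ℂ} {t : ℝ} {F' : ℂ} (hF : HasDerivAt F F' t)
    (h : ∀ᶠ r in 𝓝 t, (u r : ℂ) = F r) : ((deriv u t : ℝ) : ℂ) = F' := by
  have h1 : HasDerivAt (fun r => (u r : ℂ)) F' t := hF.congr_of_eventuallyEq h
  have h2 : HasDerivAt u F'.re t := by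
    have := (Complex.reCLM.hasFDerivAt (x := (u t : ℂ))).comp_hasDerivAt t h1
    simpa [Function.comp_def] using this
  rw [h2.deriv]
  exact (h2.ofReal_comp).unique h1

theorem eventually_pos {a : ℝ} (h : 0 < a) : ∀ᶠ t in 𝓝 a, 0 < t := lt_mem_nhds h

namespace IsEval

variable {k : ℝ → ℝ} {f : Phase → ℝ} {c : ℂ} {φ : PhaseAlg}

theorem partialEll (h : IsEval β k f c φ) (hx : x ∈ domain) :
    (partialEll f x : ℂ) = c * (2 * Complex.I * ev β x (dTheta φ)) :=
  ofReal_deriv_eq (((hasDerivAt_ev_ell φ x).const_mul c).const_add (k x.momG : ℂ))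
    (Eventually.of_forall fun t => h (t, x.ang, x.momL, x.momG) hx)

theorem partialL (h : IsEval β k f c φ) (hx : x ∈ domain) :
    (partialL f x : ℂ) = c * ev β x (dL φ) :=
  ofReal_deriv_eq (((hasDerivAt_ev_momL φ hx).const_mul c).const_add (k x.momG : ℂ))
    ((eventually_pos hx.1).mono fun t ht => h (x.ell, x.ang, t, x.momG) ⟨ht, hx.2⟩)

theorem partialG (h : IsEval β 0 f c φ) (hx : x ∈ domain) :
    (partialG f x : ℂ) = c * ev β x (dG φ) := by
  refine ofReal_deriv_eq ((hasDerivAt_ev_momG φ hx).const_mul c)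
    ((eventually_pos hx.2).mono fun t ht => ?_)
  rw [h (x.ell, x.ang, x.momL, t) ⟨hx.1, ht⟩, Pi.zero_apply, Complex.ofReal_zero, zero_add]

theorem partialAng (h : IsEval β k f c φ) (hx : x ∈ domain) : partialAng f x = 0 := by
  have h1 : ∀ t, f (x.ell, t, x.momL, x.momG) = f x := fun t => by
    have e1 := h (x.ell, t, x.momL, x.momG) hx
    have e2 := h x hx
    exact Complex.ofReal_injective (e1.trans e2.symm)
  rw [RigidBody.partialAng]
  simp only [h1, deriv_const]

end IsEval

theorem isEval_genW (j : ℕ) : IsEval β 0 (genW β j)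
    ((j.factorial : ℂ) * sigma β ^ (j + 1) / (2 * Complex.I)) (PowerSeries.coeff j gen) :=
  fun x _ => by rw [coe_genW, Pi.zero_apply, Complex.ofReal_zero, zero_add]

/-- The factor `2i` from `∂/∂ℓ = 2i θ` cancels the `1/(2i)` in the generator, so the real bracket
becomes the rational formal one. -/
theorem poisson_genW {k : ℝ → ℝ} {f : Phase → ℝ} {c : ℂ} {φ : PhaseAlg} (h : IsEval β k f c φ)
    (j : ℕ) (hx : x ∈ domain) : (poisson f (genW β j) x : ℂ) =
      c * (j.factorial * sigma β ^ (j + 1)) * ev β x (dTheta φ * dL (PowerSeries.coeff j gen) -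
        dL φ * dTheta (PowerSeries.coeff j gen)) := by
  have hW := isEval_genW (β := β) j
  rw [poisson, h.partialAng hx, hW.partialAng hx]
  push_cast
  rw [h.partialEll hx, h.partialL hx, hW.partialEll hx, hW.partialL hx, map_sub, ev_mul hx,
    ev_mul hx]
  have hI := Complex.I_ne_zero
  field_simp
  ring

theorem coeff_bracket (f h : PowerSeries PhaseAlg) (n : ℕ) :
    PowerSeries.coeff n (bracket dTheta dL f h) = ∑ j ∈ Finset.range (n + 1),
      (dTheta (PowerSeries.coeff (n - j) f) * dL (PowerSeries.coeff j h) -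
        dL (PowerSeries.coeff (n - j) f) * dTheta (PowerSeries.coeff j h)) := by
  rw [bracket, map_sub, PowerSeries.coeff_mul, PowerSeries.coeff_mul, ← Finset.sum_sub_distrib,
    Finset.Nat.sum_antidiagonal_eq_sum_range_succ fun i j =>
      PowerSeries.coeff i (coeffwise dTheta f) * PowerSeries.coeff j (coeffwise dL h) -
        PowerSeries.coeff i (coeffwise dL f) * PowerSeries.coeff j (coeffwise dTheta h),
    ← Finset.sum_flip]
  refine Finset.sum_congr rfl fun j hj => ?_
  rw [Nat.sub_sub_self (Nat.lt_succ_iff.1 (Finset.mem_range.1 hj))]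
  simp only [coeff_coeffwise]

theorem coeff_lieDeriv_gen (Φ : PowerSeries PhaseAlg) (n : ℕ) :
    PowerSeries.coeff n (lieDeriv dTheta dL gen Φ) =
      (n + 1 : ℚ) • PowerSeries.coeff (n + 1) Φ + ∑ j ∈ Finset.range (n + 1),
        (dTheta (PowerSeries.coeff (n - j) Φ) * dL (PowerSeries.coeff j gen) -
          dL (PowerSeries.coeff (n - j) Φ) * dTheta (PowerSeries.coeff j gen)) := by
  rw [lieDeriv_apply, map_add, coeff_ddε, coeff_bracket, Algebra.smul_def, mul_comm, map_add,
    map_natCast, map_one]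

/-- One step of the triangle is one application of `lieDeriv`, the factorials matching the binomial
coefficients. A summand depending on `G` alone commutes with the generator, which is free of `g`,
and so it does not survive the step. -/
theorem depritTriangle_genW_succ {f : ℕ → Phase → ℝ} {p : ℕ} {c : ℂ} {Φ : PowerSeries PhaseAlg}
    {k : ℕ → ℝ → ℝ}
    (h : ∀ n, IsEval β (k n) (depritTriangle (genW β) f n p) (c * sigma β ^ n * n.factorial)
      (PowerSeries.coeff n Φ))
    (h' : ∀ n, IsEval β 0 (depritTriangle (genW β) f (n + 1) p)
      (c * sigma β ^ (n + 1) * (n + 1).factorial) (PowerSeries.coeff (n + 1) Φ)) (n : ℕ) :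
    IsEval β 0 (depritTriangle (genW β) f n (p + 1)) (c * sigma β * sigma β ^ n * n.factorial)
      (PowerSeries.coeff n (lieDeriv dTheta dL gen Φ)) := by
  intro x hx
  rw [depritTriangle, coeff_lieDeriv_gen, map_add, map_sum, map_smul]
  push_cast
  rw [h' n x hx, mul_add, Finset.mul_sum, Pi.zero_apply, Complex.ofReal_zero, zero_add, zero_add]
  congr 1
  · rw [Nat.factorial_succ, Rat.smul_def]
    push_cast
    ring
  · refine Finset.sum_congr rfl fun j hj => ?_
    have hj : j ≤ n := Nat.lt_succ_iff.1 (Finset.mem_range.1 hj)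
    rw [poisson_genW (h (n - j)) j hx]
    have hc : (n.choose j : ℂ) * j.factorial * (n - j).factorial = n.factorial := by
      exact_mod_cast Nat.choose_mul_factorial_mul_factorial hj
    rw [← hc, show sigma β ^ n = sigma β ^ (n - j) * sigma β ^ j by
      rw [← pow_add, Nat.sub_add_cancel hj]]
    ring

theorem depritTriangle_genW {f : ℕ → Phase → ℝ} {p : ℕ} {c : ℂ} {Φ : PowerSeries PhaseAlg}
    (h : ∀ n, IsEval β 0 (depritTriangle (genW β) f n p) (c * sigma β ^ n * n.factorial)
      (PowerSeries.coeff n Φ)) (r n : ℕ) :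
    IsEval β 0 (depritTriangle (genW β) f n (p + r)) (c * sigma β ^ r * sigma β ^ n * n.factorial)
      (PowerSeries.coeff n ((lieDeriv dTheta dL gen ^ r) Φ)) := by
  induction r generalizing n with
  | zero => simpa using h n
  | succ r ih =>
    have h2 := depritTriangle_genW_succ (k := fun _ => 0) ih (fun n => ih (n + 1)) n
    rw [pow_succ' (lieDeriv dTheta dL gen), Module.End.mul_apply, pow_succ, ← mul_assoc]
    exact h2

/-- The transform of a function whose Deprit triangle is given by `Φ`. -/
theorem depritTransform_genW {f : ℕ → Phase → ℝ} {c : ℂ} {Φ : PowerSeries PhaseAlg}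
    (h : ∀ n, IsEval β 0 (f n) (c * sigma β ^ n * n.factorial) (PowerSeries.coeff n Φ))
    (n : ℕ) (hx : x ∈ domain) : (depritTransform (genW β) f n x : ℂ) =
      c * sigma β ^ n * n.factorial * ev β x (PowerSeries.coeff n (lieT gen Φ)) := by
  have h1 := depritTriangle_genW (f := f) (p := 0) h n 0 x hx
  rw [zero_add] at h1
  rw [depritTransform, h1, coeff_transform, map_smul, Rat.smul_def, Pi.zero_apply,
    Complex.ofReal_zero]
  have : (n.factorial : ℂ) ≠ 0 := by exact_mod_cast n.factorial_ne_zero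
  push_cast
  field_simp
  simp

/-- The transform of a function whose first column is generated by `r W`. -/
theorem depritTransform_genW_correction {f : ℕ → Phase → ℝ} {r : Derivation ℚ PhaseAlg PhaseAlg}
    (h : ∀ n, IsEval β 0 (depritTriangle (genW β) f n 1)
      (sigma β / (2 * Complex.I) * sigma β ^ n * n.factorial)
      (PowerSeries.coeff n (coeffwise r gen)))
    (n : ℕ) (hx : x ∈ domain) : (depritTransform (genW β) f (n + 1) x : ℂ) =
      sigma β ^ (n + 1) * (n + 1).factorial / (2 * Complex.I) *
        ev β x (PowerSeries.coeff (n + 1) (correction dTheta dL r gen)) := by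
  have h1 := depritTriangle_genW h n 0 x hx
  rw [add_comm 1 n] at h1
  rw [depritTransform, h1, coeff_correction_succ, map_smul, Rat.smul_def, Pi.zero_apply,
    Complex.ofReal_zero]
  have : ((n + 1).factorial : ℂ) ≠ 0 := by exact_mod_cast (n + 1).factorial_ne_zero
  push_cast
  field_simp
  simp [pow_succ]
  ring

end RigidBody
end

noncomputable section

namespace RigidBody

open LieSeries

variable {β : ℝ} {x : Phase}

/-! ### Values of the triaxiality polynomials -/

theorem evTrig_single (ℓ : ℝ) (g : ℕ × ℕ) (r : ℚ) :
    evTrig β ℓ (AddMonoidAlgebra.single g r) = r • trigVal β ℓ g := evalWith_single _ _ _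

theorem evTrig_ofPoly (ℓ : ℝ) (p : ℚ[X]) : evTrig β ℓ (ofPoly p) = (triax p β : ℂ) := by
  induction p using Polynomial.induction_on' with
  | add p q hp hq => rw [map_add, map_add, hp, hq, triax, triax, triax, map_add]; push_cast; rfl
  | monomial n r =>
    rw [ofPoly_monomial, evTrig_single, triax, aeval_monomial, trigVal, Rat.smul_def]
    simp only [sub_self, mul_zero, zero_mul, Complex.exp_zero, mul_one]
    rw [← two_mul, pow_mul, neg_sq]
    push_cast
    rfl

theorem evTrig_zz_pow (ℓ : ℝ) (m : ℕ) : evTrig β ℓ (zz ^ m) =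
    (-β : ℂ) ^ m * Complex.exp (2 * m * ℓ * Complex.I) := by
  rw [zz_pow, evTrig_single, one_smul, trigVal]
  simp only [add_zero, Nat.cast_zero, sub_zero]
  congr 2; ring

theorem evTrig_zzb_pow (ℓ : ℝ) (m : ℕ) : evTrig β ℓ (zzb ^ m) =
    (-β : ℂ) ^ m * Complex.exp (-(2 * m * ℓ) * Complex.I) := by
  rw [zzb_pow, evTrig_single, one_smul, trigVal]
  simp only [zero_add, Nat.cast_zero, zero_sub]
  congr 2; ring

theorem evTrig_sinForm (ℓ : ℝ) (d : ℕ) (p : ℕ → ℚ[X]) : evTrig β ℓ (sinForm d p) =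
    2 * Complex.I * ((∑ m ∈ Finset.Icc 1 d, (-β) ^ m * triax (p m) β * Real.sin (2 * m * ℓ) : ℝ)
      : ℂ) := by
  rw [sinForm, map_sum]
  push_cast
  rw [Finset.mul_sum]
  refine Finset.sum_congr rfl fun m _ => ?_
  rw [evTrig_mul, map_sub, evTrig_zz_pow, evTrig_zzb_pow, evTrig_ofPoly]
  linear_combination (-β : ℂ) ^ m * triax (p m) β * (-Complex.two_sin (2 * m * ℓ)) * Complex.I
    - (-β : ℂ) ^ m * triax (p m) β * (Complex.exp (-(2 * m * ℓ) * Complex.I) -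
      Complex.exp (2 * m * ℓ * Complex.I)) * (Complex.I_mul_I)

theorem evTrig_cosForm (ℓ : ℝ) (d : ℕ) (p : ℕ → ℚ[X]) : evTrig β ℓ (cosForm d p) =
    2 * ((∑ m ∈ Finset.Icc 1 d, (-β) ^ m * triax (p m) β * Real.cos (2 * m * ℓ) : ℝ) : ℂ) := by
  rw [cosForm, map_sum]
  push_cast
  rw [Finset.mul_sum]
  refine Finset.sum_congr rfl fun m _ => ?_
  rw [evTrig_mul, map_add, evTrig_zz_pow, evTrig_zzb_pow, evTrig_ofPoly]
  linear_combination -(-β : ℂ) ^ m * triax (p m) β * Complex.two_cos (2 * m * ℓ)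

theorem triax_X_mul (p : ℚ[X]) : triax (X * p) β = β ^ 2 * triax p β := by
  rw [triax, triax, map_mul, aeval_X]

/-- Homogeneity supplies the powers of `L / G` and the rescaling of `ε` supplies the powers of `σ`;
together they are the powers of `δ'`. -/
theorem sigma_mul_pow (hx : x ∈ domain) (n : ℕ) :
    (x.momL : ℂ) ^ n * (x.momG : ℂ) ^ (-(n : ℤ)) * sigma β ^ n = ((deltaPrime β x ^ n : ℝ) : ℂ) := by
  rw [deltaPrime, zpow_neg, zpow_natCast, sigma]
  push_cast
  have := momG_ne hx
  rw [mul_pow, div_pow, one_div, ← div_eq_mul_inv]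

/-! ### First columns -/

theorem poisson_zero_left (h : Phase → ℝ) (x : Phase) : poisson (fun _ => 0) h x = 0 := by
  simp [poisson, partialEll, partialL, partialAng, partialG]

/-- The angles `ℓ` and `g` are not elements of the algebra, so their triangles can be compared with
formal series only from the first column on. There only the summand with the highest term of the
generator is left. -/
theorem depritTriangle_constTerm_one (W : ℕ → Phase → ℝ) (u : Phase → ℝ) (n : ℕ) (x : Phase) :
    depritTriangle W (constTerm u) n 1 x = poisson u (W n) x := by
  have h0 : ∀ m, m ≠ 0 → constTerm u m = fun _ => 0 := fun m hm => by
    cases m with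
    | zero => exact absurd rfl hm
    | succ m => rfl
  change depritTriangle W (constTerm u) (n + 1) 0 x + ∑ j ∈ Finset.range (n + 1), _ = _
  rw [Finset.sum_range_succ, Finset.sum_eq_zero]
  · simp only [depritTriangle, Nat.sub_self, Nat.choose_self, Nat.cast_one, one_mul, zero_add]
    rw [h0 (n + 1) (by omega), zero_add]
    rfl
  · intro j hj
    have := Finset.mem_range.1 hj
    simp only [depritTriangle]
    rw [h0 (n - j) (by omega), poisson_zero_left, mul_zero]

theorem poisson_ell (h : Phase → ℝ) (x : Phase) : poisson Phase.ell h x = partialL h x := by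
  have h1 : partialEll Phase.ell x = 1 := deriv_id _
  have h2 : partialL Phase.ell x = 0 := deriv_const _ _
  have h3 : partialAng Phase.ell x = 0 := deriv_const _ _
  have h4 : partialG Phase.ell x = 0 := deriv_const _ _
  rw [poisson, h1, h2, h3, h4]
  ring

theorem poisson_ang (h : Phase → ℝ) (x : Phase) : poisson Phase.ang h x = partialG h x := by
  have h1 : partialEll Phase.ang x = 0 := deriv_const _ _
  have h2 : partialL Phase.ang x = 0 := deriv_const _ _
  have h3 : partialAng Phase.ang x = 1 := deriv_id _
  have h4 : partialG Phase.ang x = 0 := deriv_const _ _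
  rw [poisson, h1, h2, h3, h4]
  ring

theorem isEval_constTerm {u : Phase → ℝ} {φ : PhaseAlg}
    (h : ∀ x ∈ domain, (u x : ℂ) = ev β x φ) (n : ℕ) :
    IsEval β 0 (constTerm u n) (1 * sigma β ^ n * n.factorial)
      (PowerSeries.coeff n (PowerSeries.C φ)) := by
  intro x hx
  cases n with
  | zero => simp [constTerm, h x hx]
  | succ n => simp [constTerm, PowerSeries.coeff_succ_C]

theorem ev_mono (d k : ℤ) (a c : ℕ) : ev β x (mono d k a c) =
    (x.momL : ℂ) ^ d * (x.momG : ℂ) ^ k * trigVal β x.ell (a, c) := by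
  rw [mono, ev_single, one_smul, phaseVal]

theorem trigVal_zero (ℓ : ℝ) : trigVal β ℓ (0, 0) = 1 := by simp [trigVal]

theorem depritTransform_zero (W f : ℕ → Phase → ℝ) (x : Phase) :
    depritTransform W f 0 x = f 0 x := rfl

theorem depritTransform_momG (n : ℕ) (hx : x ∈ domain) :
    depritTransform (genW β) (constTerm Phase.momG) (n + 1) x = 0 := by
  have h := depritTransform_genW (isEval_constTerm (β := β) (u := Phase.momG) (φ := mono 0 1 0 0)
    fun x _ => by rw [ev_mono, trigVal_zero]; simp) (n + 1) hx
  rw [show PowerSeries.C (mono 0 1 0 0) = serG from rfl, lieT_serG, serG,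
    PowerSeries.coeff_succ_C, map_zero, mul_zero] at h
  exact_mod_cast h

theorem depritTransform_momL {P : ℕ → ℚ[X]} {n : ℕ}
    (hP : PowerSeries.coeff n tU = ofPoly (X * P 0) - (1 / 2 : ℚ) • cosForm ((n + 1) / 2) P)
    (hx : x ∈ domain) :
    depritTransform (genW β) (constTerm Phase.momL) n x = n.factorial * (x.momL *
      (deltaPrime β x ^ n * (β ^ 2 * triax (P 0) β - ∑ m ∈ Finset.Icc 1 ((n + 1) / 2),
        (-β) ^ m * triax (P m) β * Real.cos (2 * m * x.ell)))) := by
  have h := depritTransform_genW (isEval_constTerm (β := β) (u := Phase.momL) (φ := mono 1 0 0 0)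
    fun x _ => by rw [ev_mono, trigVal_zero]; simp) n hx
  have hh : IsHomog ((n + 1 : ℤ) : ℚ) ((-n : ℤ) : ℚ) (PowerSeries.coeff n (lieT gen serL)) := by
    have h1 : HomogSeries ((1 : ℤ) : ℚ) ((0 : ℤ) : ℚ) serL := HomogSeries.C (IsHomog.mono 1 0 0 0)
    have h2 := HomogSeries.transform homog_gen h1 n
    have e1 : ((1 : ℤ) : ℚ) + n = ((n + 1 : ℤ) : ℚ) := by push_cast; ring
    have e2 : ((0 : ℤ) : ℚ) - n = ((-n : ℤ) : ℚ) := by push_cast; ring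
    rw [e1, e2] at h2
    exact h2
  rw [show PowerSeries.C (mono 1 0 0 0) = serL from rfl, evTrig_toTrig hh, ← coeff_proj,
    show proj (lieT gen serL) = tU from rfl, hP, map_sub, map_smul, evTrig_ofPoly, evTrig_cosForm,
    triax_X_mul, Rat.smul_def] at h
  have hs := sigma_mul_pow (β := β) hx n
  rw [zpow_add_one₀ (momL_ne hx), zpow_natCast] at h
  apply Complex.ofReal_injective
  rw [h]
  push_cast at hs ⊢
  rw [← hs]
  ring

theorem depritTransform_ell {l : ℕ → ℚ[X]} {n : ℕ}
    (hl : PowerSeries.coeff (n + 1) tLam = sinForm (n + 1) l) (hx : x ∈ domain) :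
    depritTransform (genW β) (constTerm Phase.ell) (n + 1) x = (n + 1).factorial *
      (deltaPrime β x ^ (n + 1) * ∑ m ∈ Finset.Icc 1 (n + 1),
        (-β) ^ m * triax (l m) β * Real.sin (2 * m * x.ell)) := by
  have h := depritTransform_genW_correction (β := β) (f := constTerm Phase.ell) (r := dL)
    (fun n x hx => by
      rw [depritTriangle_constTerm_one, poisson_ell, (isEval_genW n).partialL hx, coeff_coeffwise,
        Pi.zero_apply, Complex.ofReal_zero]
      ring) n hx
  have hh : IsHomog ((n + 1 : ℕ) : ℤ) ((-(n + 1 : ℕ) : ℤ) : ℚ)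
      (PowerSeries.coeff (n + 1) corrEll) := by
    have h2 := HomogSeries.correction (d := 0) (k := 0) homog_gen (r := dL)
      ((homog_gen.dL).congr (by norm_num) (by norm_num)) (n + 1)
    have e1 : (0 : ℚ) + ((n + 1 : ℕ) : ℚ) = (((n + 1 : ℕ) : ℤ) : ℚ) := by push_cast; ring
    have e2 : (0 : ℚ) - ((n + 1 : ℕ) : ℚ) = ((-(n + 1 : ℕ) : ℤ) : ℚ) := by push_cast; ring
    rw [e1, e2] at h2
    exact h2
  rw [show correction dTheta dL dL gen = corrEll from rfl, evTrig_toTrig hh, ← coeff_proj,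
    show proj corrEll = tLam from rfl, hl, evTrig_sinForm, zpow_natCast] at h
  have hs := sigma_mul_pow (β := β) hx (n + 1)
  apply Complex.ofReal_injective
  rw [h, Complex.ofReal_mul, Complex.ofReal_mul, ← hs]
  have hI := Complex.I_ne_zero
  simp only [Complex.ofReal_natCast]
  generalize (∑ m ∈ Finset.Icc 1 _, _ : ℝ) = S
  field_simp

theorem depritTransform_ang {g : ℕ → ℚ[X]} {n : ℕ}
    (hg : PowerSeries.coeff (n + 1) tGam = -sinForm ((n + 1 + 1) / 2) g) (hx : x ∈ domain) :
    depritTransform (genW β) (constTerm Phase.ang) (n + 1) x = -((n + 1).factorial *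
      (x.momL / x.momG * (deltaPrime β x ^ (n + 1) * ∑ m ∈ Finset.Icc 1 ((n + 1 + 1) / 2),
        (-β) ^ m * triax (g m) β * Real.sin (2 * m * x.ell)))) := by
  have h := depritTransform_genW_correction (β := β) (f := constTerm Phase.ang) (r := dG)
    (fun n x hx => by
      rw [depritTriangle_constTerm_one, poisson_ang, (isEval_genW n).partialG hx, coeff_coeffwise,
        Pi.zero_apply, Complex.ofReal_zero]
      ring) n hx
  have hh : IsHomog (((n + 1 : ℕ) + 1 : ℤ) : ℚ) ((-(n + 1 : ℕ) - 1 : ℤ) : ℚ)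
      (PowerSeries.coeff (n + 1) corrAng) := by
    have h2 := HomogSeries.correction (d := 1) (k := -1) homog_gen (r := dG)
      ((homog_gen.dG).congr (by norm_num) (by norm_num)) (n + 1)
    have e1 : (1 : ℚ) + ((n + 1 : ℕ) : ℚ) = (((n + 1 : ℕ) + 1 : ℤ) : ℚ) := by push_cast; ring
    have e2 : (-1 : ℚ) - ((n + 1 : ℕ) : ℚ) = ((-(n + 1 : ℕ) - 1 : ℤ) : ℚ) := by push_cast; ring
    rw [e1, e2] at h2
    exact h2
  rw [show correction dTheta dL dG gen = corrAng from rfl, evTrig_toTrig hh, ← coeff_proj,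
    show proj corrAng = tGam from rfl, hg, map_neg, evTrig_sinForm, zpow_add_one₀ (momL_ne hx),
    zpow_natCast, zpow_sub_one₀ (momG_ne hx)] at h
  have hs := sigma_mul_pow (β := β) hx (n + 1)
  apply Complex.ofReal_injective
  rw [h, Complex.ofReal_neg, Complex.ofReal_mul, Complex.ofReal_mul, Complex.ofReal_mul,
    Complex.ofReal_div, ← hs]
  have hI := Complex.I_ne_zero
  simp only [Complex.ofReal_natCast]
  generalize (∑ m ∈ Finset.Icc 1 _, _ : ℝ) = S
  field_simp

end RigidBody
end

noncomputable section

namespace RigidBody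

open LieSeries

variable {β : ℝ} {x : Phase}

/-! ### The transformed Hamiltonian -/

theorem serK_eq : serK = PowerSeries.C (mono 1 1 0 0) + PowerSeries.X * PowerSeries.C
    (-(1 / 2 : ℚ) • mono 2 0 0 0 + (1 / 4 : ℚ) • (mono 2 0 1 0 + mono 2 0 0 1)) := by
  have h : ∀ (r : ℚ) (a : PhaseAlg), PowerSeries.C (r • a) = r • PowerSeries.C a := fun r a => by
    ext1 n
    rw [LinearMap.map_smul_of_tower, PowerSeries.coeff_C, PowerSeries.coeff_C]
    split <;> simp
  rw [serK, serL, serG, serZ, serZbar]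
  have e1 : mono 2 0 0 0 = mono 1 0 0 0 * mono 1 0 0 0 := by rw [mono_mul_mono]; rfl
  have e2 : mono 2 0 1 0 = mono 1 0 0 0 * mono 1 0 0 0 * mono 0 0 1 0 := by
    rw [mono_mul_mono, mono_mul_mono]; rfl
  have e3 : mono 2 0 0 1 = mono 1 0 0 0 * mono 1 0 0 0 * mono 0 0 0 1 := by
    rw [mono_mul_mono, mono_mul_mono]; rfl
  have e4 : mono 1 1 0 0 = mono 1 0 0 0 * mono 0 1 0 0 := by rw [mono_mul_mono]; rfl
  rw [e1, e2, e3, e4, map_add, h, h, map_mul, map_add, map_mul, map_mul, map_mul, map_mul, map_mul]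
  have q : ∀ r : ℚ, ∀ f : PowerSeries PhaseAlg, r • f = algebraMap ℚ (PowerSeries PhaseAlg) r * f :=
    fun r f => Algebra.smul_def r f
  simp only [q, map_neg]
  have e5 : algebraMap ℚ (PowerSeries PhaseAlg) (1 / 2) * algebraMap ℚ (PowerSeries PhaseAlg) (1 / 2)
      = algebraMap ℚ (PowerSeries PhaseAlg) (1 / 4) := by
    rw [← map_mul]; norm_num
  linear_combination PowerSeries.X * PowerSeries.C (mono 1 0 0 0) * PowerSeries.C (mono 1 0 0 0) *
    (PowerSeries.C (mono 0 0 1 0) + PowerSeries.C (mono 0 0 0 1)) * e5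

theorem sqrt_ne_zero_of_lt (h0 : 0 ≤ β) (h1 : β < 1) : √(1 - β ^ 2) ≠ 0 :=
  (Real.sqrt_pos.2 (by nlinarith)).ne'

theorem trigVal_add_trigVal (ℓ : ℝ) :
    trigVal β ℓ (1, 0) + trigVal β ℓ (0, 1) = ((-(2 * β * Real.cos (2 * ℓ)) : ℝ) : ℂ) := by
  have h := Complex.two_cos (2 * (ℓ : ℂ))
  simp only [trigVal]
  push_cast
  rw [show 2 * Complex.I * ((1 : ℂ) - 0) * ℓ = 2 * (ℓ : ℂ) * Complex.I by ring,
    show 2 * Complex.I * ((0 : ℂ) - 1) * ℓ = -(2 * (ℓ : ℂ)) * Complex.I by ring]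
  linear_combination β * h

/-- The reduction to parameter-free form: `α√(1-β²)/C` is the overall factor, `σ` rescales `ε`, and
`G²/(2C)` is the part that the formal Hamiltonian omits. -/
theorem isEval_hamiltonianTerm (C α : ℝ) (h0 : 0 ≤ β) (h1 : β < 1) (n : ℕ) :
    IsEval β (if n = 0 then fun G => G ^ 2 / (2 * C) else 0) (hamiltonianTerm C α β n)
      (((α * √(1 - β ^ 2) / C : ℝ) : ℂ) * sigma β ^ n * n.factorial)
      (PowerSeries.coeff n serK) := by
  intro x hx
  have hs : ((√(1 - β ^ 2) : ℝ) : ℂ) ≠ 0 := Complex.ofReal_ne_zero.2 (sqrt_ne_zero_of_lt h0 h1)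
  have hG := momG_ne hx
  match n with
  | 0 =>
    rw [coeff_zero_serK, ev_mono, trigVal_zero]
    simp only [hamiltonianTerm, if_true]
    push_cast
    simp only [zpow_one, pow_zero, Nat.factorial_zero, Nat.cast_one, mul_one]
    field_simp
  | 1 =>
    rw [serK_eq, map_add, PowerSeries.coeff_succ_X_mul, PowerSeries.coeff_succ_C,
      PowerSeries.coeff_zero_C, zero_add, map_add, map_smul, map_smul, map_add, ev_mono, ev_mono,
      ev_mono, trigVal_zero, ← mul_add, trigVal_add_trigVal, Rat.smul_def, Rat.smul_def]
    simp only [hamiltonianTerm, one_ne_zero, if_false, sigma, zpow_zero]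
    rw [show ((x.momL : ℂ) ^ (2 : ℤ)) = (x.momL : ℂ) ^ 2 by norm_cast]
    push_cast
    simp only [pow_one, Nat.factorial_one, Nat.cast_one, mul_one, Pi.zero_apply, Complex.ofReal_zero]
    field_simp
    ring
  | n + 2 =>
    rw [serK_eq, map_add, PowerSeries.coeff_succ_X_mul, PowerSeries.coeff_succ_C,
      PowerSeries.coeff_succ_C]
    simp [hamiltonianTerm]

theorem depritTransform_hamiltonianTerm (C α : ℝ) (h0 : 0 ≤ β) (h1 : β < 1) (n : ℕ)
    (hx : x ∈ domain) : (depritTransform (genW β) (hamiltonianTerm C α β) (n + 1) x : ℂ) =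
      ((α * √(1 - β ^ 2) / C : ℝ) : ℂ) * sigma β ^ (n + 1) * (n + 1).factorial *
        ((x.momL : ℂ) ^ (n + 2) * ((x.momG : ℂ) ^ (-(n : ℤ)) *
          evTrig β x.ell (PowerSeries.coeff (n + 1) tK))) := by
  have hE := isEval_hamiltonianTerm C α h0 h1
  -- The zeroth column still contains `G²/(2C)`. One step removes it, so the formula for iterated
  -- steps starts from the first column.
  have h := depritTriangle_genW (p := 1) (depritTriangle_genW_succ (f := hamiltonianTerm C α β) (p := 0) hE
    fun n => by have := hE (n + 1); rwa [if_neg (Nat.succ_ne_zero n)] at this) n 0 x hx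
  have hh : IsHomog ((n + 2 : ℕ) : ℤ) ((-(n : ℕ) : ℤ) : ℚ)
      (PowerSeries.coeff (n + 1) (lieT gen serK)) := by
    have h2 := HomogSeries.transform homog_gen homog_serK (n + 1)
    have e1 : (1 : ℚ) + ((n + 1 : ℕ) : ℚ) = (((n + 2 : ℕ) : ℤ) : ℚ) := by push_cast; ring
    have e2 : (1 : ℚ) - ((n + 1 : ℕ) : ℚ) = ((-(n : ℕ) : ℤ) : ℚ) := by push_cast; ring
    rw [e1, e2] at h2
    exact h2
  have h3 := evTrig_toTrig (β := β) (x := x) hh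
  rw [← coeff_proj, show proj (lieT gen serK) = tK from rfl, coeff_transform, map_smul,
    Rat.smul_def, pow_succ (lieDeriv dTheta dL gen), Module.End.mul_apply, zpow_natCast,
    mul_assoc] at h3
  rw [← h3, depritTransform, ← add_comm 1 n, h]
  have : ((1 + n).factorial : ℂ) ≠ 0 := by exact_mod_cast (1 + n).factorial_ne_zero
  simp only [Pi.zero_apply, Complex.ofReal_zero, zero_add, pow_zero, Nat.factorial_zero,
    Nat.cast_one, mul_one, pow_add (sigma β), pow_one]
  push_cast
  field_simp

theorem depritTransform_hamiltonianTerm_one (C α : ℝ) (h0 : 0 ≤ β) (h1 : β < 1)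
    (hx : x ∈ domain) :
    depritTransform (genW β) (hamiltonianTerm C α β) 1 x = -(α * x.momL ^ 2 / (2 * C)) := by
  have h := depritTransform_hamiltonianTerm C α h0 h1 0 hx
  have hs : ((√(1 - β ^ 2) : ℝ) : ℂ) ≠ 0 := Complex.ofReal_ne_zero.2 (sqrt_ne_zero_of_lt h0 h1)
  have e : evTrig β x.ell 1 = 1 := by
    rw [show (1 : TrigAlg) = AddMonoidAlgebra.single (0, 0) 1 from rfl, evTrig_single, one_smul,
      trigVal_zero]
  rw [zero_add] at h
  rw [coeff_one_tK, map_smul, e, Rat.smul_def, sigma] at h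
  apply Complex.ofReal_injective
  rw [h]
  simp
  field_simp

theorem depritTransform_hamiltonianTerm_succ (C α : ℝ) (h0 : 0 ≤ β) (h1 : β < 1) {n : ℕ} {q : ℚ[X]}
    (hq : PowerSeries.coeff (n + 2) tK = -((1 / 2 : ℚ) • ofPoly (X * q))) (hx : x ∈ domain) :
    depritTransform (genW β) (hamiltonianTerm C α β) (n + 2) x = -((n + 2).factorial *
      (α * x.momL ^ 2 / (2 * C) * (β ^ 2 * (deltaPrime β x ^ (n + 1) * triax q β)))) := by
  have h := depritTransform_hamiltonianTerm C α h0 h1 (n + 1) hx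
  have hs : ((√(1 - β ^ 2) : ℝ) : ℂ) ≠ 0 := Complex.ofReal_ne_zero.2 (sqrt_ne_zero_of_lt h0 h1)
  rw [hq, map_neg, map_smul, evTrig_ofPoly, triax_X_mul, Rat.smul_def] at h
  have hd := sigma_mul_pow (β := β) hx (n + 1)
  apply Complex.ofReal_injective
  rw [h]
  push_cast at hd ⊢
  rw [← hd, pow_succ (sigma β), pow_succ (x.momL : ℂ) (n + 1 + 1), pow_succ (x.momL : ℂ) (n + 1)]
  rw [show sigma β ^ (n + 1) * sigma β = sigma β ^ (n + 1) * ((√(1 - β ^ 2) : ℝ) : ℂ)⁻¹ from rfl]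
  generalize (x.momG : ℂ) ^ (-((n : ℤ) + 1)) = Gz
  generalize sigma β ^ (n + 1) = Sz
  field_simp

end RigidBody
end

noncomputable section

namespace RigidBody

open LieSeries

variable {β : ℝ} {x : Phase}

/-! ### Existence of the normalization -/

theorem trigVal_add_two_pi (ℓ : ℝ) (g : ℕ × ℕ) :
    trigVal β (ℓ + 2 * Real.pi) g = trigVal β ℓ g := by
  have h := Complex.exp_periodic.int_mul (2 * ((g.1 : ℤ) - g.2))
    (2 * Complex.I * ((g.1 : ℂ) - g.2) * ℓ)
  rw [trigVal, trigVal, ← h]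
  congr 2
  push_cast
  ring

theorem ev_add_two_pi (f : PhaseAlg) (t g L G : ℝ) :
    ev β (t + 2 * Real.pi, g, L, G) f = ev β (t, g, L, G) f := by
  have : phaseVal β (t + 2 * Real.pi, g, L, G) = phaseVal β (t, g, L, G) := by
    funext e
    exact congrArg (fun z => (L : ℂ) ^ e.1 * (G : ℂ) ^ e.2.1 * z) (trigVal_add_two_pi t e.2.2)
  rw [ev, this, ev]

/-- The generator is the derivative with respect to `ℓ` of a `2π`-periodic function, namely the
evaluation of the formal antiderivative. -/
theorem genW_mean_zero (j : ℕ) (x : Phase) :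
    ∫ t in (0 : ℝ)..(2 * Real.pi), genW β j (t, x.ang, x.momL, x.momG) = 0 := by
  set c := (j.factorial : ℂ) * sigma β ^ (j + 1) / (2 * Complex.I) with hc
  set φ := pantider (PowerSeries.coeff j gen) with hφ
  have hd : ∀ t : ℝ, HasDerivAt
      (fun t : ℝ => (c / (2 * Complex.I) * ev β (t, x.ang, x.momL, x.momG) φ).re)
      (genW β j (t, x.ang, x.momL, x.momG)) t := by
    intro t
    have h1 := (hasDerivAt_ev_ell (β := β) φ (t, x.ang, x.momL, x.momG)).const_mul
      (c / (2 * Complex.I))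
    have h2 := (Complex.reCLM.hasFDerivAt (x := c / (2 * Complex.I) *
      ev β (t, x.ang, x.momL, x.momG) φ)).comp_hasDerivAt t h1
    refine h2.congr_deriv ?_
    rw [genW, hφ, dTheta_pantider_gen, ← hc]
    have hI : (2 * Complex.I) ≠ 0 := mul_ne_zero two_ne_zero Complex.I_ne_zero
    rw [← mul_assoc, div_mul_cancel₀ _ hI]
    rfl
  have hcont : Continuous fun t : ℝ => genW β j (t, x.ang, x.momL, x.momG) := by
    have h1 : ∀ t : ℝ, HasDerivAt (fun t : ℝ => genW β j (t, x.ang, x.momL, x.momG)) _ t :=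
      fun t => (Complex.reCLM.hasFDerivAt (x := c * ev β (t, x.ang, x.momL, x.momG)
        (PowerSeries.coeff j gen))).comp_hasDerivAt t ((hasDerivAt_ev_ell (β := β)
        (PowerSeries.coeff j gen) (t, x.ang, x.momL, x.momG)).const_mul c)
    exact continuous_iff_continuousAt.2 fun t => (h1 t).continuousAt
  rw [intervalIntegral.integral_eq_sub_of_hasDerivAt (fun t _ => hd t)
    (hcont.intervalIntegrable _ _)]
  have h := ev_add_two_pi (β := β) φ 0 x.ang x.momL x.momG
  rw [zero_add] at h
  rw [h, sub_self]

theorem isDepritNormalization_genW (C α : ℝ) (h0 : 0 ≤ β) (h1 : β < 1) (N : ℕ) :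
    IsDepritNormalization C α β N (genW β) where
  smooth j _ := Complex.reCLM.contDiff.comp_contDiffOn (contDiffOn_const.mul (contDiffOn_ev _))
  ang_free j _ x _ g := rfl
  periodic j _ x _ := by rw [genW, ev_add_two_pi, genW]
  mean_zero j _ x _ := genW_mean_zero j x
  normalized n _ := by
    match n with
    | 0 => exact ⟨fun L G => G ^ 2 / (2 * C) * (1 + 2 * α * √(1 - β ^ 2) * (L / G)), fun _ _ => rfl⟩
    | 1 => exact ⟨fun L _ => -(α * L ^ 2 / (2 * C)),
        fun x hx => depritTransform_hamiltonianTerm_one C α h0 h1 hx⟩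
    | n + 2 =>
      obtain ⟨q, hq⟩ := exists_tK n
      exact ⟨fun L G => -((n + 2).factorial *
        (α * L ^ 2 / (2 * C) * (β ^ 2 * ((L / G * (1 / √(1 - β ^ 2))) ^ (n + 1) * triax q β)))),
        fun x hx => depritTransform_hamiltonianTerm_succ C α h0 h1 hq hx⟩

end RigidBody
end

noncomputable section

namespace RigidBody

open LieSeries

/-! ### Uniqueness of the normalization -/

theorem isOpen_domain : IsOpen domain :=
  (isOpen_lt (f := fun _ : Phase => (0 : ℝ)) (g := fun x => x.momL) continuous_const
    (by fun_prop)).inter (isOpen_lt (f := fun _ : Phase => (0 : ℝ)) (g := fun x => x.momG)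
      continuous_const (by fun_prop))

variable {W W' : ℕ → Phase → ℝ} {f f' h h' : Phase → ℝ} {x : Phase}

theorem partialEll_congr (H : EqOn f f' domain) (hx : x ∈ domain) :
    partialEll f x = partialEll f' x := by
  refine Filter.EventuallyEq.deriv_eq (Eventually.of_forall fun t => ?_)
  exact H (x := (t, x.ang, x.momL, x.momG)) hx

theorem partialAng_congr (H : EqOn f f' domain) (hx : x ∈ domain) :
    partialAng f x = partialAng f' x := by
  refine Filter.EventuallyEq.deriv_eq (Eventually.of_forall fun t => ?_)
  exact H (x := (x.ell, t, x.momL, x.momG)) hx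

theorem partialL_congr (H : EqOn f f' domain) (hx : x ∈ domain) :
    partialL f x = partialL f' x :=
  Filter.EventuallyEq.deriv_eq ((eventually_pos hx.1).mono fun t ht =>
    H (x := (x.ell, x.ang, t, x.momG)) ⟨ht, hx.2⟩)

theorem partialG_congr (H : EqOn f f' domain) (hx : x ∈ domain) :
    partialG f x = partialG f' x :=
  Filter.EventuallyEq.deriv_eq ((eventually_pos hx.2).mono fun t ht =>
    H (x := (x.ell, x.ang, x.momL, t)) ⟨hx.1, ht⟩)

theorem poisson_congr (H : EqOn f f' domain) (H' : EqOn h h' domain) (hx : x ∈ domain) :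
    poisson f h x = poisson f' h' x := by
  rw [poisson, poisson, partialEll_congr H hx, partialAng_congr H hx, partialL_congr H hx,
    partialG_congr H hx, partialEll_congr H' hx, partialAng_congr H' hx, partialL_congr H' hx,
    partialG_congr H' hx]

theorem depritTriangle_succ (W f : ℕ → Phase → ℝ) (n p : ℕ) (x : Phase) :
    depritTriangle W f n (p + 1) x = depritTriangle W f (n + 1) p x +
      ∑ j ∈ Finset.range (n + 1),
        (n.choose j : ℝ) * poisson (depritTriangle W f (n - j) p) (W j) x := rfl

theorem depritTriangle_congr {m : ℕ} (H : ∀ j < m, EqOn (W j) (W' j) domain)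
    (F : ℕ → Phase → ℝ) (p n : ℕ) (hn : n + p ≤ m) :
    EqOn (depritTriangle W F n p) (depritTriangle W' F n p) domain := by
  induction p generalizing n with
  | zero => exact fun _ _ => rfl
  | succ p ih =>
    intro x hx
    rw [depritTriangle_succ, depritTriangle_succ, ih (n + 1) (by omega) hx]
    congr 1
    refine Finset.sum_congr rfl fun j hj => ?_
    have := Finset.mem_range.1 hj
    rw [poisson_congr (ih (n - j) (by omega)) (H j (by omega)) hx]

/-- Two generators that first differ in `W m` change the antidiagonal of order `m + 1` only through
the bracket of `F 0` with that term; all other brackets there involve terms on which they agree, and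
the change is passed unaltered from one column to the next. -/
theorem depritTriangle_sub {m : ℕ} (H : ∀ j < m, EqOn (W j) (W' j) domain)
    (F : ℕ → Phase → ℝ) (hx : x ∈ domain) (p n : ℕ) (hn : n + p = m) :
    depritTriangle W F n (p + 1) x - depritTriangle W' F n (p + 1) x =
      poisson (F 0) (W m) x - poisson (F 0) (W' m) x := by
  induction p generalizing n with
  | zero =>
    obtain rfl : n = m := by omega
    rw [depritTriangle_succ, depritTriangle_succ, Finset.sum_range_succ, Finset.sum_range_succ]
    rw [Finset.sum_congr rfl fun j hj => by
      rw [poisson_congr (fun _ _ => rfl : EqOn (depritTriangle W F (n - j) 0)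
        (depritTriangle W' F (n - j) 0) domain) (H j (Finset.mem_range.1 hj)) hx]]
    simp only [Nat.sub_self, Nat.choose_self, Nat.cast_one, one_mul, depritTriangle]
    ring
  | succ p ih =>
    have e : ∑ j ∈ Finset.range (n + 1),
        (n.choose j : ℝ) * poisson (depritTriangle W F (n - j) (p + 1)) (W j) x =
        ∑ j ∈ Finset.range (n + 1),
        (n.choose j : ℝ) * poisson (depritTriangle W' F (n - j) (p + 1)) (W' j) x :=
      Finset.sum_congr rfl fun j hj => by
        have := Finset.mem_range.1 hj
        rw [poisson_congr (depritTriangle_congr H F (p + 1) (n - j) (by omega))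
          (H j (by omega)) hx]
    have h1 := depritTriangle_succ W F n (p + 1) x
    have h2 := depritTriangle_succ W' F n (p + 1) x
    rw [← ih (n + 1) (by omega)]
    linarith

theorem partialAng_eq_zero (hf : ∀ x ∈ domain, ∀ g : ℝ, f (x.ell, g, x.momL, x.momG) = f x)
    (hx : x ∈ domain) : partialAng f x = 0 := by
  rw [partialAng]
  simp only [hf x hx, deriv_const]

theorem partialL_hamiltonianTerm_zero (C α β : ℝ) (hx : x ∈ domain) :
    partialL (hamiltonianTerm C α β 0) x = α * √(1 - β ^ 2) * x.momG / C := by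
  have hG : x.momG ≠ 0 := hx.2.ne'
  have h : HasDerivAt (fun t : ℝ => x.momG ^ 2 / (2 * C) *
      (1 + 2 * α * √(1 - β ^ 2) * (t / x.momG)))
      (x.momG ^ 2 / (2 * C) * (2 * α * √(1 - β ^ 2) * (1 / x.momG))) x.momL :=
    ((((hasDerivAt_id _).div_const _).const_mul _).const_add _).const_mul _
  refine h.deriv.trans ?_
  field_simp

theorem poisson_hamiltonianTerm_zero (C α β : ℝ)
    (hf : ∀ x ∈ domain, ∀ g : ℝ, f (x.ell, g, x.momL, x.momG) = f x) (hx : x ∈ domain) :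
    poisson (hamiltonianTerm C α β 0) f x = -(α * √(1 - β ^ 2) * x.momG / C) * partialEll f x := by
  have h1 : partialEll (hamiltonianTerm C α β 0) x = 0 :=
    deriv_const x.ell (hamiltonianTerm C α β 0 x)
  have h2 : partialAng (hamiltonianTerm C α β 0) x = 0 :=
    deriv_const x.ang (hamiltonianTerm C α β 0 x)
  rw [poisson, h1, h2, partialAng_eq_zero hf hx, partialL_hamiltonianTerm_zero C α β hx]
  ring

theorem hasDerivAt_ell (hf : ContDiffOn ℝ ∞ f domain) (hx : x ∈ domain) :
    HasDerivAt (fun t => f (t, x.ang, x.momL, x.momG)) (partialEll f x) x.ell := by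
  have h1 : DifferentiableAt ℝ f x :=
    (hf.contDiffAt (isOpen_domain.mem_nhds hx)).differentiableAt (by simp)
  have h2 : DifferentiableAt ℝ (fun t : ℝ => ((t, x.ang, x.momL, x.momG) : Phase)) x.ell := by
    fun_prop
  exact (DifferentiableAt.comp x.ell (g := f) h1 h2).hasDerivAt

theorem continuous_ell (hf : ContDiffOn ℝ ∞ f domain) (hx : x ∈ domain) :
    Continuous fun t => f (t, x.ang, x.momL, x.momG) :=
  continuous_iff_continuousAt.2 fun t =>
    (hasDerivAt_ell (x := (t, x.ang, x.momL, x.momG)) hf hx).continuousAt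

/-- By induction the generators agree below `j`. Both transformed Hamiltonians of order `j + 1`
depend on the momenta only, and their difference is a nonzero multiple of the `ℓ`-derivative of the
difference of the generators. So the latter is affine in `ℓ`; periodicity removes the slope and the
vanishing mean removes the constant. -/
theorem IsDepritNormalization.eqOn {C α β : ℝ} (hC : 0 < C) (hα : 0 < α) (h0 : 0 ≤ β) (h1 : β < 1)
    {N : ℕ} (hW : IsDepritNormalization C α β N W) (hW' : IsDepritNormalization C α β N W')
    (j : ℕ) (hj : j < N) : EqOn (W j) (W' j) domain := by
  induction j using Nat.strong_induction_on with
  | _ j ih =>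
    intro x hx
    have H : ∀ i < j, EqOn (W i) (W' i) domain := fun i hi => ih i hi (hi.trans hj)
    obtain ⟨T, hT⟩ := hW.normalized (j + 1) hj
    obtain ⟨T', hT'⟩ := hW'.normalized (j + 1) hj
    set a := α * √(1 - β ^ 2) * x.momG / C with ha
    have ha0 : a ≠ 0 := by
      have := sqrt_ne_zero_of_lt h0 h1
      have := hx.2.ne'
      positivity
    set u : ℝ → ℝ := fun t => W j (t, x.ang, x.momL, x.momG) - W' j (t, x.ang, x.momL, x.momG)
      with hu
    set c := -(T x.momL x.momG - T' x.momL x.momG) / a with hc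
    -- `a` is `∂H_0/∂L`, so the difference of the brackets with `H_0` is `-a` times the derivative
    -- of `u`. It equals the difference of `T` and `T'`, which is independent of `t`.
    have hd : ∀ t, HasDerivAt u c t := by
      intro t
      have hy : ((t, x.ang, x.momL, x.momG) : Phase) ∈ domain := hx
      have h2 := depritTriangle_sub H (hamiltonianTerm C α β) hy j 0 (by omega)
      rw [poisson_hamiltonianTerm_zero C α β (hW.ang_free j hj) hy,
        poisson_hamiltonianTerm_zero C α β (hW'.ang_free j hj) hy] at h2
      have h3 := hT _ hy
      have h4 := hT' _ hy
      rw [depritTransform] at h3 h4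
      rw [h3, h4] at h2
      refine ((hasDerivAt_ell (hW.smooth j hj) hy).sub
        (hasDerivAt_ell (hW'.smooth j hj) hy)).congr_deriv ?_
      rw [hc, eq_div_iff ha0, ha]
      change T x.momL x.momG - T' x.momL x.momG = _ at h2
      rw [h2]
      ring
    have hlin : ∀ t, u t = u 0 + c * t := by
      intro t
      have h2 : ∀ t, HasDerivAt (fun t => u t - c * t) (c - c * 1) t := fun t =>
        (hd t).sub ((hasDerivAt_id t).const_mul c)
      have h3 := is_const_of_deriv_eq_zero (fun t => (h2 t).differentiableAt)
        (fun t => by rw [(h2 t).deriv]; ring) t 0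
      change u t - c * t = u 0 - c * 0 at h3
      linarith
    have hper : u (2 * Real.pi) = u 0 := by
      have e1 := hW.periodic j hj (0, x.ang, x.momL, x.momG) hx
      have e2 := hW'.periodic j hj (0, x.ang, x.momL, x.momG) hx
      change W j (0 + 2 * Real.pi, x.ang, x.momL, x.momG) = _ at e1
      change W' j (0 + 2 * Real.pi, x.ang, x.momL, x.momG) = _ at e2
      rw [zero_add] at e1 e2
      change W j _ - W' j _ = W j _ - W' j _
      rw [e1, e2]
    have hc0 : c = 0 := by
      have := hlin (2 * Real.pi)
      rw [hper] at this
      have hp := Real.pi_pos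
      have h5 : c * (2 * Real.pi) = 0 := by linarith
      exact (mul_eq_zero.1 h5).resolve_right (by positivity)
    have hcst : ∀ t, W j (t, x.ang, x.momL, x.momG) = W' j (t, x.ang, x.momL, x.momG) + u 0 := by
      intro t
      have := hlin t
      rw [hc0, zero_mul, add_zero] at this
      rw [← this, hu]
      ring
    have hint := hW.mean_zero j hj x hx
    simp only [hcst] at hint
    rw [intervalIntegral.integral_add ((continuous_ell (hW'.smooth j hj) hx).intervalIntegrable _ _)
      (continuous_const.intervalIntegrable _ _), hW'.mean_zero j hj x hx, zero_add,
      intervalIntegral.integral_const, smul_eq_mul, sub_zero] at hint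
    have hp := Real.pi_pos
    have hu0 := (mul_eq_zero.1 hint).resolve_left (by positivity)
    have := hcst x.ell
    rw [hu0, add_zero] at this
    exact this

end RigidBody
end

noncomputable section

namespace RigidBody

open LieSeries

/-! ### Partial derivatives of smooth functions -/

section Smooth

variable {f h : Phase → ℝ} {x : Phase}

theorem hasDerivAt_line_ell (x : Phase) :
    HasDerivAt (fun t : ℝ => ((t, x.ang, x.momL, x.momG) : Phase)) (1, 0, 0, 0) x.ell :=
  (hasDerivAt_id _).prodMk ((hasDerivAt_const _ _).prodMk
    ((hasDerivAt_const _ _).prodMk (hasDerivAt_const _ _)))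

theorem hasDerivAt_line_ang (x : Phase) :
    HasDerivAt (fun t : ℝ => ((x.ell, t, x.momL, x.momG) : Phase)) (0, 1, 0, 0) x.ang :=
  (hasDerivAt_const _ _).prodMk ((hasDerivAt_id _).prodMk
    ((hasDerivAt_const _ _).prodMk (hasDerivAt_const _ _)))

theorem hasDerivAt_line_momL (x : Phase) :
    HasDerivAt (fun t : ℝ => ((x.ell, x.ang, t, x.momG) : Phase)) (0, 0, 1, 0) x.momL :=
  (hasDerivAt_const _ _).prodMk ((hasDerivAt_const _ _).prodMk
    ((hasDerivAt_id _).prodMk (hasDerivAt_const _ _)))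

theorem hasDerivAt_line_momG (x : Phase) :
    HasDerivAt (fun t : ℝ => ((x.ell, x.ang, x.momL, t) : Phase)) (0, 0, 0, 1) x.momG :=
  (hasDerivAt_const _ _).prodMk ((hasDerivAt_const _ _).prodMk
    ((hasDerivAt_const _ _).prodMk (hasDerivAt_id _)))

theorem partialEll_eq_fderiv (hf : DifferentiableAt ℝ f x) :
    partialEll f x = fderiv ℝ f x (1, 0, 0, 0) :=
  (HasFDerivAt.comp_hasDerivAt x.ell (l := f) hf.hasFDerivAt (hasDerivAt_line_ell x)).deriv

theorem partialAng_eq_fderiv (hf : DifferentiableAt ℝ f x) :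
    partialAng f x = fderiv ℝ f x (0, 1, 0, 0) :=
  (HasFDerivAt.comp_hasDerivAt x.ang (l := f) hf.hasFDerivAt (hasDerivAt_line_ang x)).deriv

theorem partialL_eq_fderiv (hf : DifferentiableAt ℝ f x) :
    partialL f x = fderiv ℝ f x (0, 0, 1, 0) :=
  (HasFDerivAt.comp_hasDerivAt x.momL (l := f) hf.hasFDerivAt (hasDerivAt_line_momL x)).deriv

theorem partialG_eq_fderiv (hf : DifferentiableAt ℝ f x) :
    partialG f x = fderiv ℝ f x (0, 0, 0, 1) :=
  (HasFDerivAt.comp_hasDerivAt x.momG (l := f) hf.hasFDerivAt (hasDerivAt_line_momG x)).deriv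

theorem fderiv_eq_partials (hf : DifferentiableAt ℝ f x) (a b c d : ℝ) :
    fderiv ℝ f x (a, b, c, d) =
      a * partialEll f x + b * partialAng f x + c * partialL f x + d * partialG f x := by
  rw [partialEll_eq_fderiv hf, partialAng_eq_fderiv hf, partialL_eq_fderiv hf,
    partialG_eq_fderiv hf]
  have e : ((a, b, c, d) : Phase) = a • (1, 0, 0, 0) + b • (0, 1, 0, 0) + c • (0, 0, 1, 0) +
      d • (0, 0, 0, 1) := by simp
  rw [e]
  simp only [map_add, map_smul, smul_eq_mul]

theorem differentiableAt_of_smooth (hf : ContDiffOn ℝ ∞ f domain) (hx : x ∈ domain) :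
    DifferentiableAt ℝ f x :=
  (hf.contDiffAt (isOpen_domain.mem_nhds hx)).differentiableAt (by simp)

theorem continuousAt_of_smooth (hf : ContDiffOn ℝ ∞ f domain) (hx : x ∈ domain) :
    ContinuousAt f x := (differentiableAt_of_smooth hf hx).continuousAt

theorem contDiffOn_fderiv_apply (hf : ContDiffOn ℝ ∞ f domain) (v : Phase) :
    ContDiffOn ℝ ∞ (fun x => fderiv ℝ f x v) domain :=
  (hf.fderiv_of_isOpen isOpen_domain (by simp)).clm_apply contDiffOn_const

theorem contDiffOn_partialEll (hf : ContDiffOn ℝ ∞ f domain) :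
    ContDiffOn ℝ ∞ (partialEll f) domain :=
  (contDiffOn_fderiv_apply hf _).congr fun _ hx =>
    partialEll_eq_fderiv (differentiableAt_of_smooth hf hx)

theorem contDiffOn_partialAng (hf : ContDiffOn ℝ ∞ f domain) :
    ContDiffOn ℝ ∞ (partialAng f) domain :=
  (contDiffOn_fderiv_apply hf _).congr fun _ hx =>
    partialAng_eq_fderiv (differentiableAt_of_smooth hf hx)

theorem contDiffOn_partialL (hf : ContDiffOn ℝ ∞ f domain) :
    ContDiffOn ℝ ∞ (partialL f) domain :=
  (contDiffOn_fderiv_apply hf _).congr fun _ hx =>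
    partialL_eq_fderiv (differentiableAt_of_smooth hf hx)

theorem contDiffOn_partialG (hf : ContDiffOn ℝ ∞ f domain) :
    ContDiffOn ℝ ∞ (partialG f) domain :=
  (contDiffOn_fderiv_apply hf _).congr fun _ hx =>
    partialG_eq_fderiv (differentiableAt_of_smooth hf hx)

theorem contDiffOn_poisson (hf : ContDiffOn ℝ ∞ f domain) (hh : ContDiffOn ℝ ∞ h domain) :
    ContDiffOn ℝ ∞ (poisson f h) domain :=
  (((contDiffOn_partialEll hf).mul (contDiffOn_partialL hh)).sub
    ((contDiffOn_partialL hf).mul (contDiffOn_partialEll hh))).add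
  (((contDiffOn_partialAng hf).mul (contDiffOn_partialG hh)).sub
    ((contDiffOn_partialG hf).mul (contDiffOn_partialAng hh)))

theorem contDiffOn_depritTriangle {W F : ℕ → Phase → ℝ} {m : ℕ}
    (hW : ∀ j < m, ContDiffOn ℝ ∞ (W j) domain) (hF : ∀ n, ContDiffOn ℝ ∞ (F n) domain)
    (p n : ℕ) (hn : n + p ≤ m) : ContDiffOn ℝ ∞ (depritTriangle W F n p) domain := by
  induction p generalizing n with
  | zero => exact hF n
  | succ p ih =>
    refine (ih (n + 1) (by omega)).add (ContDiffOn.sum fun j hj => contDiffOn_const.mul ?_)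
    have := Finset.mem_range.1 hj
    exact contDiffOn_poisson (ih (n - j) (by omega)) (hW j (by omega))

/-- Only finite linearity of the bracket in its second argument, but it turns the derivative along
the flow into the sum that appears in Deprit's triangle. -/
theorem poisson_generator {W : ℕ → Phase → ℝ} {m : ℕ}
    (hW : ∀ j < m, ContDiffOn ℝ ∞ (W j) domain) (f : Phase → ℝ) (ε : ℝ) (hx : x ∈ domain) :
    poisson f (generator W m ε) x =
      ∑ j ∈ Finset.range m, ε ^ j / (j.factorial : ℝ) * poisson f (W j) x := by
  have hd : ∀ j ∈ Finset.range m, DifferentiableAt ℝ (W j) x := fun j hj =>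
    differentiableAt_of_smooth (hW j (Finset.mem_range.1 hj)) hx
  have hd' : ∀ j ∈ Finset.range m,
      DifferentiableAt ℝ (fun x => ε ^ j / (j.factorial : ℝ) * W j x) x := fun j hj =>
    (hd j hj).const_mul _
  have hg : DifferentiableAt ℝ (generator W m ε) x := DifferentiableAt.fun_sum hd'
  have hfd : fderiv ℝ (generator W m ε) x =
      ∑ j ∈ Finset.range m, (ε ^ j / (j.factorial : ℝ)) • fderiv ℝ (W j) x := by
    refine (fderiv_fun_sum hd').trans (Finset.sum_congr rfl fun j hj => ?_)
    exact fderiv_const_mul (hd j hj) _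
  rw [poisson, partialEll_eq_fderiv hg, partialAng_eq_fderiv hg, partialL_eq_fderiv hg,
    partialG_eq_fderiv hg, hfd]
  simp only [sum_apply, smul_apply, smul_eq_mul,
    Finset.mul_sum, ← Finset.sum_sub_distrib, ← Finset.sum_add_distrib]
  refine Finset.sum_congr rfl fun j hj => ?_
  rw [poisson, partialEll_eq_fderiv (hd j hj), partialAng_eq_fderiv (hd j hj),
    partialL_eq_fderiv (hd j hj), partialG_eq_fderiv (hd j hj)]
  ring

/-- The derivative of a function along a Hamiltonian flow is its Poisson bracket. -/
theorem hasDerivAt_comp_flow {γ : ℝ → Phase} {F : Phase → ℝ} {ε : ℝ}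
    (hγ : HasDerivAt γ (hamiltonianField F (γ ε)) ε) (hf : DifferentiableAt ℝ f (γ ε)) :
    HasDerivAt (fun ε => f (γ ε)) (poisson f F (γ ε)) ε := by
  refine (HasFDerivAt.comp_hasDerivAt ε (l := f) hf.hasFDerivAt hγ).congr_deriv ?_
  rw [hamiltonianField, fderiv_eq_partials hf, poisson]
  ring

end Smooth

/-! ### Taylor expansion along the flow -/

/-- The mean value inequality on the ball of radius `|ε|` gains one power of `ε`; no integrability
of the derivative is needed. -/
theorem isBigO_pow_succ_of_hasDerivAt {u u' : ℝ → ℝ} {n : ℕ}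
    (hu : ∀ᶠ ε in 𝓝 (0 : ℝ), HasDerivAt u (u' ε) ε) (h : u' =O[𝓝 0] fun ε : ℝ => ε ^ n)
    (h0 : u 0 = 0) : u =O[𝓝 0] fun ε : ℝ => ε ^ (n + 1) := by
  obtain ⟨c, hc⟩ := h.bound
  obtain ⟨r, hr, hball⟩ := Metric.eventually_nhds_iff_ball.1 (hu.and hc)
  refine IsBigO.of_bound |c| (Metric.eventually_nhds_iff_ball.2 ⟨r, hr, fun ε hε => ?_⟩)
  have hsub : ∀ t ∈ Metric.closedBall (0 : ℝ) |ε|, t ∈ Metric.ball (0 : ℝ) r := fun t ht => by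
    rw [mem_closedBall_zero_iff] at ht
    rw [mem_ball_zero_iff] at hε ⊢
    exact lt_of_le_of_lt ht hε
  have hc0 : ∀ t ∈ Metric.closedBall (0 : ℝ) |ε|, ‖u' t‖ ≤ |c| * |ε| ^ n := fun t ht => by
    refine (hball t (hsub t ht)).2.trans ?_
    rw [norm_pow]
    rw [mem_closedBall_zero_iff] at ht
    exact mul_le_mul (le_abs_self c) (pow_le_pow_left₀ (norm_nonneg t) ht n) (by positivity)
      (abs_nonneg c)
  have key := (convex_closedBall (0 : ℝ) |ε|).norm_image_sub_le_of_norm_hasDerivWithin_le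
    (fun t ht => (hball t (hsub t ht)).1.hasDerivWithinAt) hc0
    (x := 0) (y := ε) (by simp) (by simp)
  rw [h0, sub_zero, sub_zero] at key
  rw [norm_pow, pow_succ, ← mul_assoc]
  exact key

/-- A rectangle of pairs `(n, j)` minus the triangle `n + j < k`, which the second sum enumerates by
antidiagonals; `k ≤ m` puts the triangle inside the rectangle. -/
theorem sum_range_sum_range_sub (b : ℕ → ℕ → ℝ) {k m : ℕ} (hk : k ≤ m) :
    ∑ n ∈ Finset.range (k + 1), ∑ j ∈ Finset.range m, b n j -
      ∑ n ∈ Finset.range k, ∑ j ∈ Finset.range (n + 1), b (n - j) j =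
    ∑ n ∈ Finset.range (k + 1), ∑ j ∈ Finset.range m, if n + j < k then 0 else b n j := by
  have e : ∑ n ∈ Finset.range k, ∑ j ∈ Finset.range (n + 1), b (n - j) j =
      ∑ n ∈ Finset.range (k + 1), ∑ j ∈ Finset.range m, if n + j < k then b n j else 0 := by
    rw [Finset.sum_range_diag_flip k fun j n => b n j, Finset.sum_comm]
    have e1 : ∀ j, ∑ n ∈ Finset.range (k + 1), (if n + j < k then b n j else 0) =
        ∑ n ∈ Finset.range (k - j), b n j := fun j => by
      rw [← Finset.sum_filter]
      refine Finset.sum_congr (Finset.ext fun n => ?_) fun _ _ => rfl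
      simp only [Finset.mem_filter, Finset.mem_range]
      omega
    simp only [e1]
    refine Finset.sum_subset (Finset.range_mono hk) fun j _ hj => ?_
    have : k ≤ j := by simpa using hj
    rw [Nat.sub_eq_zero_of_le this, Finset.sum_range_zero]
  rw [e, ← Finset.sum_sub_distrib]
  refine Finset.sum_congr rfl fun n _ => ?_
  rw [← Finset.sum_sub_distrib]
  refine Finset.sum_congr rfl fun j _ => ?_
  split <;> ring

theorem isBigO_pow_of_le {n m : ℕ} (h : n ≤ m) :
    (fun ε : ℝ => ε ^ m) =O[𝓝 0] fun ε : ℝ => ε ^ n := by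
  obtain ⟨k, rfl⟩ := Nat.exists_eq_add_of_le h
  have h1 : (fun ε : ℝ => ε ^ k) =O[𝓝 0] fun _ => (1 : ℝ) :=
    ((continuous_pow k).tendsto (0 : ℝ)).isBigO_one ℝ
  simpa [pow_add] using (isBigO_refl (fun ε : ℝ => ε ^ n) (𝓝 0)).mul h1

section Flow

variable {W F : ℕ → Phase → ℝ} {m : ℕ} {γ : ℝ → Phase} {x : Phase}

theorem IsLieTransform.hasDerivAt_zero (hγ : IsLieTransform W m x γ) :
    HasDerivAt γ (hamiltonianField (generator W m 0) x) 0 := by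
  have := hγ.flow.self_of_nhds
  rwa [hγ.init] at this

theorem IsLieTransform.eventually_mem (hγ : IsLieTransform W m x γ) (hx : x ∈ domain) :
    ∀ᶠ ε in 𝓝 (0 : ℝ), γ ε ∈ domain := by
  refine hγ.hasDerivAt_zero.continuousAt.eventually_mem (isOpen_domain.mem_nhds ?_)
  rwa [hγ.init]

/-- The column `p` of Deprit's triangle along the flow. -/
def column (W F : ℕ → Phase → ℝ) (m : ℕ) (γ : ℝ → Phase) (p : ℕ) (ε : ℝ) : ℝ :=
  ∑ n ∈ Finset.range (m - p + 1), ε ^ n / (n.factorial : ℝ) * depritTriangle W F n p (γ ε)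

/-- The derivative of `column W F m γ p`. -/
def columnDeriv (W F : ℕ → Phase → ℝ) (m : ℕ) (γ : ℝ → Phase) (p : ℕ) (ε : ℝ) : ℝ :=
  ∑ n ∈ Finset.range (m - p), ε ^ n / (n.factorial : ℝ) * depritTriangle W F (n + 1) p (γ ε) +
    ∑ n ∈ Finset.range (m - p + 1), ∑ j ∈ Finset.range m,
      ε ^ n / (n.factorial : ℝ) * (ε ^ j / (j.factorial : ℝ) *
        poisson (depritTriangle W F n p) (W j) (γ ε))

theorem hasDerivAt_pow_div_factorial (n : ℕ) (ε : ℝ) :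
    HasDerivAt (fun ε : ℝ => ε ^ (n + 1) / ((n + 1).factorial : ℝ))
      (ε ^ n / (n.factorial : ℝ)) ε := by
  refine ((hasDerivAt_pow (n + 1) ε).div_const _).congr_deriv ?_
  rw [Nat.factorial_succ]
  have : (n.factorial : ℝ) ≠ 0 := by positivity
  push_cast
  field_simp

theorem hasDerivAt_column (hW : ∀ j < m, ContDiffOn ℝ ∞ (W j) domain)
    (hF : ∀ n, ContDiffOn ℝ ∞ (F n) domain) {p : ℕ} (hp : p ≤ m) {ε : ℝ} (hε : γ ε ∈ domain)
    (hγ : HasDerivAt γ (hamiltonianField (generator W m ε) (γ ε)) ε) :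
    HasDerivAt (column W F m γ p) (columnDeriv W F m γ p ε) ε := by
  have hT : ∀ n ∈ Finset.range (m - p + 1), HasDerivAt
      (fun ε => depritTriangle W F n p (γ ε)) (∑ j ∈ Finset.range m, ε ^ j / (j.factorial : ℝ) *
        poisson (depritTriangle W F n p) (W j) (γ ε)) ε := fun n hn => by
    have := Finset.mem_range.1 hn
    rw [← poisson_generator hW _ _ hε]
    exact hasDerivAt_comp_flow hγ
      (differentiableAt_of_smooth (contDiffOn_depritTriangle hW hF p n (by omega)) hε)
  have hsum := HasDerivAt.fun_sum fun n hn => ((show HasDerivAt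
    (fun ε : ℝ => ε ^ n / (n.factorial : ℝ))
      (if n = 0 then 0 else ε ^ (n - 1) / ((n - 1).factorial : ℝ)) ε by
        cases n with
        | zero => simpa using hasDerivAt_const ε (1 : ℝ)
        | succ n => simpa using hasDerivAt_pow_div_factorial n ε).mul (hT n hn))
  refine hsum.congr_deriv ?_
  rw [columnDeriv, Finset.sum_add_distrib]
  congr 1
  · rw [Finset.sum_range_succ']
    simp
  · simp only [Finset.mul_sum]

/-- By Deprit's recursion the brackets with `n + j < m - p`, together with the derivatives of the
powers of `ε`, are exactly the next column. The remaining brackets carry at least `ε^(m - p)` times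
a factor bounded near the initial point. -/
theorem columnDeriv_sub_isBigO (hW : ∀ j < m, ContDiffOn ℝ ∞ (W j) domain)
    (hF : ∀ n, ContDiffOn ℝ ∞ (F n) domain) {p : ℕ} (hp : p < m)
    (hγ : IsLieTransform W m x γ) (hx : x ∈ domain) :
    (fun ε => columnDeriv W F m γ p ε - column W F m γ (p + 1) ε) =O[𝓝 0]
      fun ε : ℝ => ε ^ (m - p) := by
  have e : ∀ ε, columnDeriv W F m γ p ε - column W F m γ (p + 1) ε =
      ∑ n ∈ Finset.range (m - p + 1), ∑ j ∈ Finset.range m, if n + j < m - p then 0 else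
        ε ^ n / (n.factorial : ℝ) * (ε ^ j / (j.factorial : ℝ) *
          poisson (depritTriangle W F n p) (W j) (γ ε)) := by
    intro ε
    rw [← sum_range_sum_range_sub _ (Nat.sub_le m p), columnDeriv, column,
      show m - (p + 1) + 1 = m - p by omega]
    simp only [depritTriangle_succ, mul_add, Finset.sum_add_distrib]
    rw [add_sub_add_left_eq_sub]
    congr 1
    refine Finset.sum_congr rfl fun n _ => ?_
    rw [Finset.mul_sum]
    refine Finset.sum_congr rfl fun j hj => ?_
    have hj : j ≤ n := Nat.lt_succ_iff.1 (Finset.mem_range.1 hj)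
    have h1 : (n.choose j : ℝ) * j.factorial * (n - j).factorial = n.factorial := by
      exact_mod_cast Nat.choose_mul_factorial_mul_factorial hj
    have h2 : ε ^ n = ε ^ (n - j) * ε ^ j := by rw [← pow_add, Nat.sub_add_cancel hj]
    have h3 : (j.factorial : ℝ) ≠ 0 := by positivity
    have h4 : ((n - j).factorial : ℝ) ≠ 0 := by positivity
    have h5 : (n.choose j : ℝ) ≠ 0 := by exact_mod_cast (Nat.choose_pos hj).ne'
    rw [← h1, h2]
    field_simp
  simp only [e]
  refine IsBigO.fun_sum fun n hn => IsBigO.fun_sum fun j hj => ?_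
  split
  · exact isBigO_zero _ _
  · rename_i hnj
    have hn := Finset.mem_range.1 hn
    have hB : (fun ε => poisson (depritTriangle W F n p) (W j) (γ ε)) =O[𝓝 0]
        fun _ => (1 : ℝ) := by
      have h1 : ContinuousAt (poisson (depritTriangle W F n p) (W j)) (γ 0) := by
        rw [hγ.init]
        exact continuousAt_of_smooth (contDiffOn_poisson
          (contDiffOn_depritTriangle hW hF p n (by omega)) (hW j (Finset.mem_range.1 hj))) hx
      exact (ContinuousAt.comp (f := γ) h1 hγ.hasDerivAt_zero.continuousAt).tendsto.isBigO_one ℝ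
    have h2 := ((isBigO_pow_of_le (not_lt.1 hnj)).const_mul_left
      ((n.factorial : ℝ)⁻¹ * (j.factorial : ℝ)⁻¹)).mul hB
    refine (h2.congr_left fun ε => ?_).congr_right fun ε => mul_one _
    rw [pow_add]
    ring

/-- Induction from the last column back to the first. The last column is differentiable at `0`, so
it equals its initial value up to `O(ε)`. Each earlier column has the next one as derivative up to
an admissible error, and integration raises the order of the error by one. -/
theorem column_sub_isBigO (hW : ∀ j < m, ContDiffOn ℝ ∞ (W j) domain)
    (hF : ∀ n, ContDiffOn ℝ ∞ (F n) domain) (hγ : IsLieTransform W m x γ) (hx : x ∈ domain)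
    (k p : ℕ) (hp : p + k = m) :
    (fun ε => column W F m γ p ε - ∑ r ∈ Finset.range (k + 1),
      ε ^ r / (r.factorial : ℝ) * depritTriangle W F 0 (p + r) x) =O[𝓝 0]
      fun ε : ℝ => ε ^ (k + 1) := by
  have h0 : ∀ p, column W F m γ p 0 = depritTriangle W F 0 p x := fun p => by
    rw [column, Finset.sum_range_succ']
    simp [hγ.init]
  have hd : ∀ p ≤ m, ∀ᶠ ε in 𝓝 (0 : ℝ),
      HasDerivAt (column W F m γ p) (columnDeriv W F m γ p ε) ε := fun p hp =>
    (hγ.flow.and (hγ.eventually_mem hx)).mono fun ε hε => hasDerivAt_column hW hF hp hε.2 hε.1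
  induction k generalizing p with
  | zero =>
    have h1 := (hd p (by omega)).self_of_nhds.isBigO_sub
    rw [h0] at h1
    simpa using h1
  | succ k ih =>
    have ih := ih (p + 1) (by omega)
    have hb := columnDeriv_sub_isBigO hW hF (p := p) (by omega) hγ hx
    rw [show m - p = k + 1 by omega] at hb
    refine isBigO_pow_succ_of_hasDerivAt (u' := fun ε => columnDeriv W F m γ p ε -
      ∑ r ∈ Finset.range (k + 1), ε ^ r / (r.factorial : ℝ) *
        depritTriangle W F 0 (p + 1 + r) x) ?_ ?_ ?_
    · refine (hd p (by omega)).mono fun ε hε => hε.sub ?_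
      simp only [Finset.sum_range_succ' _ (k + 1), pow_zero]
      have h1 := HasDerivAt.fun_sum (u := Finset.range (k + 1)) fun r _ =>
        (hasDerivAt_pow_div_factorial r ε).mul_const (depritTriangle W F 0 (p + (r + 1)) x)
      refine (h1.add_const _).congr_deriv ?_
      refine Finset.sum_congr rfl fun r _ => ?_
      rw [add_assoc p 1 r, add_comm 1 r]
    · refine (hb.add ih).congr_left fun ε => ?_
      ring
    · rw [h0, Finset.sum_range_succ']
      simp

/-- The expansion of a function along the flow is given by Deprit's triangle. -/
theorem sum_comp_sub_depritSum_isBigO (hW : ∀ j < m, ContDiffOn ℝ ∞ (W j) domain)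
    (hF : ∀ n, ContDiffOn ℝ ∞ (F n) domain) (hγ : IsLieTransform W m x γ) (hx : x ∈ domain) :
    (fun ε => ∑ n ∈ Finset.range (m + 1), ε ^ n / (n.factorial : ℝ) * F n (γ ε) -
      depritSum W F m ε x) =O[𝓝 0] fun ε : ℝ => ε ^ (m + 1) := by
  have h := column_sub_isBigO hW hF hγ hx m 0 (zero_add m)
  simpa only [column, Nat.sub_zero, depritTriangle, zero_add, depritSum, depritTransform] using h

end Flow

end RigidBody
end

noncomputable section

namespace RigidBody

open LieSeries

/-! ### The flow of the generator -/

theorem poisson_momL (h : Phase → ℝ) (x : Phase) : poisson Phase.momL h x = -partialEll h x := by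
  have h1 : partialEll Phase.momL x = 0 := deriv_const _ _
  have h2 : partialL Phase.momL x = 1 := deriv_id _
  have h3 : partialAng Phase.momL x = 0 := deriv_const _ _
  have h4 : partialG Phase.momL x = 0 := deriv_const _ _
  rw [poisson, h1, h2, h3, h4]
  ring

theorem poisson_momG (h : Phase → ℝ) (x : Phase) : poisson Phase.momG h x = -partialAng h x := by
  have h1 : partialEll Phase.momG x = 0 := deriv_const _ _
  have h2 : partialL Phase.momG x = 0 := deriv_const _ _
  have h3 : partialAng Phase.momG x = 0 := deriv_const _ _
  have h4 : partialG Phase.momG x = 1 := deriv_id _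
  rw [poisson, h1, h2, h3, h4]
  ring

theorem hamiltonianField_eq_poisson (F : Phase → ℝ) (x : Phase) :
    hamiltonianField F x = (poisson Phase.ell F x, poisson Phase.ang F x, poisson Phase.momL F x,
      poisson Phase.momG F x) := by
  rw [hamiltonianField, poisson_ell, poisson_ang, poisson_momL, poisson_momG]

theorem eventually_eq_of_hasDerivAt_zero {u : ℝ → ℝ}
    (h : ∀ᶠ ε in 𝓝 (0 : ℝ), HasDerivAt u 0 ε) : ∀ᶠ ε in 𝓝 (0 : ℝ), u ε = u 0 := by
  obtain ⟨r, hr, hball⟩ := Metric.eventually_nhds_iff_ball.1 h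
  refine Metric.eventually_nhds_iff_ball.2 ⟨r, hr, fun ε hε => ?_⟩
  exact Metric.isOpen_ball.is_const_of_deriv_eq_zero (convex_ball (0 : ℝ) r).isPreconnected
    (fun t ht => (hball t ht).differentiableAt.differentiableWithinAt)
    (fun t ht => (hball t ht).deriv) hε (Metric.mem_ball_self hr)

variable {W : ℕ → Phase → ℝ} {m : ℕ} {x : Phase}

theorem contDiff_ell : ContDiff ℝ ∞ Phase.ell := contDiff_fst
theorem contDiff_ang : ContDiff ℝ ∞ Phase.ang := contDiff_fst.comp contDiff_snd
theorem contDiff_momL : ContDiff ℝ ∞ Phase.momL :=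
  contDiff_fst.comp (contDiff_snd.comp contDiff_snd)
theorem contDiff_momG : ContDiff ℝ ∞ Phase.momG :=
  contDiff_snd.comp (contDiff_snd.comp contDiff_snd)

theorem contDiffOn_poisson_generator (hW : ∀ j < m, ContDiffOn ℝ ∞ (W j) domain) {u : Phase → ℝ}
    (hu : ContDiff ℝ ∞ u) : ContDiffOn ℝ ∞
      (fun y : ℝ × Phase => poisson u (generator W m y.1) y.2) (univ ×ˢ domain) := by
  have h : ContDiffOn ℝ ∞ (fun y : ℝ × Phase => ∑ j ∈ Finset.range m,
      y.1 ^ j / (j.factorial : ℝ) * poisson u (W j) y.2) (univ ×ˢ domain) := by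
    refine ContDiffOn.sum fun j hj => ?_
    have h1 : ContDiff ℝ ∞ fun y : ℝ × Phase => y.1 ^ j / (j.factorial : ℝ) :=
      (contDiff_fst.pow j).div_const _
    refine h1.contDiffOn.mul ?_
    exact (contDiffOn_poisson hu.contDiffOn (hW j (Finset.mem_range.1 hj))).comp
      contDiffOn_snd fun y hy => hy.2
  exact h.congr fun y hy => poisson_generator hW u y.1 hy.2

theorem exists_isLieTransform (hW : ∀ j < m, ContDiffOn ℝ ∞ (W j) domain) (hx : x ∈ domain) :
    ∃ γ : ℝ → Phase, IsLieTransform W m x γ := by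
  -- The generator depends on the time `ε`, so the time is adjoined as a coordinate with velocity
  -- `1`. The local existence theorem for autonomous fields then applies, and that coordinate is
  -- shown to equal `ε`.
  set V : ℝ × Phase → ℝ × Phase := fun y => (1, hamiltonianField (generator W m y.1) y.2) with hV
  have hsm : ContDiffOn ℝ ∞ V (univ ×ˢ domain) := by
    have e : V = fun y => (1, poisson Phase.ell (generator W m y.1) y.2,
        poisson Phase.ang (generator W m y.1) y.2, poisson Phase.momL (generator W m y.1) y.2,
        poisson Phase.momG (generator W m y.1) y.2) := by
      funext y
      exact Prod.ext rfl (hamiltonianField_eq_poisson _ _)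
    rw [e]
    exact contDiffOn_const.prodMk ((contDiffOn_poisson_generator hW contDiff_ell).prodMk
      ((contDiffOn_poisson_generator hW contDiff_ang).prodMk
        ((contDiffOn_poisson_generator hW contDiff_momL).prodMk
          (contDiffOn_poisson_generator hW contDiff_momG))))
  have hat : ContDiffAt ℝ 1 V (0, x) :=
    (hsm.contDiffAt ((isOpen_univ.prod isOpen_domain).mem_nhds ⟨mem_univ _, hx⟩)).of_le (by simp)
  obtain ⟨α, h0, r, hr, hα⟩ :=
    hat.exists_forall_mem_closedBall_exists_eq_forall_mem_Ioo_hasDerivAt₀ 0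
  have hev : ∀ᶠ ε in 𝓝 (0 : ℝ), HasDerivAt α (V (α ε)) ε :=
    Filter.mem_of_superset (Ioo_mem_nhds (by linarith) (by linarith)) hα
  have hfst : ∀ᶠ ε in 𝓝 (0 : ℝ), (α ε).1 = ε := by
    have h1 : ∀ᶠ ε in 𝓝 (0 : ℝ), HasDerivAt (fun ε => (α ε).1 - ε) 0 ε :=
      hev.mono fun ε hε => by
        have h : HasDerivAt (fun ε => (α ε).1) 1 ε :=
          (ContinuousLinearMap.fst ℝ ℝ Phase).hasFDerivAt.comp_hasDerivAt ε hε
        exact (h.sub (hasDerivAt_id ε)).congr_deriv (sub_self _)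
    refine (eventually_eq_of_hasDerivAt_zero h1).mono fun ε hε => ?_
    rw [h0] at hε
    simpa [sub_eq_zero] using hε
  refine ⟨fun ε => (α ε).2, by simp [h0], (hev.and hfst).mono fun ε hε => ?_⟩
  have h2 : HasDerivAt (fun ε => (α ε).2) (hamiltonianField (generator W m (α ε).1) (α ε).2) ε :=
    (ContinuousLinearMap.snd ℝ ℝ Phase).hasFDerivAt.comp_hasDerivAt ε hε.1
  rwa [hε.2] at h2

/-- The generator is free of `g`, so the conjugate momentum `G` has derivative zero along the flow.
-/
theorem momG_eq_of_isLieTransform (hW : ∀ j < m, ContDiffOn ℝ ∞ (W j) domain)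
    (hang : ∀ j < m, ∀ x ∈ domain, ∀ g : ℝ, W j (x.ell, g, x.momL, x.momG) = W j x)
    {γ : ℝ → Phase} (hγ : IsLieTransform W m x γ) (hx : x ∈ domain) :
    ∀ᶠ ε in 𝓝 (0 : ℝ), (γ ε).momG = x.momG := by
  have h1 : ∀ᶠ ε in 𝓝 (0 : ℝ), HasDerivAt (fun ε => (γ ε).momG) 0 ε := by
    filter_upwards [hγ.flow, hγ.eventually_mem hx] with ε hε hmem
    refine (hasDerivAt_comp_flow hε (contDiff_momG.contDiffAt.differentiableAt
      (by simp))).congr_deriv ?_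
    rw [poisson_generator hW _ _ hmem]
    refine Finset.sum_eq_zero fun j hj => ?_
    rw [poisson_momG, partialAng_eq_zero (hang j (Finset.mem_range.1 hj)) hmem, neg_zero, mul_zero]
  have h2 := eventually_eq_of_hasDerivAt_zero h1
  simpa only [hγ.init] using h2

/-! ### The series -/

theorem contDiffOn_constTerm {u : Phase → ℝ} (hu : ContDiff ℝ ∞ u) :
    ∀ n, ContDiffOn ℝ ∞ (constTerm u n) domain
  | 0 => hu.contDiffOn
  | _ + 1 => contDiffOn_const

theorem contDiffOn_hamiltonianTerm (C α β : ℝ) :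
    ∀ n, ContDiffOn ℝ ∞ (hamiltonianTerm C α β n) domain
  | 0 => by
    refine (contDiff_momG.pow 2 |>.div_const _).contDiffOn.mul (contDiffOn_const.add
      (contDiffOn_const.mul (contDiff_momL.contDiffOn.div contDiff_momG.contDiffOn ?_)))
    exact fun x hx => hx.2.ne'
  | 1 => by
    have h : ContDiff ℝ ∞ fun x : Phase => Real.cos (2 * x.ell) :=
      Real.contDiff_cos.comp (contDiff_const.mul contDiff_ell)
    exact ((((contDiff_momL.pow 2).div_const _).mul contDiff_const).mul
      (contDiff_const.add (contDiff_const.mul h))).neg.contDiffOn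
  | _ + 2 => contDiffOn_const

theorem depritSum_congr {W' : ℕ → Phase → ℝ} (H : ∀ j < m, EqOn (W j) (W' j) domain)
    (F : ℕ → Phase → ℝ) (ε : ℝ) (hx : x ∈ domain) : depritSum W F m ε x = depritSum W' F m ε x := by
  refine Finset.sum_congr rfl fun n hn => ?_
  have := Finset.mem_range.1 hn
  rw [depritTransform, depritTransform, depritTriangle_congr H F n 0 (by omega) hx]

theorem sum_constTerm (u : Phase → ℝ) (m : ℕ) (ε : ℝ) (x : Phase) :
    ∑ n ∈ Finset.range (m + 1), ε ^ n / (n.factorial : ℝ) * constTerm u n x = u x := by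
  rw [Finset.sum_range_succ']
  simp [constTerm]

theorem sum_hamiltonianTerm (C α β : ℝ) (m : ℕ) (ε : ℝ) (x : Phase) :
    ∑ n ∈ Finset.range (m + 2), ε ^ n / (n.factorial : ℝ) * hamiltonianTerm C α β n x =
      hamiltonianTerm C α β 0 x + ε * hamiltonianTerm C α β 1 x := by
  rw [Finset.sum_range_succ', Finset.sum_range_succ']
  simp [hamiltonianTerm]
  ring

variable {β : ℝ}

theorem pow_div_factorial_mul (ε a : ℝ) (n : ℕ) :
    ε ^ n / (n.factorial : ℝ) * (n.factorial * a) = ε ^ n * a := by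
  have : (n.factorial : ℝ) ≠ 0 := by positivity
  field_simp

theorem depritSum_momG (N : ℕ) (ε : ℝ) (hx : x ∈ domain) :
    depritSum (genW β) (constTerm Phase.momG) N ε x = x.momG := by
  rw [depritSum, Finset.sum_range_succ', Finset.sum_eq_zero]
  · simp [depritTransform_zero, constTerm]
  · intro n _
    rw [depritTransform_momG n hx, mul_zero]

theorem depritSum_ang {g : ℕ → ℕ → ℚ[X]}
    (hg : ∀ i, PowerSeries.coeff i tGam = -sinForm ((i + 1) / 2) (g i)) (N : ℕ) (ε : ℝ)
    (hx : x ∈ domain) :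
    depritSum (genW β) (constTerm Phase.ang) N ε x = gSeries β g N ε x := by
  rw [depritSum, Finset.sum_range_succ', gSeries, sum_Icc_one, depritTransform_zero, Finset.mul_sum,
    sub_eq_add_neg, ← Finset.sum_neg_distrib, add_comm]
  congr 1
  · simp [constTerm]
  · refine Finset.sum_congr rfl fun n _ => ?_
    rw [depritTransform_ang (hg (n + 1)) hx, mul_neg, pow_div_factorial_mul]
    ring

theorem depritSum_ell {l : ℕ → ℕ → ℚ[X]}
    (hl : ∀ i, PowerSeries.coeff i tLam = sinForm i (l i)) (N : ℕ) (ε : ℝ) (hx : x ∈ domain) :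
    depritSum (genW β) (constTerm Phase.ell) N ε x = ellSeries β l N ε x := by
  rw [depritSum, Finset.sum_range_succ', ellSeries, sum_Icc_one, depritTransform_zero, add_comm]
  congr 1
  · simp [constTerm]
  · refine Finset.sum_congr rfl fun n _ => ?_
    rw [depritTransform_ell (hl (n + 1)) hx, pow_div_factorial_mul]

theorem depritSum_momL {P : ℕ → ℕ → ℚ[X]}
    (hP : ∀ i, 1 ≤ i → PowerSeries.coeff i tU =
        ofPoly (X * P i 0) - (1 / 2 : ℚ) • cosForm ((i + 1) / 2) (P i)) (N : ℕ) (ε : ℝ)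
    (hx : x ∈ domain) :
    depritSum (genW β) (constTerm Phase.momL) N ε x = LSeries β P N ε x := by
  rw [depritSum, Finset.sum_range_succ', LSeries, sum_Icc_one, depritTransform_zero,
    Finset.mul_sum, add_comm]
  congr 1
  · simp [constTerm]
  · refine Finset.sum_congr rfl fun n _ => ?_
    rw [depritTransform_momL (hP (n + 1) (by omega)) hx, pow_div_factorial_mul]
    ring

theorem depritSum_hamiltonianTerm {q : ℕ → ℚ[X]}
    (hq : ∀ i, PowerSeries.coeff (i + 2) tK = -((1 / 2 : ℚ) • ofPoly (X * q (i + 1))))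
    (C α : ℝ) (h0 : 0 ≤ β) (h1 : β < 1) (N : ℕ) (ε : ℝ) (hx : x ∈ domain) :
    depritSum (genW β) (hamiltonianTerm C α β) (N + 1) ε x = averaged C α β q N ε x := by
  have e : ∀ n ∈ Finset.range N, ε ^ (n + 1 + 1) / ((n + 1 + 1).factorial : ℝ) *
      depritTransform (genW β) (hamiltonianTerm C α β) (n + 1 + 1) x =
      -(α * x.momL ^ 2 / (2 * C) * β ^ 2 * ε) * (ε ^ (n + 1) *
        (deltaPrime β x ^ (n + 1) * triax (q (n + 1)) β)) := fun n _ => by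
    rw [depritTransform_hamiltonianTerm_succ C α h0 h1 (hq n) hx, mul_neg, pow_div_factorial_mul]
    ring
  have hG : x.momG ≠ 0 := hx.2.ne'
  rw [depritSum, Finset.sum_range_succ', Finset.sum_range_succ', Finset.sum_congr rfl e,
    ← Finset.mul_sum, averaged, sum_Icc_one, depritTransform_zero, zero_add,
    depritTransform_hamiltonianTerm_one C α h0 h1 hx]
  generalize ∑ n ∈ Finset.range N,
    ε ^ (n + 1) * (deltaPrime β x ^ (n + 1) * triax (q (n + 1)) β) = S
  have e2 : ∀ a : ℝ, x.momG ^ 2 / (2 * C) * (a * (x.momL ^ 2 / x.momG ^ 2)) =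
      a * x.momL ^ 2 / (2 * C) := fun a => by field_simp
  have e3 := e2 (α * (1 + β ^ 2 * S) * ε)
  simp only [hamiltonianTerm, Nat.factorial_one, Nat.cast_one, pow_one, pow_zero,
    Nat.factorial_zero]
  linear_combination e3

end RigidBody
end

/-! ### The main theorem -/

theorem mainTheorem3 :
    ∃ (q : ℕ → Polynomial ℚ) (g l P : ℕ → ℕ → Polynomial ℚ),
      -- the explicit triaxiality polynomials
      (∀ i, 1 ≤ i → i ≤ 10 → q i = RigidBody.ofCoeffs (RigidBody.qTable i)) ∧
      (∀ i m, 1 ≤ i → i ≤ 9 → 1 ≤ m → m ≤ (i + 1) / 2 →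
        g i m = RigidBody.ofCoeffs ((RigidBody.gTable i).getD (m - 1) [])) ∧
      (∀ i m, 1 ≤ i → i ≤ 9 → 1 ≤ m → m ≤ i →
        l i m = RigidBody.ofCoeffs ((RigidBody.ellTable i).getD (m - 1) [])) ∧
      (∀ i m, 1 ≤ i → i ≤ 9 → m ≤ (i + 1) / 2 →
        P i m = RigidBody.ofCoeffs ((RigidBody.LTable i).getD m [])) ∧
      ∀ C α β : ℝ, 0 < C → 0 < α → 0 ≤ β → β < 1 →
        -- the normalization exists to all orders
        (∃ W : ℕ → RigidBody.Phase → ℝ, ∀ N, RigidBody.IsDepritNormalization C α β N W) ∧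
        ∀ (N : ℕ) (W : ℕ → RigidBody.Phase → ℝ),
          RigidBody.IsDepritNormalization C α β (N + 1) W →
          ∀ x ∈ RigidBody.domain,
            -- averaged Hamiltonian and transformation equations given by Deprit's algorithm
            (∀ ε : ℝ,
              RigidBody.depritSum W (RigidBody.hamiltonianTerm C α β) (N + 1) ε x
                = RigidBody.averaged C α β q N ε x ∧
              RigidBody.depritSum W (RigidBody.constTerm RigidBody.Phase.momG) (N + 1) ε x
                = x.momG ∧
              RigidBody.depritSum W (RigidBody.constTerm RigidBody.Phase.ang) (N + 1) ε x
                = RigidBody.gSeries β g (N + 1) ε x ∧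
              RigidBody.depritSum W (RigidBody.constTerm RigidBody.Phase.ell) (N + 1) ε x
                = RigidBody.ellSeries β l (N + 1) ε x ∧
              RigidBody.depritSum W (RigidBody.constTerm RigidBody.Phase.momL) (N + 1) ε x
                = RigidBody.LSeries β P (N + 1) ε x) ∧
            -- they are the expansions of the canonical transformation generated by `W`
            -- and of the Hamiltonian in the new variables
            (∃ γ : ℝ → RigidBody.Phase, RigidBody.IsLieTransform W (N + 1) x γ) ∧
            ∀ γ : ℝ → RigidBody.Phase, RigidBody.IsLieTransform W (N + 1) x γ →
              (fun ε => RigidBody.hamiltonianK C α β ε (γ ε) - RigidBody.averaged C α β q N ε x)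
                =O[𝓝 0] (fun ε : ℝ => ε ^ (N + 2)) ∧
              (∀ᶠ ε in 𝓝 (0 : ℝ), (γ ε).momG = x.momG) ∧
              (fun ε => (γ ε).ang - RigidBody.gSeries β g (N + 1) ε x)
                =O[𝓝 0] (fun ε : ℝ => ε ^ (N + 2)) ∧
              (fun ε => (γ ε).ell - RigidBody.ellSeries β l (N + 1) ε x)
                =O[𝓝 0] (fun ε : ℝ => ε ^ (N + 2)) ∧
              (fun ε => (γ ε).momL - RigidBody.LSeries β P (N + 1) ε x)
                =O[𝓝 0] (fun ε : ℝ => ε ^ (N + 2)) := by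
  obtain ⟨q, g, l, P, hq, hg, hl, hP, hK, hGam, hLam, hU⟩ :=
    RigidBody.exists_triaxiality_polynomials
  refine ⟨q, g, l, P, hq, fun i m h1 h2 _ _ => hg i m h1 h2, fun i m h1 h2 _ _ => hl i m h1 h2,
    fun i m h1 h2 _ => hP i m h1 h2, ?_⟩
  intro C α β hC hα h0 h1
  refine ⟨⟨RigidBody.genW β, RigidBody.isDepritNormalization_genW C α h0 h1⟩, ?_⟩
  intro N W hW x hx
  -- Uniqueness transfers every formula proved for the explicit generator to an arbitrary
  -- normalization `W`.
  have hE := hW.eqOn hC hα h0 h1 (RigidBody.isDepritNormalization_genW C α h0 h1 (N + 1))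
  have sK := fun ε => (RigidBody.depritSum_congr hE (RigidBody.hamiltonianTerm C α β) ε hx).trans
    (RigidBody.depritSum_hamiltonianTerm hK C α h0 h1 N ε hx)
  have sg := fun ε => (RigidBody.depritSum_congr hE (RigidBody.constTerm RigidBody.Phase.ang) ε
    hx).trans (RigidBody.depritSum_ang hGam (N + 1) ε hx)
  have sl := fun ε => (RigidBody.depritSum_congr hE (RigidBody.constTerm RigidBody.Phase.ell) ε
    hx).trans (RigidBody.depritSum_ell hLam (N + 1) ε hx)
  have sL := fun ε => (RigidBody.depritSum_congr hE (RigidBody.constTerm RigidBody.Phase.momL) ε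
    hx).trans (RigidBody.depritSum_momL hU (N + 1) ε hx)
  refine ⟨fun ε => ⟨sK ε, (RigidBody.depritSum_congr hE _ ε hx).trans
    (RigidBody.depritSum_momG (N + 1) ε hx), sg ε, sl ε, sL ε⟩,
    RigidBody.exists_isLieTransform hW.smooth hx, fun γ hγ => ?_⟩
  have expand : ∀ u : RigidBody.Phase → ℝ, ContDiff ℝ ∞ u →
      (fun ε => u (γ ε) - RigidBody.depritSum W (RigidBody.constTerm u) (N + 1) ε x)
        =O[𝓝 0] fun ε : ℝ => ε ^ (N + 2) := fun u hu =>
    (RigidBody.sum_comp_sub_depritSum_isBigO hW.smooth (RigidBody.contDiffOn_constTerm hu) hγ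
      hx).congr_left fun ε => by rw [RigidBody.sum_constTerm]
  refine ⟨?_, RigidBody.momG_eq_of_isLieTransform hW.smooth hW.ang_free hγ hx,
    (expand _ RigidBody.contDiff_ang).congr_left fun ε => by rw [sg],
    (expand _ RigidBody.contDiff_ell).congr_left fun ε => by rw [sl],
    (expand _ RigidBody.contDiff_momL).congr_left fun ε => by rw [sL]⟩
  -- The Hamiltonian equals `H_0 + ε H_1` only on the domain, where `G` does not vanish. The flow
  -- stays there for small `ε`, so the comparison is made eventually.
  refine (RigidBody.sum_comp_sub_depritSum_isBigO hW.smooth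
    (RigidBody.contDiffOn_hamiltonianTerm C α β) hγ hx).congr' ?_ EventuallyEq.rfl
  filter_upwards [hγ.eventually_mem hx] with ε hε
  rw [RigidBody.sum_hamiltonianTerm, sK, RigidBody.hamiltonianK_eq h0 h1 ε hε]
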